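/- **Words and products.** Let $\mathfrak H^1=\mathbb Q\langle z_k\mid k\ge 1\rangle$, and let $\mathbf 1$ be the empty word. The stuffle product $*$ and the shuffle product ${\sqcup\mkern-3mu\sqcup}$ on $\mathfrak H^1$ are the bilinear products with unit $\mathbf 1$ and $$z_iu\star z_jv=z_i(u\star z_jv)+z_j(z_iu\star v)+(z_i\diamond z_j)(u\star v),$$ where $z_i\diamond z_j=z_{i+j}$ for $\star=*$ and $z_i\diamond z_j=0$ for $\star={\sqcup\mkern-3mu\sqcup}$ (the letters being the $z_k$ in both cases). **Multiple zeta values.** For $k_1\ge2$, $k_2,\dots,k_r\ge1$ put $\zeta(k_1,\dots,k_r)=\sum_{m_1>\dots>m_r>0}m_1^{-k_1}\cdots m_r^{-k_r}$. For all $k_1,\dots,k_r\ge1$ let $\zeta^*(k_1,\dots,k_r)\in\mathbb R$ be the stuffle regularized multiple zeta values: $z_{k_1}\cdots z_{k_r}\mapsto\zeta^*(k_1,\dots,k_r)$ is the unique algebra homomorphism $(\mathfrak H^1,*)\to\mathbb R$ with $\zeta^*(1)=0$ which agrees with $\zeta$ whenever $k_1\ge2$. **Moulds.** A mould $Z$ with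 values in a commutative $\mathbb Q$-algebra $A$ is a family of power series $Z(X_1,\dots,X_r)\in A[[X_1,\dots,X_r]]$, $r\ge0$, here always with $Z=1$ for $r=0$. Its coefficients are defined by $Z(X_1,\dots,X_r)=\sum z(k_1,\dots,k_r)X_1^{k_1-1}\cdots X_r^{k_r-1}$. Products are $(Z_1\times Z_2)(X_1,\dots,X_r)=\sum_{j=0}^rZ_1(X_1,\dots,X_j)Z_2(X_{j+1},\dots,X_r)$. Put $Z^\sharp(X_1,\dots,X_r)=Z(X_1+\dots+X_r,\dots,X_1+X_2,X_1)$, $Z^-(X_1,\dots,X_r)=Z(-X_1,\dots,-X_r)$ and $Z_\gamma=Z^\sharp\times\Gamma^Z$, where a power series $\sum a_rT^r$ is regarded as the mould which is the constant $a_r$ in depth $r$, and $\Gamma^Z=\exp\big(\sum_{n\ge2}\frac{(-1)^n}{n}z(n)T^n\big)$. The mould $Z$ satisfies the *extended double shuffle equations* if $z_{k_1}\cdots z_{k_r}\mapsto z(k_1,\dots,k_r)$ is a unital algebra homomorphism $(\mathfrak H^1,*)\to A$ and the map on $\mathfrak H^1$ defined in the same way by the coefficients of $Z_\gamma$ is a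 unital algebra homomorphism $(\mathfrak H^1,{\sqcup\mkern-3mu\sqcup})\to A$. A bimould is a family of power series $B\binom{X_1,\dots,X_r}{Y_1,\dots,Y_r}$, $r\ge 0$, equal to $1$ for $r=0$; products of bimoulds (and constant bimoulds) are defined as for moulds. For a mould $Z$ put $X^Z\binom{X_1,\dots,X_r}{Y_1,\dots,Y_r}=Z(X_1,\dots,X_r)$ and $Y^Z\binom{X_1,\dots,X_r}{Y_1,\dots,Y_r}=Z(Y_1,\dots,Y_r)$. **Combinatorial multiple Eisenstein series.** Let $\mathfrak b$ be a $\mathbb Q$-valued mould, with coefficients $\beta(k_1,\dots,k_r)$, which satisfies the extended double shuffle equations and is in depth one given by $\beta(1)=0$ and $\beta(k)=-\frac{B_k}{2\,k!}$ for $k\ge2$, with $B_k$ the Bernoulli numbers. Denote also by $\mathfrak b$ the bimould $Y^{\mathfrak b_\gamma}\times X^{\mathfrak b}$, and put $\tilde{\mathfrak b}=Y^{\mathfrak b_\gamma^-}\times\exp(-\tfrac T2)\times X^{\mathfrak b}$. For $m\ge1$ put $L_m\binom XY=\frac{e^{X+mY}q^m}{1-e^Xq^m}$ and, for $r\ge1$,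 $$\mathfrak L_m\tbinom{X_1,\dots,X_r}{Y_1,\dots,Y_r}=\sum_{j=1}^r\mathfrak b\tbinom{X_1-X_j,\dots,X_{j-1}-X_j}{Y_1,\dots,Y_{j-1}}\,L_m\tbinom{X_j}{Y_1+\dots+Y_r}\,\tilde{\mathfrak b}\tbinom{X_r-X_j,\dots,X_{j+1}-X_j}{Y_r,\dots,Y_{j+1}},$$ $$\mathfrak g^*\tbinom{X_1,\dots,X_r}{Y_1,\dots,Y_r}=\sum_{\substack{1\le j\le r\\0=r_0<r_1<\dots<r_j=r\\m_1>\dots>m_j>0}}\ \prod_{i=1}^j\mathfrak L_{m_i}\tbinom{X_{r_{i-1}+1},\dots,X_{r_i}}{Y_{r_{i-1}+1},\dots,Y_{r_i}}.$$ The combinatorial multiple Eisenstein series $G(k_1,\dots,k_r)\in\mathbb Q[[q]]$ (which depend on the choice of $\mathfrak b$) are the coefficients of $X_1^{k_1-1}\cdots X_r^{k_r-1}Y_1^0\cdots Y_r^0$ in the $\mathbb Q[[q]]$-valued bimould $\mathfrak G=\mathfrak g^*\times\mathfrak b$. **Proposition 5.13.** Let $k\ge4$ and let $\epsilon_{k_1,\dots,k_r}\in\mathbb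 Q$ for all $r\ge1$ and $k_1,\dots,k_r\ge1$ with $k_1+\dots+k_r=k$. If the $q$-series $$\sum_{\substack{1\le r\le k\\k_1+\dots+k_r=k}}\epsilon_{k_1,\dots,k_r}\,G(k_1,\dots,k_r)$$ is, with $q=e^{2\pi i\tau}$, a modular form of weight $k$ for $\mathrm{SL}_2(\mathbb Z)$, then $$\sum_{\substack{1\le r\le k\\k_1+\dots+k_r=k}}\epsilon_{k_1,\dots,k_r}\,\zeta^*(k_1,\dots,k_r)=(2\pi i)^k\sum_{\substack{1\le r\le k\\k_1+\dots+k_r=k}}\epsilon_{k_1,\dots,k_r}\,\beta(k_1,\dots,k_r).$$ In particular, if $\epsilon_{k_1,\dots,k_r}=0$ whenever $k_1=1$, the values $\zeta^*(k_1,\dots,k_r)$ that occur are the multiple zeta values $\zeta(k_1,\dots,k_r)$. -/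

import Mathlib

namespace CMES

/-! ### Quasi-shuffle products

A word over the alphabet `α` is a `List α`.  A product of two words is a formal sum of words with
non-negative integer coefficients; it is recorded as the list of its words, with multiplicity.
The product `a ⋄ b` of two letters is likewise a formal sum of letters, recorded as a list. -/

/-- The quasi-shuffle product of two words, for the product `d` on letters:
`1 * w = w * 1 = w` and
`a u * b v = a (u * b v) + b (a u * v) + (a ⋄ b) (u * v)`. -/
def quasiShuffle {α : Type*} (d : α → α → List α) : List α → List α → List (List α)
  | [], v => [v]
  | a :: u, [] => [a :: u]
  | a :: u, b :: v =>
      (quasiShuffle d u (b :: v)).map (List.cons a)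
        ++ (quasiShuffle d (a :: u) v).map (List.cons b)
        ++ (d a b).flatMap fun c => (quasiShuffle d u v).map (List.cons c)
  termination_by u v => u.length + v.length

/-- The stuffle (harmonic) product on the alphabet `z_k`, `k ≥ 1`: `z_i ⋄ z_j = z_{i+j}`.
The letter `z_k` is represented by `k : ℕ+`. -/
def stuffle : List ℕ+ → List ℕ+ → List (List ℕ+) := quasiShuffle fun i j => [i + j]

/-- The shuffle product on the alphabet `z_k`, `k ≥ 1`: `z_i ⋄ z_j = 0`. -/
def shuffle : List ℕ+ → List ℕ+ → List (List ℕ+) := quasiShuffle fun _ _ => []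

/-- The linear extension to `ℚ⟨z_k | k ≥ 1⟩` of a map on words is a unital algebra homomorphism for
the product `p` (as `p` is bilinear, this only has to be said for words). -/
def IsWordHom {A : Type*} [Semiring A] (p : List ℕ+ → List ℕ+ → List (List ℕ+))
    (φ : List ℕ+ → A) : Prop :=
  φ [] = 1 ∧ ∀ u v : List ℕ+, φ u * φ v = ((p u v).map φ).sum

/-! ### Moulds -/

/-- A mould with values in `A`: a power series in `X_1, …, X_r` for every depth `r ≥ 0`. -/
abbrev Mould (A : Type*) := (r : ℕ) → MvPowerSeries (Fin r) A

/-- The exponent of `X_1^{k_1-1} ⋯ X_r^{k_r-1}`. -/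
noncomputable def expo (w : List ℕ+) : Fin w.length →₀ ℕ :=
  Finsupp.equivFunOnFinite.symm fun i => (w.get i : ℕ) - 1

namespace Mould

variable {A : Type*} [CommRing A]

/-- The coefficients `z(k_1,…,k_r)` of a mould:
`Z(X_1,…,X_r) = ∑ z(k_1,…,k_r) X_1^{k_1-1} ⋯ X_r^{k_r-1}`. -/
noncomputable def coeff (Z : Mould A) (w : List ℕ+) : A :=
  MvPowerSeries.coeff (expo w) (Z w.length)

/-- `Z(x_1,…,x_r)`, for power series `x_1,…,x_r` (only used without constant terms). -/
noncomputable def app {τ : Type*} (Z : Mould A) (l : List (MvPowerSeries τ A)) :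
    MvPowerSeries τ A :=
  MvPowerSeries.subst (fun i : Fin l.length => l.get i) (Z l.length)

/-- The list of variables `X_1, …, X_r`. -/
noncomputable def vars (A : Type*) [CommRing A] (r : ℕ) : List (MvPowerSeries (Fin r) A) :=
  List.ofFn fun i => MvPowerSeries.X i

/-- `(Z₁ × Z₂)(X_1,…,X_r) = ∑_{j=0}^r Z₁(X_1,…,X_j) Z₂(X_{j+1},…,X_r)`. -/
noncomputable def prod (Z₁ Z₂ : Mould A) : Mould A := fun r =>
  ∑ j ∈ Finset.range (r + 1), Z₁.app ((vars A r).take j) * Z₂.app ((vars A r).drop j)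

/-- `Z^♯(X_1,…,X_r) = Z(X_1+⋯+X_r, …, X_1+X_2, X_1)`. -/
noncomputable def sharp (Z : Mould A) : Mould A := fun r =>
  Z.app (List.ofFn fun i : Fin r =>
    ∑ j ∈ Finset.univ.filter (fun j : Fin r => (j : ℕ) + i < r), MvPowerSeries.X j)

/-- `Z^-(X_1,…,X_r) = Z(-X_1,…,-X_r)`. -/
noncomputable def neg (Z : Mould A) : Mould A := fun r =>
  Z.app (List.ofFn fun i : Fin r => -MvPowerSeries.X i)

/-- The constant mould attached to the power series `∑ a_r T^r`. -/
noncomputable def const (F : PowerSeries A) : Mould A := fun r =>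
  MvPowerSeries.C (PowerSeries.coeff r F)

/-- `Γ^Z = exp (∑_{n ≥ 2} (-1)^n / n · z(n) T^n)`. -/
noncomputable def Gam [Algebra ℚ A] (Z : Mould A) : PowerSeries A :=
  PowerSeries.subst
    (PowerSeries.mk fun n : ℕ =>
      if 2 ≤ n then algebraMap ℚ A ((-1) ^ n / n) * Z.coeff [n.toPNat'] else 0)
    (PowerSeries.exp A)

/-- `Z_γ = Z^♯ × Γ^Z`. -/
noncomputable def gam [Algebra ℚ A] (Z : Mould A) : Mould A := Z.sharp.prod (const Z.Gam)

/-- A mould is symmetril if its coefficient map is a homomorphism for the stuffle product. -/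
def IsSymmetril (Z : Mould A) : Prop := IsWordHom stuffle Z.coeff

/-- A mould is symmetral if its coefficient map is a homomorphism for the shuffle product. -/
def IsSymmetral (Z : Mould A) : Prop := IsWordHom shuffle Z.coeff

/-- The extended double shuffle equations: `Z` is symmetril and `Z_γ` is symmetral. -/
def SatisfiesEDS [Algebra ℚ A] (Z : Mould A) : Prop := Z.IsSymmetril ∧ Z.gam.IsSymmetral

end Mould

/-! ### Bimoulds -/

/-- A bimould with values in `A`: a power series in `X_1, …, X_r` (the variables `Sum.inl i`) and
`Y_1, …, Y_r` (the variables `Sum.inr i`) for every depth `r ≥ 0`. -/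
abbrev Bimould (A : Type*) := (r : ℕ) → MvPowerSeries (Fin r ⊕ Fin r) A

namespace Bimould

variable {A : Type*} [CommRing A]

/-- `B(x_1,…,x_r; y_1,…,y_r)`, where the argument is the list of the pairs `(x_i, y_i)` of power
series (only used without constant terms). -/
noncomputable def app {τ : Type*} (B : Bimould A)
    (l : List (MvPowerSeries τ A × MvPowerSeries τ A)) : MvPowerSeries τ A :=
  MvPowerSeries.subst
    (Sum.elim (fun i : Fin l.length => (l.get i).1) (fun i : Fin l.length => (l.get i).2))
    (B l.length)

/-- The list of pairs of variables `(X_1, Y_1), …, (X_r, Y_r)`. -/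
noncomputable def vars (A : Type*) [CommRing A] (r : ℕ) :
    List (MvPowerSeries (Fin r ⊕ Fin r) A × MvPowerSeries (Fin r ⊕ Fin r) A) :=
  List.ofFn fun i => (MvPowerSeries.X (Sum.inl i), MvPowerSeries.X (Sum.inr i))

/-- The product of bimoulds
`(B × C)(X; Y) = ∑_{j=0}^r B(X_1,…,X_j; Y_1,…,Y_j) C(X_{j+1},…,X_r; Y_{j+1},…,Y_r)`. -/
noncomputable def prod (B C : Bimould A) : Bimould A := fun r =>
  ∑ j ∈ Finset.range (r + 1), B.app ((vars A r).take j) * C.app ((vars A r).drop j)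

/-- `X^Z(X; Y) = Z(X_1,…,X_r)`. -/
noncomputable def ofX (Z : Mould A) : Bimould A := fun r => Z.app ((vars A r).map Prod.fst)

/-- `Y^Z(X; Y) = Z(Y_1,…,Y_r)`. -/
noncomputable def ofY (Z : Mould A) : Bimould A := fun r => Z.app ((vars A r).map Prod.snd)

/-- The constant bimould attached to the power series `∑ a_r T^r`. -/
noncomputable def const (F : PowerSeries A) : Bimould A := fun r =>
  MvPowerSeries.C (PowerSeries.coeff r F)

/-- Extension of scalars. -/
noncomputable def map {A' : Type*} [CommRing A'] (f : A →+* A') (B : Bimould A) : Bimould A' :=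
  fun r => MvPowerSeries.map f (B r)

end Bimould

/-! ### Combinatorial multiple Eisenstein series -/

/-- The bimould `𝔟 = Y^{𝔟_γ} × X^𝔟` of a rational mould, with its values read in `ℚ⟦q⟧`. -/
noncomputable def bimouldB (b : Mould ℚ) : Bimould (PowerSeries ℚ) :=
  ((Bimould.ofY b.gam).prod (Bimould.ofX b)).map PowerSeries.C

/-- The bimould `𝔟̃ = Y^{𝔟_γ^-} × exp(-T/2) × X^𝔟`, with its values read in `ℚ⟦q⟧`. -/
noncomputable def bimouldBTilde (b : Mould ℚ) : Bimould (PowerSeries ℚ) :=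
  (((Bimould.ofY b.gam.neg).prod
      (Bimould.const (PowerSeries.rescale (-1 / 2 : ℚ) (PowerSeries.exp ℚ)))).prod
    (Bimould.ofX b)).map PowerSeries.C

/-- `exp(x)` for a power series `x` without constant term, with coefficients in `ℚ⟦q⟧`. -/
noncomputable def expSeries {τ : Type*} (x : MvPowerSeries τ (PowerSeries ℚ)) :
    MvPowerSeries τ (PowerSeries ℚ) :=
  PowerSeries.subst x (PowerSeries.exp (PowerSeries ℚ))

/-- `q^m` as a constant power series over `ℚ⟦q⟧`. -/
noncomputable def qPow {τ : Type*} (m : ℕ) : MvPowerSeries τ (PowerSeries ℚ) :=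
  MvPowerSeries.C (PowerSeries.X ^ m)

/-- `L_m(x; y) = e^{x + m y} q^m / (1 - e^x q^m)`; the denominator is invertible for `m ≥ 1`. -/
noncomputable def seriesL {τ : Type*} (m : ℕ) (x y : MvPowerSeries τ (PowerSeries ℚ)) :
    MvPowerSeries τ (PowerSeries ℚ) :=
  expSeries (x + m • y) * qPow m * Ring.inverse (1 - expSeries x * qPow m)

/-- The bimould `𝔏_m`, in depth `r ≥ 1`
`∑_{j=1}^r 𝔟(X_1-X_j,…,X_{j-1}-X_j; Y_1,…,Y_{j-1}) L_m(X_j; Y_1+⋯+Y_r)`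
`  𝔟̃(X_r-X_j,…,X_{j+1}-X_j; Y_r,…,Y_{j+1})`,
and `1` in depth `0`. -/
noncomputable def bimouldL (b : Mould ℚ) (m : ℕ) : Bimould (PowerSeries ℚ)
  | 0 => 1
  | r + 1 =>
    ∑ j : Fin (r + 1),
      let v := (Bimould.vars (PowerSeries ℚ) (r + 1)).map
        fun p => (p.1 - MvPowerSeries.X (Sum.inl j), p.2)
      (bimouldB b).app (v.take j)
        * seriesL m (MvPowerSeries.X (Sum.inl j)) (∑ i, MvPowerSeries.X (Sum.inr i))
        * (bimouldBTilde b).app (v.drop (j + 1)).reverse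

/-- The bimould `𝔤*`.  The summation indices `0 = r_0 < r_1 < ⋯ < r_j = r` are the compositions `c`
of `r`; the block number `i` of `c` is `r_{i-1}+1, …, r_i`.  The sum over `m_1 > ⋯ > m_j > 0` is
taken coefficientwise: the summand is divisible by `q^{m_1}`, so that for each coefficient of each
`q^n` only finitely many of its terms are non-zero. -/
noncomputable def bimouldGStar (b : Mould ℚ) : Bimould (PowerSeries ℚ) := fun r e =>
  PowerSeries.mk fun n =>
    ∑ c : Composition r,
      ∑ᶠ m : {m : Fin c.length → ℕ // StrictAnti m ∧ ∀ i, 0 < m i},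
        PowerSeries.coeff n (MvPowerSeries.coeff e
          (∏ i : Fin c.length, (bimouldL b (m.1 i)).app
            (List.ofFn fun s : Fin (c.blocksFun i) =>
              ((MvPowerSeries.X (Sum.inl (c.embedding i s)),
                MvPowerSeries.X (Sum.inr (c.embedding i s))) :
                MvPowerSeries (Fin r ⊕ Fin r) (PowerSeries ℚ) ×
                  MvPowerSeries (Fin r ⊕ Fin r) (PowerSeries ℚ)))))

/-- The bimould `𝔊 = 𝔤* × 𝔟`. -/
noncomputable def bimouldG (b : Mould ℚ) : Bimould (PowerSeries ℚ) :=
  (bimouldGStar b).prod (bimouldB b)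

/-- The combinatorial multiple Eisenstein series `G(k_1,…,k_r) ∈ ℚ⟦q⟧`: the coefficient of
`X_1^{k_1-1} ⋯ X_r^{k_r-1} Y_1^0 ⋯ Y_r^0` in `𝔊`. -/
noncomputable def G (b : Mould ℚ) (w : List ℕ+) : PowerSeries ℚ :=
  MvPowerSeries.coeff (Finsupp.sumElim (expo w) 0) (bimouldG b w.length)

/-! ### Multiple zeta values -/

/-- `ζ(k_1,…,k_r) = ∑_{m_1 > ⋯ > m_r > 0} m_1^{-k_1} ⋯ m_r^{-k_r}`; this is only used for the empty
word (with value `1`) and for `k_1 ≥ 2`, where the series converges. -/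
noncomputable def mzv (w : List ℕ+) : ℝ :=
  ∑' m : {m : Fin w.length → ℕ // StrictAnti m ∧ ∀ i, 0 < m i},
    ∏ i, ((m.1 i : ℝ) ^ (w.get i : ℕ))⁻¹

/-- The number `n` of leading letters `z_1` of a word. -/
def leadingOnes (w : List ℕ+) : ℕ := (w.takeWhile fun k => decide (k = 1)).length

/-- The stuffle regularized multiple zeta values.  If `k_1 ≥ 2` then `ζ*(w) = ζ(w)`.  If `w = z_1 v`
has `n ≥ 1` leading letters `z_1`, then `z_1 * v` is `n w` plus words with fewer than `n` leading
letters `z_1`, and `ζ*(z_1) = 0` forces `0 = n ζ*(w) + ∑ ζ*(u)`, the sum over these other words `u`.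
That this is the only possible value is `eq_zetaStar` below. -/
noncomputable def zetaStar (w : List ℕ+) : ℝ :=
  if leadingOnes w = 0 then mzv w
  else -(1 / (leadingOnes w : ℝ)) *
    (((stuffle [1] w.tail).filter fun u => decide (leadingOnes u < leadingOnes w)).attach.map
      fun u => zetaStar u.1).sum
  termination_by leadingOnes w
  decreasing_by
    have h := (List.mem_filter.mp u.2).2
    simpa using h

@[simp] lemma leadingOnes_nil : leadingOnes [] = 0 := rfl

lemma leadingOnes_cons_one (v : List ℕ+) : leadingOnes (1 :: v) = leadingOnes v + 1 := by
  simp [leadingOnes]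

lemma leadingOnes_cons_ne {b : ℕ+} (hb : b ≠ 1) (v : List ℕ+) : leadingOnes (b :: v) = 0 := by
  simp [leadingOnes, hb]

lemma stuffle_one_cons (b : ℕ+) (v : List ℕ+) :
    stuffle [1] (b :: v) =
      (1 :: b :: v) :: ((stuffle [1] v).map (List.cons b) ++ [(1 + b) :: v]) := by
  simp [stuffle, quasiShuffle]

lemma sum_stuffle_one (φ : List ℕ+ → ℝ) (v : List ℕ+) :
    ((stuffle [1] v).map φ).sum = ((leadingOnes v + 1 : ℕ) : ℝ) * φ (1 :: v) +
      (((stuffle [1] v).filter fun u => decide (leadingOnes u < leadingOnes v + 1)).map φ).sum := by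
  induction v generalizing φ with
  | nil => simp [stuffle, quasiShuffle, leadingOnes]
  | cons b v ih =>
    have h1 : (1 + b : ℕ+) ≠ 1 := by
      intro h
      have := congrArg PNat.val h
      have hb := b.pos
      simp at this
    rw [stuffle_one_cons]
    by_cases hb : b = 1
    · subst hb
      have := ih (φ ∘ List.cons 1)
      simp only [List.map_cons, List.map_append, List.map_map, List.sum_cons, List.sum_append,
        List.filter_cons, List.filter_append, List.filter_map, leadingOnes_cons_one,
        leadingOnes_cons_ne h1] at this ⊢
      rw [this]
      simp [Function.comp_def, leadingOnes_cons_one]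
      ring
    · simp [List.filter_append, List.filter_map, leadingOnes_cons_one,
        leadingOnes_cons_ne h1, leadingOnes_cons_ne hb, Function.comp_def]

/-- `zetaStar` is the only map on words that is a homomorphism for the stuffle product, agrees with
the multiple zeta values for `k_1 ≥ 2`, and sends `z_1` to `0`. -/
theorem eq_zetaStar (φ : List ℕ+ → ℝ) (hφ : IsWordHom stuffle φ)
    (h0 : ∀ w : List ℕ+, leadingOnes w = 0 → φ w = mzv w) (h1 : φ [1] = 0) (w : List ℕ+) :
    φ w = zetaStar w := by
  induction hn : leadingOnes w using Nat.strong_induction_on generalizing w with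
  | _ n ih =>
    subst hn
    rw [zetaStar]
    split_ifs with h
    · exact h0 w h
    · obtain ⟨v, rfl⟩ : ∃ v, w = 1 :: v := by
        cases w with
        | nil => exact absurd rfl h
        | cons b v =>
          by_cases hb : b = 1
          · exact ⟨v, by rw [hb]⟩
          · exact absurd (leadingOnes_cons_ne hb v) h
      have key := hφ.2 [1] v
      rw [h1, zero_mul, sum_stuffle_one] at key
      have hl : leadingOnes (1 :: v) = leadingOnes v + 1 := leadingOnes_cons_one v
      have hs : (((stuffle [1] (1 :: v).tail).filter
          fun u => decide (leadingOnes u < leadingOnes (1 :: v))).attach.map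
            fun u => zetaStar u.1).sum =
          (((stuffle [1] v).filter fun u => decide (leadingOnes u < leadingOnes v + 1)).map φ).sum := by
        rw [hl, List.tail_cons, List.attach_map_val (f := zetaStar)]
        congr 1
        apply List.map_congr_left
        intro u hu
        have := (List.mem_filter.mp hu).2
        exact (ih _ (by rw [hl]; simpa using this) u rfl).symm
      rw [hs, hl]
      have hne : ((leadingOnes v + 1 : ℕ) : ℝ) ≠ 0 := by positivity
      field_simp
      linarith

end CMES

/-! Put `q = e^{-t}` and let `t → 0+`. The form takes this value of `q` at `τ = it/2π`, and `S`
sends `τ` to `2πi/t`, so modularity gives `t^k f(τ) = (-2πi)^k f(-1/τ) → (-2πi)^k a_0`, with `a_0`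
the constant term of the `q`-series. Since `G(w)` has constant term `β(w)` (`coeff_zero_G`), `a_0 =
∑ ε_w β(w)`. The same limit is now computed from the `q`-series, where the values `ζ*` appear.

Algebraic half (`G_sub_mem`): modulo brackets of lower weight, `G(w)` is `β(w)` plus the bracket
`∑_{m_1>⋯>m_r>0} ∏_i ∑_n n^{k_i-1}/(k_i-1)! q^{m_i n}`. The extended double shuffle equations are
needed only to see that `𝔟` and `𝔟̃` are `1` in depth `0` and that `𝔟` restricts to `X^𝔟` at `Y =
0`. The latter holds because `𝔟_γ` has no constant terms in positive depth: its coefficients at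
`z_1^n` are forced by the shuffle product to vanish with the one at `z_1`.

Analytic half: at `q = e^{-t}`, `t^k` times a bracket of weight `k` is a nested sum in the letters
`lambertLetter`, and brackets of smaller weight contribute `O(t^{1/2})`. Replacing `lambertLetter`
by `stuffleLetter`, that is by `(t/(e^{mt}-1))^{k_i}`, costs again `O(t^{1/2})`
(`exists_lambert_sub_stuffle_le`). These new letters multiply like the `z_k`, so their nested sums
obey the stuffle product with `z_1` exactly. For `k_1 ≥ 2` they tend to `ζ(w)`. Stripping leading
letters `z_1` by the recursion that defines `ζ*` shows that in general they are, up to `O(t^δ)` with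
some `δ > 0`, polynomials in `T(t) = stuffleValue t [1]` with constant term `ζ*(w)`
(`hasExpansion_stuffleValue`).

Conclusion: `t^k f(τ)` is such a polynomial in `T(t)`, with constant term `∑ ε_w ζ*(w)`, and has a
finite limit. As `T(t) → ∞`, the polynomial is constant (`HasExpansion.eq_of_tendsto`), whence `∑
ε_w ζ*(w) = (-2πi)^k ∑ ε_w β(w)`. The sign is harmless: for odd `k` the form vanishes. -/

open Filter Topology

namespace CMES

/-! ### The coefficients of `L_m` -/

/-- `∑_{n ≥ 1} n^k / k! q^{mn}`, the coefficient of `X^k` in `L_m`. -/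
noncomputable def divisorSeries (k m : ℕ) : PowerSeries ℚ :=
  PowerSeries.mk fun N => if m ∣ N ∧ N ≠ 0 then ((N / m : ℕ) : ℚ) ^ k / k.factorial else 0

lemma divisorSeries_zero (k : ℕ) : divisorSeries k 0 = 0 := by
  ext N
  simp only [divisorSeries, PowerSeries.coeff_mk, zero_dvd_iff, map_zero]
  rw [if_neg (by tauto)]

lemma coeff_divisorSeries_eq_zero {k m N : ℕ} (h : N < m) :
    PowerSeries.coeff N (divisorSeries k m) = 0 := by
  simp only [divisorSeries, PowerSeries.coeff_mk]
  rw [if_neg]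
  rintro ⟨h1, h2⟩
  exact absurd (Nat.le_of_dvd (Nat.pos_of_ne_zero h2) h1) (by omega)

lemma coeff_divisorSeries_nonneg (k m N : ℕ) :
    0 ≤ PowerSeries.coeff N (divisorSeries k m) := by
  simp only [divisorSeries, PowerSeries.coeff_mk]
  split_ifs <;> positivity

/-- The coefficient of `X^k` in `e^X e^{nX} = e^{(n+1)X}`. -/
lemma sum_antidiagonal_exp (n k : ℕ) :
    ∑ p ∈ Finset.HasAntidiagonal.antidiagonal k, (1 / (p.1.factorial : ℚ)) * ((n : ℚ) ^ p.2 / p.2.factorial) =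
      ((n + 1 : ℕ) : ℚ) ^ k / k.factorial := by
  have h := congrArg (PowerSeries.coeff k)
    (PowerSeries.exp_mul_exp_eq_exp_add (A := ℚ) 1 (n : ℚ))
  simp only [PowerSeries.coeff_mul, PowerSeries.coeff_rescale, PowerSeries.coeff_exp,
    Algebra.algebraMap_self, RingHom.id_apply, one_pow, one_mul] at h
  rw [add_comm (1 : ℚ)] at h
  push_cast
  rw [div_eq_mul_one_div, ← h]
  refine Finset.sum_congr rfl fun p _ => ?_
  ring

/-- The generating series of `divisorSeries`, for all `n ≥ 0` instead of `n ≥ 1`. -/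
lemma geom_divisorSeries {m : ℕ} (hm : 0 < m) :
    (1 + PowerSeries.mk fun k => divisorSeries k m) =
      1 + PowerSeries.exp (PowerSeries ℚ) * PowerSeries.C (PowerSeries.X ^ m) *
        (1 + PowerSeries.mk fun k => divisorSeries k m) := by
  have hD : ∀ k N : ℕ, PowerSeries.coeff N (PowerSeries.coeff k
      (1 + PowerSeries.mk fun k => divisorSeries k m)) =
      if m ∣ N then ((N / m : ℕ) : ℚ) ^ k / k.factorial else 0 := by
    intro k N
    simp only [map_add, PowerSeries.coeff_one, divisorSeries, PowerSeries.coeff_mk]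
    rcases eq_or_ne N 0 with rfl | hN
    · rcases eq_or_ne k 0 with rfl | hk <;> simp [*]
    · split_ifs <;> simp_all [PowerSeries.coeff_one]
  set D := 1 + PowerSeries.mk fun k => divisorSeries k m
  -- Compare coefficients of `X^k q^N`. The factor `q^m` shifts `N` by `m`: for `N ≥ m` the binomial
  -- identity remains, for `N < m` only `N = 0` can contribute.
  ext k N
  rw [hD, mul_assoc, mul_left_comm, map_add, map_add, PowerSeries.coeff_C_mul, mul_comm,
    PowerSeries.coeff_mul_X_pow', PowerSeries.coeff_mul]
  by_cases hN : m ≤ N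
  · obtain ⟨N, rfl⟩ := Nat.exists_eq_add_of_le' hN
    have h1 : PowerSeries.coeff (N + m) (PowerSeries.coeff k (1 : PowerSeries (PowerSeries ℚ)))
        = 0 := by
      rw [PowerSeries.coeff_one]
      split_ifs
      · rw [PowerSeries.coeff_one, if_neg (by omega)]
      · simp
    rw [h1, if_pos hN, zero_add, Nat.add_sub_cancel, map_sum]
    simp only [PowerSeries.coeff_exp, Nat.dvd_add_self_right, PowerSeries.algebraMap_apply,
      Algebra.algebraMap_self, RingHom.id_apply, PowerSeries.coeff_C_mul, hD]
    split_ifs with h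
    · rw [sum_antidiagonal_exp, Nat.add_div_right _ hm]
    · simp
  · rw [if_neg hN, add_zero]
    rcases eq_or_ne N 0 with rfl | h0
    · rcases eq_or_ne k 0 with rfl | hk <;> simp [*, PowerSeries.coeff_one]
    · rw [if_neg fun h => hN (Nat.le_of_dvd (Nat.pos_of_ne_zero h0) h), PowerSeries.coeff_one]
      split_ifs <;> simp [PowerSeries.coeff_one, h0]

lemma isUnit_one_sub_exp {m : ℕ} (hm : 0 < m) :
    IsUnit (1 - PowerSeries.exp (PowerSeries ℚ) * PowerSeries.C (PowerSeries.X ^ m)) := by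
  refine IsUnit.of_mul_eq_one (1 + PowerSeries.mk fun k => divisorSeries k m) ?_
  linear_combination geom_divisorSeries hm

lemma divisorSeries_mul {m : ℕ} (hm : 0 < m) :
    (PowerSeries.mk fun k => divisorSeries k m) *
      (1 - PowerSeries.exp (PowerSeries ℚ) * PowerSeries.C (PowerSeries.X ^ m)) =
      PowerSeries.exp (PowerSeries ℚ) * PowerSeries.C (PowerSeries.X ^ m) := by
  linear_combination geom_divisorSeries hm

/-! ### Power series up to terms involving `Y` -/

section YFree

variable {σ τ : Type*} {R : Type*} [CommRing R]

/-- The exponents that do not involve the variables `Y`. -/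
def YFree (e : σ ⊕ τ →₀ ℕ) : Prop := ∀ i, e (Sum.inr i) = 0

lemma YFree.of_add_left {d e : σ ⊕ τ →₀ ℕ} (h : YFree (d + e)) : YFree d := fun i => by
  have := h i
  simp only [Finsupp.add_apply] at this
  omega

lemma YFree.of_add_right {d e : σ ⊕ τ →₀ ℕ} (h : YFree (d + e)) : YFree e := by
  rw [add_comm] at h
  exact h.of_add_left

/-- Two power series agree if all variables `Y` are set to `0`. -/
def YCongr (F G : MvPowerSeries (σ ⊕ τ) R) : Prop :=
  ∀ e, YFree e → MvPowerSeries.coeff e F = MvPowerSeries.coeff e G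

/-- An exponent without `Y` splits only into exponents without `Y`. -/
lemma YCongr.mul {F F' G G' : MvPowerSeries (σ ⊕ τ) R} (h : YCongr F F') (h' : YCongr G G') :
    YCongr (F * G) (F' * G') := by
  classical
  intro e he
  rw [MvPowerSeries.coeff_mul, MvPowerSeries.coeff_mul]
  refine Finset.sum_congr rfl fun p hp => ?_
  rw [Finset.HasAntidiagonal.mem_antidiagonal] at hp
  rw [← hp] at he
  rw [h _ he.of_add_left, h' _ he.of_add_right]

lemma YCongr.refl (F : MvPowerSeries (σ ⊕ τ) R) : YCongr F F := fun _ _ => rfl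

lemma YCongr.pow {F G : MvPowerSeries (σ ⊕ τ) R} (h : YCongr F G) (n : ℕ) :
    YCongr (F ^ n) (G ^ n) := by
  induction n with
  | zero => simpa using YCongr.refl _
  | succ n ih => rw [pow_succ, pow_succ]; exact ih.mul h

lemma YCongr.expSeries {x y : MvPowerSeries (σ ⊕ τ) (PowerSeries ℚ)}
    (hx : MvPowerSeries.constantCoeff x = 0) (hy : MvPowerSeries.constantCoeff y = 0)
    (h : YCongr x y) : YCongr (expSeries x) (expSeries y) := by
  intro e he
  rw [CMES.expSeries, CMES.expSeries, PowerSeries.coeff_subst (.of_constantCoeff_zero hx),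
    PowerSeries.coeff_subst (.of_constantCoeff_zero hy)]
  exact finsum_congr fun d => by rw [h.pow d e he]

end YFree

/-- `L_m(x; 0)` is the substitution of `x` into the generating series of `divisorSeries`. -/
lemma expSeries_mul_qPow_mul_inverse {τ : Type*} {m : ℕ} (hm : 0 < m)
    {x : MvPowerSeries τ (PowerSeries ℚ)} (hx : MvPowerSeries.constantCoeff x = 0) :
    expSeries x * qPow m * Ring.inverse (1 - expSeries x * qPow m) =
      PowerSeries.subst x (PowerSeries.mk fun k => divisorSeries k m) := by
  have hx' : PowerSeries.HasSubst x := .of_constantCoeff_zero hx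
  have hE : expSeries x * qPow m = PowerSeries.substAlgHom hx'
      (PowerSeries.exp (PowerSeries ℚ) * PowerSeries.C (PowerSeries.X ^ m)) := by
    rw [PowerSeries.coe_substAlgHom, PowerSeries.subst_mul hx', PowerSeries.subst_C]
    rfl
  rw [hE, ← map_one (PowerSeries.substAlgHom (R := PowerSeries ℚ) hx'), ← map_sub]
  nth_rewrite 1 [← divisorSeries_mul hm]
  rw [map_mul, Ring.mul_inverse_cancel_right _ _ ((isUnit_one_sub_exp hm).map _),
    PowerSeries.coe_substAlgHom]

/-- For `m = 0` the denominator `1 - e^x` has no constant term, so `Ring.inverse` takes its default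
value `0`. This matches `divisorSeries_zero`, and formulas for the coefficients of `L_m` then hold
for every `m`. -/
lemma seriesL_zero {τ : Type*} {x : MvPowerSeries τ (PowerSeries ℚ)}
    (hx : MvPowerSeries.constantCoeff x = 0) (y : MvPowerSeries τ (PowerSeries ℚ)) :
    seriesL 0 x y = 0 := by
  have hE : MvPowerSeries.constantCoeff (expSeries x) = 1 := by
    have h1 : expSeries x = 1 + PowerSeries.subst x (PowerSeries.exp (PowerSeries ℚ) - 1) := by
      have hx' : PowerSeries.HasSubst x := .of_constantCoeff_zero hx
      rw [PowerSeries.subst_sub hx', ← PowerSeries.coe_substAlgHom hx', map_one,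
        PowerSeries.coe_substAlgHom hx']
      simp [expSeries]
    rw [h1, map_add, map_one, PowerSeries.constantCoeff_subst_eq_zero hx _ (by simp), add_zero]
  rw [seriesL, Ring.inverse_non_unit, mul_zero]
  rw [MvPowerSeries.isUnit_iff_constantCoeff]
  simp [hE, qPow]

/-- At `Y = 0` the factor `e^{mY}` disappears and a geometric series in `e^{X_j} q^m` is left, which
involves the single variable `X_j`. -/
lemma coeff_seriesL {r : ℕ} (m : ℕ) (j : Fin r) {e : Fin r ⊕ Fin r →₀ ℕ} (he : YFree e) :
    MvPowerSeries.coeff e (seriesL m (MvPowerSeries.X (Sum.inl j))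
      (∑ i, MvPowerSeries.X (Sum.inr i))) =
      if e = Finsupp.single (Sum.inl j) (e (Sum.inl j)) then divisorSeries (e (Sum.inl j)) m
        else 0 := by
  rcases Nat.eq_zero_or_pos m with rfl | hm
  · rw [seriesL_zero (by simp), divisorSeries_zero]
    simp
  · have h1 : YCongr (expSeries ((MvPowerSeries.X (Sum.inl j) :
        MvPowerSeries (Fin r ⊕ Fin r) (PowerSeries ℚ)) + m • ∑ i, MvPowerSeries.X (Sum.inr i)))
        (expSeries (MvPowerSeries.X (Sum.inl j))) := by
      refine YCongr.expSeries (by simp) (by simp) fun d hd => ?_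
      rw [map_add, map_nsmul, map_sum, Finset.sum_eq_zero, smul_zero, add_zero]
      intro i _
      rw [MvPowerSeries.coeff_X, if_neg]
      rintro rfl
      simpa using hd i
    rw [seriesL, ((h1.mul (YCongr.refl _)).mul (YCongr.refl _)) e he,
      expSeries_mul_qPow_mul_inverse hm (by simp), PowerSeries.coeff_subst_single,
      PowerSeries.coeff_mk]

/-! ### The coefficients of `𝔏_m` -/

section Rational

variable {σ τ : Type*}

/-- The power series with coefficients in `ℚ ⊆ ℚ⟦q⟧`. -/
noncomputable def rationalSeries (τ : Type*) : Subring (MvPowerSeries τ (PowerSeries ℚ)) :=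
  (MvPowerSeries.map (σ := τ) (PowerSeries.C : ℚ →+* PowerSeries ℚ)).range

lemma X_mem_rationalSeries (i : τ) : MvPowerSeries.X i ∈ rationalSeries τ :=
  ⟨MvPowerSeries.X i, by simp⟩

lemma exists_coeff_eq_C {F : MvPowerSeries τ (PowerSeries ℚ)} (hF : F ∈ rationalSeries τ)
    (e : τ →₀ ℕ) : ∃ c : ℚ, MvPowerSeries.coeff e F = PowerSeries.C c := by
  obtain ⟨F, rfl⟩ := hF
  exact ⟨MvPowerSeries.coeff e F, by simp⟩

lemma subst_mem_rationalSeries [Finite σ] {a : σ → MvPowerSeries τ (PowerSeries ℚ)}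
    (ha : ∀ s, a s ∈ rationalSeries τ) (h0 : ∀ s, MvPowerSeries.constantCoeff (a s) = 0)
    {F : MvPowerSeries σ (PowerSeries ℚ)} (hF : F ∈ rationalSeries σ) :
    MvPowerSeries.subst a F ∈ rationalSeries τ := by
  obtain ⟨F, rfl⟩ := hF
  choose a' ha' using ha
  obtain rfl : (fun s => MvPowerSeries.map PowerSeries.C (a' s)) = a := funext ha'
  refine ⟨MvPowerSeries.subst a' F, MvPowerSeries.map_subst
    (MvPowerSeries.hasSubst_of_constantCoeff_zero fun s => ?_) F⟩
  have := h0 s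
  rw [MvPowerSeries.constantCoeff_map] at this
  exact PowerSeries.C_injective (this.trans (map_zero _).symm)

lemma app_mem_rationalSeries {B : Bimould (PowerSeries ℚ)}
    (hB : ∀ n, B n ∈ rationalSeries (Fin n ⊕ Fin n))
    {l : List (MvPowerSeries τ (PowerSeries ℚ) × MvPowerSeries τ (PowerSeries ℚ))}
    (hl : ∀ p ∈ l, (p.1 ∈ rationalSeries τ ∧ MvPowerSeries.constantCoeff p.1 = 0) ∧
      (p.2 ∈ rationalSeries τ ∧ MvPowerSeries.constantCoeff p.2 = 0)) :
    B.app l ∈ rationalSeries τ := by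
  refine subst_mem_rationalSeries ?_ ?_ (hB _) <;> rintro (s | s)
  · exact (hl _ (l.get_mem s)).1.1
  · exact (hl _ (l.get_mem s)).2.1
  · exact (hl _ (l.get_mem s)).1.2
  · exact (hl _ (l.get_mem s)).2.2

lemma bimouldB_mem (b : Mould ℚ) (n : ℕ) : bimouldB b n ∈ rationalSeries (Fin n ⊕ Fin n) :=
  ⟨_, rfl⟩

lemma bimouldBTilde_mem (b : Mould ℚ) (n : ℕ) :
    bimouldBTilde b n ∈ rationalSeries (Fin n ⊕ Fin n) :=
  ⟨_, rfl⟩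

lemma mem_vars {r : ℕ} {A : Type*} [CommRing A]
    {p : MvPowerSeries (Fin r ⊕ Fin r) A × MvPowerSeries (Fin r ⊕ Fin r) A}
    (hp : p ∈ Bimould.vars A r) :
    ∃ i : Fin r, p = (MvPowerSeries.X (Sum.inl i), MvPowerSeries.X (Sum.inr i)) := by
  rw [Bimould.vars, List.mem_ofFn] at hp
  obtain ⟨i, rfl⟩ := hp
  exact ⟨i, rfl⟩

end Rational

/-! ### Families with controlled dependence on `m` -/

/-- A family `F_m` of power series such that the coefficient of a monomial of degree `d` without
`Y` is a linear combination, with coefficients independent of `m`, of the coefficients of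
`X^0, …, X^d` in `L_m`. -/
def IsDivisorFamily {σ τ : Type*} (F : ℕ → MvPowerSeries (σ ⊕ τ) (PowerSeries ℚ)) : Prop :=
  ∀ e : σ ⊕ τ →₀ ℕ, YFree e → ∃ c : ℕ → ℚ, ∀ m, MvPowerSeries.coeff e (F m) =
    ∑ k ∈ Finset.range (e.degree + 1), c k • divisorSeries k m

lemma sum_divisorSeries_extend {n N : ℕ} (h : n ≤ N) (c : ℕ → ℚ) :
    ∃ c' : ℕ → ℚ, ∀ m, ∑ k ∈ Finset.range (n + 1), c k • divisorSeries k m =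
      ∑ k ∈ Finset.range (N + 1), c' k • divisorSeries k m := by
  refine ⟨fun k => if k < n + 1 then c k else 0, fun m => ?_⟩
  simp only [ite_smul, zero_smul]
  rw [← Finset.sum_filter]
  congr 1
  ext k
  simp only [Finset.mem_range, Finset.mem_filter]
  omega

namespace IsDivisorFamily

variable {σ τ : Type*} {F : ℕ → MvPowerSeries (σ ⊕ τ) (PowerSeries ℚ)}

lemma sum {ι : Type*} (s : Finset ι) {F : ι → ℕ → MvPowerSeries (σ ⊕ τ) (PowerSeries ℚ)}
    (h : ∀ i ∈ s, IsDivisorFamily (F i)) : IsDivisorFamily fun m => ∑ i ∈ s, F i m := by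
  intro e he
  have : ∀ i, ∃ c : ℕ → ℚ, i ∈ s → ∀ m, MvPowerSeries.coeff e (F i m) =
      ∑ k ∈ Finset.range (e.degree + 1), c k • divisorSeries k m := by
    intro i
    by_cases hi : i ∈ s
    · obtain ⟨c, hc⟩ := h i hi e he
      exact ⟨c, fun _ => hc⟩
    · exact ⟨0, fun h => absurd h hi⟩
  choose c hc using this
  refine ⟨fun k => ∑ i ∈ s, c i k, fun m => ?_⟩
  rw [map_sum, Finset.sum_congr rfl fun i hi => hc i hi m, Finset.sum_comm]
  exact Finset.sum_congr rfl fun k _ => (Finset.sum_smul ..).symm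

/-- The coefficients of `A` are rational numbers independent of `m`, so they enter the linear
combination as scalars, and the exponent left for `F` has at most the same degree. -/
lemma mul_right (hF : IsDivisorFamily F) {A : MvPowerSeries (σ ⊕ τ) (PowerSeries ℚ)}
    (hA : A ∈ rationalSeries (σ ⊕ τ)) : IsDivisorFamily fun m => F m * A := by
  classical
  intro e he
  choose a ha using exists_coeff_eq_C hA
  have : ∀ p : (σ ⊕ τ →₀ ℕ) × (σ ⊕ τ →₀ ℕ), ∃ c : ℕ → ℚ, p.1 + p.2 = e →
      ∀ m, MvPowerSeries.coeff p.1 (F m) =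
        ∑ k ∈ Finset.range (e.degree + 1), c k • divisorSeries k m := by
    intro p
    by_cases hp : p.1 + p.2 = e
    · subst hp
      obtain ⟨c, hc⟩ := hF _ he.of_add_left
      obtain ⟨c', hc'⟩ := sum_divisorSeries_extend
        (show p.1.degree ≤ (p.1 + p.2).degree by rw [map_add]; exact Nat.le_add_right _ _) c
      exact ⟨c', fun _ m => (hc m).trans (hc' m)⟩
    · exact ⟨0, fun h => absurd h hp⟩
  choose c hc using this
  refine ⟨fun k => ∑ p ∈ Finset.HasAntidiagonal.antidiagonal e, a p.2 * c p k, fun m => ?_⟩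
  simp only [Finset.sum_smul]
  rw [MvPowerSeries.coeff_mul, Finset.sum_comm]
  refine Finset.sum_congr rfl fun p hp => ?_
  rw [hc p (Finset.HasAntidiagonal.mem_antidiagonal.mp hp) m, ha, mul_comm,
    ← PowerSeries.smul_eq_C_mul, Finset.smul_sum]
  exact Finset.sum_congr rfl fun k _ => smul_smul ..

lemma mul_left (hF : IsDivisorFamily F) {A : MvPowerSeries (σ ⊕ τ) (PowerSeries ℚ)}
    (hA : A ∈ rationalSeries (σ ⊕ τ)) : IsDivisorFamily fun m => A * F m := by
  simpa only [mul_comm] using hF.mul_right hA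

end IsDivisorFamily

lemma isDivisorFamily_seriesL {r : ℕ} (j : Fin r) :
    IsDivisorFamily fun m => seriesL m (MvPowerSeries.X (Sum.inl j) :
      MvPowerSeries (Fin r ⊕ Fin r) (PowerSeries ℚ)) (∑ i, MvPowerSeries.X (Sum.inr i)) := by
  intro e he
  by_cases h : e = Finsupp.single (Sum.inl j) (e (Sum.inl j))
  · have hd : e.degree = e (Sum.inl j) := by
      conv_lhs => rw [h]
      simp
    refine ⟨fun k => if k = e.degree then 1 else 0, fun m => ?_⟩
    rw [coeff_seriesL m j he, if_pos h, hd]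
    simp
  · exact ⟨0, fun m => by rw [coeff_seriesL m j he, if_neg h]; simp⟩

/-- Each summand is one series `L_m` multiplied by values of `𝔟` and `𝔟̃`, which are rational. -/
lemma isDivisorFamily_bimouldL (b : Mould ℚ) (r : ℕ) :
    IsDivisorFamily fun m => bimouldL b m (r + 1) := by
  refine IsDivisorFamily.sum _ fun j _ => ?_
  have hv : ∀ p ∈ (Bimould.vars (PowerSeries ℚ) (r + 1)).map
      (fun p => (p.1 - MvPowerSeries.X (Sum.inl j), p.2)),
      (p.1 ∈ rationalSeries _ ∧ MvPowerSeries.constantCoeff p.1 = 0) ∧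
      (p.2 ∈ rationalSeries _ ∧ MvPowerSeries.constantCoeff p.2 = 0) := by
    intro p hp
    obtain ⟨p', hp', rfl⟩ := List.mem_map.mp hp
    obtain ⟨i, rfl⟩ := mem_vars hp'
    exact ⟨⟨sub_mem (X_mem_rationalSeries _) (X_mem_rationalSeries _), by simp⟩,
      X_mem_rationalSeries _, by simp⟩
  refine ((isDivisorFamily_seriesL j).mul_left ?_).mul_right ?_
  · exact app_mem_rationalSeries (bimouldB_mem b) fun p hp => hv p (List.mem_of_mem_take hp)
  · exact app_mem_rationalSeries (bimouldBTilde_mem b) fun p hp =>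
      hv p (List.mem_of_mem_drop (List.mem_reverse.mp hp))

/-! ### Bimoulds evaluated at a subset of the variables -/

section Rename

variable {σ τ : Type*} {A : Type*} [CommRing A]

lemma exists_coeff_rename (E : σ ↪ τ) (e : τ →₀ ℕ) :
    (∃ d, e = Finsupp.embDomain E d ∧
      ∀ p : MvPowerSeries σ A, MvPowerSeries.coeff e (MvPowerSeries.rename E p) =
        MvPowerSeries.coeff d p) ∨
    ∀ p : MvPowerSeries σ A, MvPowerSeries.coeff e (MvPowerSeries.rename E p) = 0 := by
  by_cases h : e ∈ Set.range (Finsupp.mapDomain E)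
  · obtain ⟨d, rfl⟩ := h
    rw [← Finsupp.embDomain_eq_mapDomain]
    exact Or.inl ⟨d, rfl, fun p => MvPowerSeries.coeff_embDomain_rename E p d⟩
  · exact Or.inr fun p => MvPowerSeries.coeff_rename_eq_zero E p h

/-- An injection on indices gives an injection on the variables `X` and `Y`. -/
def varEmb {n r : ℕ} (f : Fin n ↪ Fin r) : Fin n ⊕ Fin n ↪ Fin r ⊕ Fin r := f.sumMap f

lemma YFree.of_embDomain {n r : ℕ} (f : Fin n ↪ Fin r) {d : Fin n ⊕ Fin n →₀ ℕ}
    (h : YFree (Finsupp.embDomain (varEmb f) d)) : YFree d := fun i => by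
  have := h (f i)
  rwa [show (Sum.inr (f i) : Fin r ⊕ Fin r) = varEmb f (Sum.inr i) from rfl,
    Finsupp.embDomain_apply_self] at this

lemma degree_embDomain (E : σ ↪ τ) (d : σ →₀ ℕ) : (Finsupp.embDomain E d).degree = d.degree := by
  simp [Finsupp.degree_apply, Finsupp.support_embDomain]

lemma app_eq_subst (B : Bimould A) (l : List (MvPowerSeries τ A × MvPowerSeries τ A)) {n : ℕ}
    (h : l.length = n) :
    B.app l = MvPowerSeries.subst (Sum.elim (fun i : Fin n => (l.get (i.cast h.symm)).1)
      (fun i : Fin n => (l.get (i.cast h.symm)).2)) (B n) := by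
  subst h
  rfl

/-- The pairs of variables with indices `f 0, f 1, …`. -/
noncomputable def varList (A : Type*) [CommRing A] {n r : ℕ} (f : Fin n ↪ Fin r) :
    List (MvPowerSeries (Fin r ⊕ Fin r) A × MvPowerSeries (Fin r ⊕ Fin r) A) :=
  List.ofFn fun s => (MvPowerSeries.X (Sum.inl (f s)), MvPowerSeries.X (Sum.inr (f s)))

lemma app_varList (B : Bimould A) {n r : ℕ} (f : Fin n ↪ Fin r) :
    B.app (varList A f) = MvPowerSeries.rename (varEmb f) (B n) := by
  rw [app_eq_subst B _ (n := n) (by simp [varList]), MvPowerSeries.rename_eq_subst]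
  congr 1
  ext1 (i | i) <;> simp [varList, varEmb] <;> rfl

lemma vars_take {r j : ℕ} (h : j ≤ r) :
    (Bimould.vars A r).take j = varList A (Fin.castLEEmb h) := by
  apply List.ext_getElem
  · simp [Bimould.vars, varList, h]
  · intro i h1 h2
    simp [Bimould.vars, varList]

lemma vars_eq (r : ℕ) : Bimould.vars A r = varList A (Function.Embedding.refl _) := rfl

lemma rename_varEmb_refl {r : ℕ} (F : MvPowerSeries (Fin r ⊕ Fin r) A) :
    MvPowerSeries.rename (varEmb (Function.Embedding.refl (Fin r))) F = F := by
  have : (⇑(varEmb (Function.Embedding.refl (Fin r))) : Fin r ⊕ Fin r → Fin r ⊕ Fin r) = id := by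
    ext1 (i | i) <;> rfl
  rw [MvPowerSeries.rename_eq_subst, this]
  exact congrFun MvPowerSeries.subst_self F

lemma app_vars (B : Bimould A) (r : ℕ) : B.app (Bimould.vars A r) = B r := by
  rw [vars_eq, app_varList, rename_varEmb_refl]

lemma app_nil (B : Bimould A) (h : B 0 = 1) {r : ℕ} :
    B.app ([] : List (MvPowerSeries (Fin r ⊕ Fin r) A × MvPowerSeries (Fin r ⊕ Fin r) A)) = 1 := by
  have : ([] : List (MvPowerSeries (Fin r ⊕ Fin r) A × MvPowerSeries (Fin r ⊕ Fin r) A)) =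
    varList A (Fin.castLEEmb (Nat.zero_le r)) := by simp [varList]
  rw [this, app_varList, h, map_one]

end Rename

lemma IsDivisorFamily.rename {n r : ℕ} (f : Fin n ↪ Fin r)
    {F : ℕ → MvPowerSeries (Fin n ⊕ Fin n) (PowerSeries ℚ)} (hF : IsDivisorFamily F) :
    IsDivisorFamily fun m => MvPowerSeries.rename (varEmb f) (F m) := by
  intro e he
  rcases exists_coeff_rename (A := PowerSeries ℚ) (varEmb f) e with ⟨d, rfl, h⟩ | h
  · obtain ⟨c, hc⟩ := hF d (he.of_embDomain f)
    exact ⟨c, fun m => by rw [h, hc, degree_embDomain]⟩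
  · exact ⟨0, fun m => by rw [h]; simp⟩

/-! ### Nested sums -/

/-- `∑_{M > m_1 > ⋯ > m_r > 0} a_{k_1}(m_1) ⋯ a_{k_r}(m_r)`. -/
def nestedSum {ι R : Type*} [CommSemiring R] (a : ι → ℕ → R) : List ι → ℕ → R
  | [], _ => 1
  | k :: l, M => ∑ m ∈ Finset.Ico 1 M, a k m * nestedSum a l m

/-- The tuples `M > m_1 > ⋯ > m_s > 0`. -/
def decTuples (s M : ℕ) : Finset (Fin s → ℕ) :=
  (Fintype.piFinset fun _ => Finset.Ico 1 M).filter StrictAnti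

lemma mem_decTuples {s M : ℕ} {m : Fin s → ℕ} :
    m ∈ decTuples s M ↔ (∀ i, 1 ≤ m i ∧ m i < M) ∧ StrictAnti m := by
  simp [decTuples]

lemma strictAnti_cons {s x : ℕ} {m : Fin s → ℕ} :
    StrictAnti (Fin.cons x m : Fin (s + 1) → ℕ) ↔ (∀ i, m i < x) ∧ StrictAnti m := by
  constructor
  · intro h
    refine ⟨fun i => ?_, fun i j hij => ?_⟩
    · simpa using h (Fin.succ_pos i)
    · simpa using h (Fin.succ_lt_succ_iff.mpr hij)
  · rintro ⟨h1, h2⟩ i j hij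
    induction j using Fin.cases with
    | zero => exact absurd hij (Fin.not_lt_zero i)
    | succ j =>
      induction i using Fin.cases with
      | zero => simpa using h1 j
      | succ i => simpa using h2 (Fin.succ_lt_succ_iff.mp hij)

lemma sum_decTuples {ι R : Type*} [CommSemiring R] (a : ι → ℕ → R) {s : ℕ} (k : Fin s → ι)
    (M : ℕ) :
    ∑ m ∈ decTuples s M, ∏ i, a (k i) (m i) = nestedSum a (List.ofFn k) M := by
  induction s generalizing M with
  | zero =>
    have : decTuples 0 M = Finset.univ := by
      ext m
      simp only [mem_decTuples, IsEmpty.forall_iff, Subsingleton.strictAnti, and_self, Finset.mem_univ]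
    simp only [this, nestedSum, List.ofFn_zero, Finset.univ_eq_empty, Finset.prod_empty]
    simp
  | succ s ih =>
    rw [List.ofFn_succ, nestedSum]
    simp only [← ih, Finset.mul_sum]
    rw [Finset.sum_sigma']
    refine Finset.sum_bij' (fun m _ => ⟨m 0, Fin.tail m⟩) (fun p _ => Fin.cons p.1 p.2) ?_ ?_ ?_ ?_ ?_
    · intro m hm
      rw [← Fin.cons_self_tail m, mem_decTuples, strictAnti_cons, Fin.forall_fin_succ] at hm
      simp only [Fin.cons_zero, Fin.cons_succ] at hm
      simp only [Finset.mem_sigma, Finset.mem_Ico, mem_decTuples]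
      exact ⟨hm.1.1, fun i => ⟨(hm.1.2 i).1, hm.2.1 i⟩, hm.2.2⟩
    · rintro ⟨x, m⟩ hm
      simp only [Finset.mem_sigma, Finset.mem_Ico, mem_decTuples] at hm
      rw [mem_decTuples, strictAnti_cons, Fin.forall_fin_succ]
      simp only [Fin.cons_zero, Fin.cons_succ]
      exact ⟨⟨hm.1, fun i => ⟨(hm.2.1 i).1, (hm.2.1 i).2.trans hm.1.2⟩⟩,
        fun i => (hm.2.1 i).2, hm.2.2⟩
    · intro m _
      exact Fin.cons_self_tail m
    · rintro ⟨x, m⟩ _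
      simp
    · intro m _
      rw [Fin.prod_univ_succ]
      rfl

/-! ### The coefficients of `𝔤*` -/

/-- The sum over all `m_1 > ⋯ > m_s > 0`, where the terms with `m_1 > n` are dropped from the
coefficient of `q^n`. -/
noncomputable def sumTuples (s : ℕ) : ((Fin s → ℕ) → PowerSeries ℚ) →ₗ[ℚ] PowerSeries ℚ where
  toFun f := PowerSeries.mk fun n => ∑ m ∈ decTuples s (n + 1), PowerSeries.coeff n (f m)
  map_add' f g := by
    ext n
    simp [Finset.sum_add_distrib]
  map_smul' c f := by
    ext n
    simp [Finset.mul_sum]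

/-- `∑_{m_1 > ⋯ > m_r > 0} ∏ divisorSeries (l_i) (m_i)`. -/
noncomputable def bracket (l : List ℕ) : PowerSeries ℚ :=
  PowerSeries.mk fun n => PowerSeries.coeff n (nestedSum divisorSeries l (n + 1))

lemma sumTuples_prod {s : ℕ} (k : Fin s → ℕ) :
    sumTuples s (fun m => ∏ i, divisorSeries (k i) (m i)) = bracket (List.ofFn k) := by
  ext n
  simp only [sumTuples, LinearMap.coe_mk, AddHom.coe_mk, bracket, PowerSeries.coeff_mk]
  rw [← map_sum, sum_decTuples]

/-- Linear combinations of products of `divisorSeries` in `m_1, …, m_s` of degree at most `N`. -/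
def divisorProducts (s N : ℕ) : Submodule ℚ ((Fin s → ℕ) → PowerSeries ℚ) :=
  Submodule.span ℚ {f | ∃ k : Fin s → ℕ, ∑ i, k i ≤ N ∧
    f = fun m => ∏ i, divisorSeries (k i) (m i)}

/-- Linear combinations of brackets of positive depth and weight at most `N`. -/
def bracketSpan (N : ℕ) : Submodule ℚ (PowerSeries ℚ) :=
  Submodule.span ℚ {g | ∃ l : List ℕ, l ≠ [] ∧ l.sum + l.length ≤ N ∧ g = bracket l}

lemma bracketSpan_mono {N N' : ℕ} (h : N ≤ N') : bracketSpan N ≤ bracketSpan N' :=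
  Submodule.span_mono fun _ ⟨l, h1, h2, h3⟩ => ⟨l, h1, h2.trans h, h3⟩

lemma sumTuples_mem {s N : ℕ} (hs : 0 < s) {f : (Fin s → ℕ) → PowerSeries ℚ}
    (hf : f ∈ divisorProducts s N) : sumTuples s f ∈ bracketSpan (N + s) := by
  suffices divisorProducts s N ≤ (bracketSpan (N + s)).comap (sumTuples s) from this hf
  refine Submodule.span_le.mpr ?_
  rintro _ ⟨k, hk, rfl⟩
  rw [SetLike.mem_coe, Submodule.mem_comap, sumTuples_prod]
  refine Submodule.subset_span ⟨_, ?_, ?_, rfl⟩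
  · rw [ne_eq, ← List.length_eq_zero_iff, List.length_ofFn]
    omega
  · rw [List.length_ofFn, List.sum_ofFn]
    omega

/-- Each factor with index `m` is divisible by `q^m`. This is why cutting off at `m_1 ≤ n` in
`sumTuples` loses nothing. -/
lemma coeff_eq_zero_of_mem_divisorProducts {s N n : ℕ} {f : (Fin s → ℕ) → PowerSeries ℚ}
    (hf : f ∈ divisorProducts s N) {m : Fin s → ℕ} {i : Fin s} (h : n < m i) :
    PowerSeries.coeff n (f m) = 0 := by
  induction hf using Submodule.span_induction with
  | mem f hf =>
    obtain ⟨k, -, rfl⟩ := hf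
    beta_reduce
    have : PowerSeries.X ^ m i ∣ ∏ i, divisorSeries (k i) (m i) :=
      dvd_trans (PowerSeries.X_pow_dvd_iff.mpr fun N hN => coeff_divisorSeries_eq_zero hN)
        (Finset.dvd_prod_of_mem (fun i => divisorSeries (k i) (m i)) (Finset.mem_univ i))
    exact PowerSeries.X_pow_dvd_iff.mp this n h
  | zero => simp
  | add f g _ _ hf hg => simp [hf, hg]
  | smul c f _ hf => simp [hf]

lemma finsum_eq_coeff_sumTuples {s N : ℕ} {f : (Fin s → ℕ) → PowerSeries ℚ}
    (hf : f ∈ divisorProducts s N) (n : ℕ) :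
    ∑ᶠ m : {m : Fin s → ℕ // StrictAnti m ∧ ∀ i, 0 < m i}, PowerSeries.coeff n (f m.1) =
      PowerSeries.coeff n (sumTuples s f) := by
  have h1 : ∑ᶠ m : {m : Fin s → ℕ // StrictAnti m ∧ ∀ i, 0 < m i}, PowerSeries.coeff n (f m.1) =
      ∑ᶠ (m : Fin s → ℕ) (_ : StrictAnti m ∧ ∀ i, 0 < m i), PowerSeries.coeff n (f m) :=
    finsum_subtype_eq_finsum_cond (f := fun m => PowerSeries.coeff n (f m)) _
  have h2 : PowerSeries.coeff n (sumTuples s f) =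
      ∑ m ∈ decTuples s (n + 1), PowerSeries.coeff n (f m) := by simp [sumTuples]
  rw [h1, h2]
  refine finsum_mem_eq_sum_of_inter_support_eq _ (s := {m | StrictAnti m ∧ ∀ i, 0 < m i}) ?_
  ext m
  simp only [Set.mem_inter_iff, Set.mem_ofPred_eq, Function.mem_support, SetLike.mem_coe,
    mem_decTuples]
  constructor
  · rintro ⟨⟨ha, hp⟩, hne⟩
    refine ⟨⟨fun i => ⟨hp i, ?_⟩, ha⟩, hne⟩
    by_contra hi
    exact hne (coeff_eq_zero_of_mem_divisorProducts hf (i := i) (by omega))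
  · rintro ⟨⟨hp, ha⟩, hne⟩
    exact ⟨⟨ha, fun i => (hp i).1⟩, hne⟩

/-- The exponent `e` is distributed over the factors. Each share bounds the index in its factor, and
the shares add up to the degree of `e`. -/
lemma coeff_prod_mem_divisorProducts {σ τ : Type*} {s : ℕ}
    {F : Fin s → ℕ → MvPowerSeries (σ ⊕ τ) (PowerSeries ℚ)} (hF : ∀ i, IsDivisorFamily (F i))
    {e : σ ⊕ τ →₀ ℕ} (he : YFree e) :
    (fun m => MvPowerSeries.coeff e (∏ i, F i (m i))) ∈ divisorProducts s e.degree := by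
  classical
  have : (fun m : Fin s → ℕ => MvPowerSeries.coeff e (∏ i, F i (m i))) =
      ∑ l ∈ Finset.univ.finsuppAntidiag e, fun m => ∏ i, MvPowerSeries.coeff (l i) (F i (m i)) := by
    ext1 m
    rw [MvPowerSeries.coeff_prod, Finset.sum_apply]
  rw [this]
  refine sum_mem fun l hl => ?_
  rw [Finset.mem_finsuppAntidiag] at hl
  have hY : ∀ i, YFree (l i) := by
    intro i
    have := Finset.add_sum_erase Finset.univ l (Finset.mem_univ i)
    rw [hl.1] at this
    rw [← this] at he
    exact he.of_add_left
  choose c hc using fun i => hF i (l i) (hY i)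
  have : (fun m : Fin s → ℕ => ∏ i, MvPowerSeries.coeff (l i) (F i (m i))) =
      ∑ x ∈ Fintype.piFinset fun i => Finset.range ((l i).degree + 1),
        (∏ i, c i (x i)) • fun m : Fin s → ℕ => ∏ i, divisorSeries (x i) (m i) := by
    ext1 m
    rw [Finset.sum_apply]
    simp only [hc, Pi.smul_apply]
    rw [Finset.prod_univ_sum]
    exact Finset.sum_congr rfl fun x _ => Finset.prod_smul ..
  rw [this]
  refine sum_mem fun x hx => Submodule.smul_mem _ _ (Submodule.subset_span ⟨x, ?_, rfl⟩)
  rw [← hl.1, map_sum]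
  refine Finset.sum_le_sum fun i _ => ?_
  have := Fintype.mem_piFinset.mp hx i
  rw [Finset.mem_range] at this
  omega

/-- The factor of `𝔤*` for the block number `i` of the composition `c`. -/
noncomputable def blockFactor (b : Mould ℚ) {r : ℕ} (c : Composition r) (i : Fin c.length)
    (m : ℕ) : MvPowerSeries (Fin r ⊕ Fin r) (PowerSeries ℚ) :=
  (bimouldL b m).app (varList (PowerSeries ℚ) (c.embedding i).toEmbedding)

lemma isDivisorFamily_blockFactor (b : Mould ℚ) {r : ℕ} (c : Composition r) (i : Fin c.length) :
    IsDivisorFamily (blockFactor b c i) := by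
  have h : blockFactor b c i = fun m =>
      MvPowerSeries.rename (varEmb (c.embedding i).toEmbedding) (bimouldL b m (c.blocksFun i)) :=
    funext fun m => app_varList _ _
  rw [h]
  refine IsDivisorFamily.rename _ ?_
  obtain ⟨n, hn⟩ : ∃ n, c.blocksFun i = n + 1 :=
    Nat.exists_eq_succ_of_ne_zero (c.blocks_pos' i i.2).ne'
  rw [hn]
  exact isDivisorFamily_bimouldL b n

lemma coeff_bimouldGStar (b : Mould ℚ) {r : ℕ} {e : Fin r ⊕ Fin r →₀ ℕ} (he : YFree e) :
    MvPowerSeries.coeff e (bimouldGStar b r) = ∑ c : Composition r,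
      sumTuples c.length fun m => MvPowerSeries.coeff e (∏ i, blockFactor b c i (m i)) := by
  ext n
  have : MvPowerSeries.coeff e (bimouldGStar b r) = bimouldGStar b r e := rfl
  rw [this, bimouldGStar, PowerSeries.coeff_mk, map_sum]
  refine Finset.sum_congr rfl fun c _ => ?_
  rw [← finsum_eq_coeff_sumTuples
    (coeff_prod_mem_divisorProducts (isDivisorFamily_blockFactor b c) he)]
  rfl

lemma coeff_bimouldGStar_mem (b : Mould ℚ) {r : ℕ} (hr : 0 < r) {e : Fin r ⊕ Fin r →₀ ℕ}
    (he : YFree e) : MvPowerSeries.coeff e (bimouldGStar b r) ∈ bracketSpan (e.degree + r) := by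
  rw [coeff_bimouldGStar b he]
  refine sum_mem fun c _ => ?_
  exact bracketSpan_mono (Nat.add_le_add_left c.length_le _) (sumTuples_mem
    (c.length_pos_of_pos hr) (coeff_prod_mem_divisorProducts (isDivisorFamily_blockFactor b c) he))

/-- Modulo `Y`, the factors are series in distinct single variables, so only one splitting of `e`
contributes to the product. -/
lemma coeff_prod_single {σ τ A : Type*} [CommRing A] {s : ℕ} (v : Fin s ↪ σ)
    {P : Fin s → MvPowerSeries (σ ⊕ τ) A} {g : Fin s → ℕ → A} [DecidableEq (σ ⊕ τ)]
    (hP : ∀ i d, YFree d → MvPowerSeries.coeff d (P i) =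
      if d = Finsupp.single (Sum.inl (v i)) (d (Sum.inl (v i))) then g i (d (Sum.inl (v i))) else 0)
    {e : σ ⊕ τ →₀ ℕ} (he : YFree e)
    (hsum : ∑ i, Finsupp.single (Sum.inl (v i)) (e (Sum.inl (v i))) = e) :
    MvPowerSeries.coeff e (∏ i, P i) = ∏ i, g i (e (Sum.inl (v i))) := by
  classical
  rw [MvPowerSeries.coeff_prod]
  rw [Finset.sum_eq_single (Finsupp.equivFunOnFinite.symm fun i =>
    Finsupp.single (Sum.inl (v i)) (e (Sum.inl (v i))))]
  · refine Finset.prod_congr rfl fun i _ => ?_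
    rw [Finsupp.coe_equivFunOnFinite_symm, hP, if_pos] <;> simp [YFree]
  · intro l hl hne
    rw [Finset.mem_finsuppAntidiag] at hl
    have hY : ∀ i, YFree (l i) := by
      intro i
      have := Finset.add_sum_erase Finset.univ l (Finset.mem_univ i)
      rw [hl.1] at this
      rw [← this] at he
      exact he.of_add_left
    by_contra h0
    apply hne
    have hsingle : ∀ i, l i = Finsupp.single (Sum.inl (v i)) (l i (Sum.inl (v i))) := by
      intro i
      by_contra hi
      exact h0 (Finset.prod_eq_zero (Finset.mem_univ i) (by rw [hP i _ (hY i), if_neg hi]))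
    ext1 i
    rw [Finsupp.coe_equivFunOnFinite_symm, hsingle i]
    congr 1
    rw [← hl.1, Finset.sum_apply', Finset.sum_eq_single i]
    · intro j _ hj
      rw [hsingle j, Finsupp.single_eq_of_ne]
      simpa using fun h => hj (v.injective h).symm
    · simp
  · intro h
    refine absurd ?_ h
    rw [Finset.mem_finsuppAntidiag]
    exact ⟨by simpa using hsum, by simp⟩

/-- In depth one `𝔏_m` is `L_m`. The depth is a variable `n` with `n = 1` because the blocks of
`Composition.ones` have size one only propositionally. -/
lemma coeff_rename_bimouldL_one {b : Mould ℚ} (hB : bimouldB b 0 = 1) (hB' : bimouldBTilde b 0 = 1)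
    (m : ℕ) {n r : ℕ} (hn : n = 1) (f : Fin n ↪ Fin r) {d : Fin r ⊕ Fin r →₀ ℕ} (hd : YFree d) :
    MvPowerSeries.coeff d (MvPowerSeries.rename (varEmb f) (bimouldL b m n)) =
      if d = Finsupp.single (Sum.inl (f ⟨0, by omega⟩)) (d (Sum.inl (f ⟨0, by omega⟩))) then
        divisorSeries (d (Sum.inl (f ⟨0, by omega⟩))) m else 0 := by
  subst hn
  have hL : bimouldL b m 1 =
      seriesL m (MvPowerSeries.X (Sum.inl 0)) (∑ i, MvPowerSeries.X (Sum.inr i)) := by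
    simp [bimouldL, Bimould.vars, app_nil _ hB, app_nil _ hB']
  have hv : (Sum.inl (f 0) : Fin r ⊕ Fin r) = varEmb f (Sum.inl 0) := rfl
  simp only [Fin.zero_eta]
  by_cases h : d ∈ Set.range (Finsupp.mapDomain (varEmb f))
  · obtain ⟨d, rfl⟩ := h
    rw [← Finsupp.embDomain_eq_mapDomain] at hd ⊢
    rw [MvPowerSeries.coeff_embDomain_rename, hL, coeff_seriesL m 0 (hd.of_embDomain f), hv,
      Finsupp.embDomain_apply_self, ← Finsupp.embDomain_single]
    simp only [(Finsupp.embDomain_injective (varEmb f)).eq_iff]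
  · rw [MvPowerSeries.coeff_rename_eq_zero _ _ h, if_neg]
    intro h'
    refine h ⟨Finsupp.single (Sum.inl 0) (d (Sum.inl (f 0))), ?_⟩
    rw [Finsupp.mapDomain_single, ← hv, ← h']

lemma sumTuples_ones {b : Mould ℚ} (hB : bimouldB b 0 = 1) (hB' : bimouldBTilde b 0 = 1)
    {r : ℕ} {e : Fin r ⊕ Fin r →₀ ℕ} (he : YFree e) :
    (sumTuples (Composition.ones r).length fun m =>
      MvPowerSeries.coeff e (∏ i, blockFactor b (Composition.ones r) i (m i))) =
      bracket (List.ofFn fun i => e (Sum.inl i)) := by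
  have h : ∀ m : Fin (Composition.ones r).length → ℕ,
      MvPowerSeries.coeff e (∏ i, blockFactor b (Composition.ones r) i (m i)) =
        ∏ i, divisorSeries (e (Sum.inl (finCongr (Composition.ones_length r) i))) (m i) := by
    intro m
    refine coeff_prod_single (finCongr (Composition.ones_length r)).toEmbedding
      (g := fun i k => divisorSeries k (m i)) (fun i d hd => ?_) he ?_
    · rw [blockFactor, app_varList, coeff_rename_bimouldL_one hB hB' _ (by simp) _ hd]
      have : (Composition.ones r).embedding i ⟨0, by simp⟩ =
          finCongr (Composition.ones_length r) i := Composition.ones_embedding _ _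
      simp only [RelEmbedding.coe_toEmbedding, this, Equiv.coe_toEmbedding]
    · simp only [Equiv.coe_toEmbedding]
      rw [Equiv.sum_comp (finCongr (Composition.ones_length r))
        (fun i => Finsupp.single (Sum.inl i : Fin r ⊕ Fin r) (e (Sum.inl i)))]
      ext x
      rw [Finset.sum_apply']
      rcases x with x | x
      · simp [Finsupp.single_apply]
      · simp [he x]
  simp only [h]
  rw [sumTuples_prod]
  congr 1
  apply List.ext_getElem
  · simp
  · intro i h1 h2
    simp

/-- The composition into blocks of size one contributes the bracket itself. Every other composition
has fewer than `r` blocks, and the number of blocks is what is added to the degree to bound the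
weight. -/
lemma coeff_bimouldGStar_sub_mem {b : Mould ℚ} (hB : bimouldB b 0 = 1)
    (hB' : bimouldBTilde b 0 = 1) {r : ℕ} (hr : 0 < r) {e : Fin r ⊕ Fin r →₀ ℕ} (he : YFree e) :
    MvPowerSeries.coeff e (bimouldGStar b r) - bracket (List.ofFn fun i => e (Sum.inl i)) ∈
      bracketSpan (e.degree + r - 1) := by
  classical
  rw [coeff_bimouldGStar b he, ← sumTuples_ones hB hB' he,
    ← Finset.add_sum_erase _ _ (Finset.mem_univ (Composition.ones r)), add_sub_cancel_left]
  refine sum_mem fun c hc => ?_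
  have h1 : c.length ≠ r := fun h =>
    (Finset.mem_erase.mp hc).1 (Composition.eq_ones_iff_length.mpr h)
  have h2 := c.length_le
  exact bracketSpan_mono (by omega) (sumTuples_mem
    (c.length_pos_of_pos hr) (coeff_prod_mem_divisorProducts (isDivisorFamily_blockFactor b c) he))

/-! ### The bimould `𝔟` for `Y = 0` -/

section Mould

variable {A : Type*} [CommRing A] {τ : Type*}

lemma constantCoeff_subst_of_zero {σ : Type*} [Finite σ] {a : σ → MvPowerSeries τ A}
    (ha : ∀ i, MvPowerSeries.constantCoeff (a i) = 0) (F : MvPowerSeries σ A) :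
    MvPowerSeries.constantCoeff (MvPowerSeries.subst a F) = MvPowerSeries.constantCoeff F := by
  have h := MvPowerSeries.hasSubst_of_constantCoeff_zero ha
  have h1 : F = MvPowerSeries.C (MvPowerSeries.constantCoeff F) +
      (F - MvPowerSeries.C (MvPowerSeries.constantCoeff F)) := by ring
  conv_lhs => rw [h1]
  rw [MvPowerSeries.subst_add h, MvPowerSeries.subst_C, map_add,
    MvPowerSeries.constantCoeff_subst_eq_zero h ha (by simp)]
  simp

lemma Mould.constantCoeff_app (Z : Mould A) {l : List (MvPowerSeries τ A)}
    (hl : ∀ x ∈ l, MvPowerSeries.constantCoeff x = 0) {n : ℕ} (h : l.length = n) :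
    MvPowerSeries.constantCoeff (Z.app l) = MvPowerSeries.constantCoeff (Z n) := by
  subst h
  exact constantCoeff_subst_of_zero (fun i => hl _ (l.get_mem i)) _

lemma Mould.constantCoeff_prod (Z₁ Z₂ : Mould A) (r : ℕ) :
    MvPowerSeries.constantCoeff (Z₁.prod Z₂ r) = ∑ j ∈ Finset.range (r + 1),
      MvPowerSeries.constantCoeff (Z₁ j) * MvPowerSeries.constantCoeff (Z₂ (r - j)) := by
  have hv : ∀ x ∈ Mould.vars A r, MvPowerSeries.constantCoeff x = 0 := by
    intro x hx
    rw [Mould.vars, List.mem_ofFn] at hx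
    obtain ⟨i, rfl⟩ := hx
    simp
  rw [Mould.prod, map_sum]
  refine Finset.sum_congr rfl fun j hj => ?_
  have hj' := Finset.mem_range.mp hj
  rw [map_mul, constantCoeff_app _ (fun x hx => hv x (List.mem_of_mem_take hx)) (n := j),
    constantCoeff_app _ (fun x hx => hv x (List.mem_of_mem_drop hx)) (n := r - j)]
  · simp [Mould.vars]
  · simp only [Mould.vars, List.length_take, List.length_ofFn]
    omega

lemma Mould.constantCoeff_sharp (Z : Mould A) (r : ℕ) :
    MvPowerSeries.constantCoeff (Z.sharp r) = MvPowerSeries.constantCoeff (Z r) := by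
  rw [Mould.sharp, constantCoeff_app _ _ (List.length_ofFn ..)]
  intro x hx
  rw [List.mem_ofFn] at hx
  obtain ⟨i, rfl⟩ := hx
  simp

lemma Mould.constantCoeff_neg (Z : Mould A) (r : ℕ) :
    MvPowerSeries.constantCoeff (Z.neg r) = MvPowerSeries.constantCoeff (Z r) := by
  rw [Mould.neg, constantCoeff_app _ _ (List.length_ofFn ..)]
  intro x hx
  rw [List.mem_ofFn] at hx
  obtain ⟨i, rfl⟩ := hx
  simp

lemma expo_replicate_one (n : ℕ) : expo (List.replicate n 1) = 0 := by
  ext i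
  simp [expo]

lemma Mould.coeff_replicate_one (Z : Mould A) (n : ℕ) :
    Z.coeff (List.replicate n 1) = MvPowerSeries.constantCoeff (Z n) := by
  rw [Mould.coeff, expo_replicate_one, MvPowerSeries.coeff_zero_eq_constantCoeff, List.length_replicate]

lemma shuffle_one_replicate (n : ℕ) :
    shuffle [1] (List.replicate n 1) = List.replicate (n + 1) (List.replicate (n + 1) 1) := by
  induction n with
  | zero => simp [shuffle, quasiShuffle]
  | succ n ih =>
    rw [shuffle] at ih ⊢
    rw [List.replicate_succ, quasiShuffle, ih]
    simp [quasiShuffle, List.replicate_succ]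

/-- The shuffle product of `z_1` and `z_1^n` is `(n+1) z_1^{n+1}`. -/
lemma IsWordHom.shuffle_replicate_one {φ : List ℕ+ → ℚ} (h : IsWordHom shuffle φ)
    (h1 : φ [1] = 0) {n : ℕ} (hn : 0 < n) : φ (List.replicate n 1) = 0 := by
  obtain ⟨n, rfl⟩ := Nat.exists_eq_add_of_le' hn
  have := h.2 [1] (List.replicate n 1)
  rw [h1, zero_mul, shuffle_one_replicate, List.map_replicate, List.sum_replicate, eq_comm,
    nsmul_eq_mul, mul_eq_zero] at this
  exact this.resolve_left (by positivity)

end Mould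

/-! ### The constant terms of `𝔟_γ` -/

lemma constantCoeff_log_Gam (Z : Mould ℚ) : MvPowerSeries.constantCoeff
    (PowerSeries.mk fun n : ℕ =>
      if 2 ≤ n then algebraMap ℚ ℚ ((-1) ^ n / n) * Z.coeff [n.toPNat'] else 0) = 0 := by
  change PowerSeries.constantCoeff _ = 0
  rw [← PowerSeries.coeff_zero_eq_constantCoeff_apply, PowerSeries.coeff_mk]
  simp

lemma coeff_one_Gam (Z : Mould ℚ) : PowerSeries.coeff 1 Z.Gam = 0 := by
  have h := PowerSeries.HasSubst.of_constantCoeff_zero (constantCoeff_log_Gam Z)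
  rw [Mould.Gam, PowerSeries.coeff_subst' h]
  refine (finsum_congr fun d => ?_).trans finsum_zero
  rcases d with _ | d
  · simp [PowerSeries.coeff_one]
  · have : PowerSeries.X ^ 2 ∣ PowerSeries.mk (fun n : ℕ =>
        if 2 ≤ n then algebraMap ℚ ℚ ((-1) ^ n / n) * Z.coeff [n.toPNat'] else 0) := by
      rw [PowerSeries.X_pow_dvd_iff]
      intro m hm
      rw [PowerSeries.coeff_mk, if_neg (by omega)]
    rw [PowerSeries.X_pow_dvd_iff.mp (dvd_pow this (Nat.succ_ne_zero d)) 1 (by norm_num), smul_zero]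

lemma constantCoeff_gam_zero {b : Mould ℚ} (hb : b.SatisfiesEDS) :
    MvPowerSeries.constantCoeff (b.gam 0) = 1 := by
  rw [← Mould.coeff_replicate_one]
  exact hb.2.1

/-- The constant term in depth `n` is the coefficient at `z_1^n`, so symmetrality reduces the claim
to depth one. There the two contributions vanish since `β(1) = 0` and `Γ` has no linear term. -/
lemma constantCoeff_gam_pos {b : Mould ℚ} (hb : b.SatisfiesEDS) (h1 : b.coeff [1] = 0) {n : ℕ}
    (hn : 0 < n) : MvPowerSeries.constantCoeff (b.gam n) = 0 := by
  rw [← Mould.coeff_replicate_one]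
  refine hb.2.shuffle_replicate_one ?_ hn
  have h2 := Mould.coeff_replicate_one b.gam 1
  have h3 := Mould.coeff_replicate_one b 1
  rw [List.replicate_one] at h2 h3
  rw [h2, Mould.gam, Mould.constantCoeff_prod, Finset.sum_range_succ, Finset.sum_range_one]
  simp [Mould.constantCoeff_sharp, ← h3, h1, Mould.const, coeff_one_Gam]

lemma eq_one_of_isEmpty {σ A : Type*} [IsEmpty σ] [CommRing A] {F : MvPowerSeries σ A}
    (h : MvPowerSeries.constantCoeff F = 1) : F = 1 := by
  classical
  ext e
  rw [Subsingleton.elim e 0, MvPowerSeries.coeff_zero_eq_constantCoeff, h, map_one]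

section OfXY

variable {A : Type*} [CommRing A]

lemma Mould.app_eq_subst {τ : Type*} (Z : Mould A) (l : List (MvPowerSeries τ A)) {n : ℕ}
    (h : l.length = n) :
    Z.app l = MvPowerSeries.subst (fun i : Fin n => l.get (i.cast h.symm)) (Z n) := by
  subst h
  rfl

lemma Bimould.ofX_eq (Z : Mould A) (r : ℕ) :
    Bimould.ofX Z r = MvPowerSeries.rename (Function.Embedding.inl : Fin r ↪ Fin r ⊕ Fin r)
      (Z r) := by
  have : (Bimould.vars A r).map Prod.fst = List.ofFn fun i => MvPowerSeries.X (Sum.inl i) := by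
    simp [Bimould.vars, List.map_ofFn, Function.comp_def]
  rw [Bimould.ofX, this, MvPowerSeries.rename_eq_subst,
    Mould.app_eq_subst _ _ (List.length_ofFn ..)]
  congr 1
  ext1 i
  simp

lemma Bimould.ofY_eq (Z : Mould A) (r : ℕ) :
    Bimould.ofY Z r = MvPowerSeries.rename (Function.Embedding.inr : Fin r ↪ Fin r ⊕ Fin r)
      (Z r) := by
  have : (Bimould.vars A r).map Prod.snd = List.ofFn fun i => MvPowerSeries.X (Sum.inr i) := by
    simp [Bimould.vars, List.map_ofFn, Function.comp_def]
  rw [Bimould.ofY, this, MvPowerSeries.rename_eq_subst,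
    Mould.app_eq_subst _ _ (List.length_ofFn ..)]
  congr 1
  ext1 i
  simp

lemma Bimould.constantCoeff_prod_zero (B C : Bimould A) :
    MvPowerSeries.constantCoeff (B.prod C 0) =
      MvPowerSeries.constantCoeff (B 0) * MvPowerSeries.constantCoeff (C 0) := by
  have h : ∀ B : Bimould A, MvPowerSeries.constantCoeff (B.app (Bimould.vars A 0)) =
      MvPowerSeries.constantCoeff (B 0) := fun B => by rw [app_vars]
  rw [Bimould.prod, Finset.sum_range_one, map_mul]
  exact congrArg₂ _ (h B) (h C)

end OfXY

lemma Mould.IsSymmetril.constantCoeff_zero {b : Mould ℚ} (hb : b.IsSymmetril) :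
    MvPowerSeries.constantCoeff (b 0) = 1 := by
  rw [← Mould.coeff_replicate_one]
  exact hb.1

lemma bimouldB_zero {b : Mould ℚ} (hb : b.SatisfiesEDS) : bimouldB b 0 = 1 := by
  refine eq_one_of_isEmpty ?_
  rw [bimouldB, Bimould.map, MvPowerSeries.constantCoeff_map, Bimould.constantCoeff_prod_zero,
    Bimould.ofX_eq, Bimould.ofY_eq, MvPowerSeries.constantCoeff_rename,
    MvPowerSeries.constantCoeff_rename, constantCoeff_gam_zero hb, hb.1.constantCoeff_zero]
  simp

lemma bimouldBTilde_zero {b : Mould ℚ} (hb : b.SatisfiesEDS) : bimouldBTilde b 0 = 1 := by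
  refine eq_one_of_isEmpty ?_
  rw [bimouldBTilde, Bimould.map, MvPowerSeries.constantCoeff_map, Bimould.constantCoeff_prod_zero,
    Bimould.constantCoeff_prod_zero,
    Bimould.ofX_eq, Bimould.ofY_eq, MvPowerSeries.constantCoeff_rename,
    MvPowerSeries.constantCoeff_rename, Mould.constantCoeff_neg, constantCoeff_gam_zero hb,
    hb.1.constantCoeff_zero]
  simp [Bimould.const]

lemma coeff_ofY_gam {b : Mould ℚ} (hb : b.SatisfiesEDS) (h1 : b.coeff [1] = 0) {n : ℕ}
    (hn : 0 < n) {e : Fin n ⊕ Fin n →₀ ℕ} (he : YFree e) :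
    MvPowerSeries.coeff e (Bimould.ofY b.gam n) = 0 := by
  rw [Bimould.ofY_eq]
  rcases exists_coeff_rename (A := ℚ) (Function.Embedding.inr : Fin n ↪ Fin n ⊕ Fin n) e with
    ⟨d, rfl, h⟩ | h
  · have : d = 0 := by
      ext i
      have := he i
      rwa [show (Sum.inr i : Fin n ⊕ Fin n) = Function.Embedding.inr i from rfl,
        Finsupp.embDomain_apply_self] at this
    rw [h, this, MvPowerSeries.coeff_zero_eq_constantCoeff, constantCoeff_gam_pos hb h1 hn]
  · exact h _

/-- The exponent of a monomial without `Y`. -/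
noncomputable def xExpo {r : ℕ} (d : Fin r →₀ ℕ) : Fin r ⊕ Fin r →₀ ℕ := Finsupp.sumElim d 0

lemma yFree_xExpo {r : ℕ} (d : Fin r →₀ ℕ) : YFree (xExpo d) := fun i => by simp [xExpo]

lemma xExpo_eq_embDomain {r : ℕ} (d : Fin r →₀ ℕ) :
    xExpo d = Finsupp.embDomain Function.Embedding.inl d := by
  ext (i | i)
  · rw [show (Sum.inl i : Fin r ⊕ Fin r) = Function.Embedding.inl i from rfl,
      Finsupp.embDomain_apply_self]
    simp [xExpo]
  · rw [Finsupp.embDomain_of_notMem_range _ _ _ (by simp)]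
    simp [xExpo]

/-- In `Y^{𝔟_γ} × X^𝔟`, every term with a first factor of positive depth dies at `Y = 0`, because
`𝔟_γ` has no constant term there. -/
lemma coeff_bimouldB {b : Mould ℚ} (hb : b.SatisfiesEDS) (h1 : b.coeff [1] = 0) {r : ℕ}
    (d : Fin r →₀ ℕ) : MvPowerSeries.coeff (xExpo d) (bimouldB b r) =
      PowerSeries.C (MvPowerSeries.coeff d (b r)) := by
  classical
  rw [bimouldB, Bimould.map, MvPowerSeries.coeff_map, Bimould.prod, map_sum,
    Finset.sum_eq_single 0]
  · have h0 : Bimould.ofY b.gam 0 = 1 := by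
      refine eq_one_of_isEmpty ?_
      rw [Bimould.ofY_eq, MvPowerSeries.constantCoeff_rename, constantCoeff_gam_zero hb]
    rw [List.take_zero, List.drop_zero, app_nil _ h0, one_mul, app_vars, Bimould.ofX_eq,
      xExpo_eq_embDomain, MvPowerSeries.coeff_embDomain_rename]
  · intro j hj hj0
    rw [MvPowerSeries.coeff_mul]
    refine Finset.sum_eq_zero fun p hp => ?_
    rw [Finset.HasAntidiagonal.mem_antidiagonal] at hp
    have hY : YFree p.1 := (hp ▸ yFree_xExpo d : YFree (p.1 + p.2)).of_add_left
    rw [vars_take (Nat.lt_succ_iff.mp (Finset.mem_range.mp hj)), app_varList]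
    rcases exists_coeff_rename (A := ℚ)
      (varEmb (Fin.castLEEmb (Nat.lt_succ_iff.mp (Finset.mem_range.mp hj)))) p.1 with ⟨d', h, h'⟩ | h
    · rw [h', coeff_ofY_gam hb h1 (Nat.pos_of_ne_zero hj0), zero_mul]
      rw [h] at hY
      exact hY.of_embDomain _
    · rw [h, zero_mul]
  · simp

/-! ### The combinatorial multiple Eisenstein series -/

/-- The weight of a word. -/
def weight (w : List ℕ+) : ℕ := (w.map fun i : ℕ+ => (i : ℕ)).sum

lemma weight_eq (w : List ℕ+) : weight w = (w.map PNat.natPred).sum + w.length := by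
  induction w with
  | nil => rfl
  | cons a w ih =>
    have := PNat.natPred_add_one a
    simp only [weight, List.map_cons, List.sum_cons, List.length_cons] at ih ⊢
    omega

lemma degree_xExpo {r : ℕ} (d : Fin r →₀ ℕ) : (xExpo d).degree = d.degree := by
  rw [xExpo_eq_embDomain, degree_embDomain]

lemma ofFn_expo (w : List ℕ+) : List.ofFn (fun i => expo w i) = w.map PNat.natPred := by
  apply List.ext_getElem
  · simp
  · intro i h1 h2
    simp [expo, PNat.natPred]

lemma degree_expo (w : List ℕ+) : (expo w).degree + w.length = weight w := by
  rw [weight_eq, ← ofFn_expo, List.sum_ofFn, Finsupp.degree_eq_sum]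

lemma bimouldGStar_zero {b : Mould ℚ} (hB : bimouldB b 0 = 1) (hB' : bimouldBTilde b 0 = 1) :
    bimouldGStar b 0 = 1 := by
  classical
  refine eq_one_of_isEmpty ?_
  have h0 : YFree (0 : Fin 0 ⊕ Fin 0 →₀ ℕ) := by simp [YFree]
  rw [← MvPowerSeries.coeff_zero_eq_constantCoeff_apply, coeff_bimouldGStar b h0,
    Finset.sum_eq_single (Composition.ones 0), sumTuples_ones hB hB' h0]
  · ext n
    simp [bracket, nestedSum]
  · intro c _ hc
    exact absurd (Composition.eq_ones_iff_length.mpr (Nat.le_zero.mp c.length_le)) hc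
  · simp

/-- In `𝔊 = 𝔤* × 𝔟` the term of `𝔤*` in full depth gives the bracket modulo lower weight, and the
term in depth `0` gives `β(w)`. The intermediate terms combine `𝔤*` in depth `j < r` with rational
factors, so their weight is at most the degree plus `j`. -/
lemma G_sub_mem {b : Mould ℚ} (hb : b.SatisfiesEDS) (h1 : b.coeff [1] = 0) {w : List ℕ+}
    (hw : w ≠ []) :
    G b w - PowerSeries.C (b.coeff w) - bracket (w.map PNat.natPred) ∈
      bracketSpan (weight w - 1) := by
  classical
  set r := w.length with hr
  have hr0 : 0 < r := List.length_pos_iff.mpr hw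
  have hB := bimouldB_zero hb
  have hG : G b w = MvPowerSeries.coeff (xExpo (expo w)) (bimouldG b r) := rfl
  have hdeg : (xExpo (expo w)).degree + r = weight w := by rw [degree_xExpo, degree_expo]
  have hY := yFree_xExpo (expo w)
  have hG0 := bimouldGStar_zero hB (bimouldBTilde_zero hb)
  rw [hG, bimouldG, Bimould.prod, map_sum, Finset.sum_range_succ,
    ← Finset.add_sum_erase _ _ (Finset.mem_range.mpr hr0)]
  have hlast : (Bimould.vars (PowerSeries ℚ) r).drop r = [] := by simp [Bimould.vars]
  have hlast' : (Bimould.vars (PowerSeries ℚ) r).take r = Bimould.vars (PowerSeries ℚ) r :=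
    List.take_of_length_le (by simp [Bimould.vars])
  rw [hlast, hlast', app_nil _ hB, mul_one, app_vars, List.take_zero, List.drop_zero,
    app_nil _ hG0, one_mul, app_vars, coeff_bimouldB hb h1, Mould.coeff]
  have key := coeff_bimouldGStar_sub_mem hB (bimouldBTilde_zero hb) hr0 hY
  have hl : (List.ofFn fun i => xExpo (expo w) (Sum.inl i)) = w.map PNat.natPred := by
    rw [← ofFn_expo]
    simp [xExpo]
  rw [hl, hdeg] at key
  have hmid : ∑ j ∈ (Finset.range r).erase 0, MvPowerSeries.coeff (xExpo (expo w))
      ((bimouldGStar b).app ((Bimould.vars (PowerSeries ℚ) r).take j) *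
        (bimouldB b).app ((Bimould.vars (PowerSeries ℚ) r).drop j)) ∈
      bracketSpan (weight w - 1) := by
    refine sum_mem fun j hj => ?_
    rw [Finset.mem_erase, Finset.mem_range] at hj
    rw [MvPowerSeries.coeff_mul]
    refine sum_mem fun p hp => ?_
    rw [Finset.HasAntidiagonal.mem_antidiagonal] at hp
    have hY' : YFree p.1 := (hp ▸ hY : YFree (p.1 + p.2)).of_add_left
    have hd : p.1.degree ≤ (xExpo (expo w)).degree := by
      rw [← hp, map_add]
      exact Nat.le_add_right _ _
    obtain ⟨c, hc⟩ := exists_coeff_eq_C (app_mem_rationalSeries (bimouldB_mem b)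
      (l := (Bimould.vars (PowerSeries ℚ) r).drop j) fun q hq => by
        obtain ⟨i, rfl⟩ := mem_vars (List.mem_of_mem_drop hq)
        exact ⟨⟨X_mem_rationalSeries _, by simp⟩, X_mem_rationalSeries _, by simp⟩) p.2
    rw [hc, mul_comm, ← PowerSeries.smul_eq_C_mul]
    refine Submodule.smul_mem _ _ ?_
    rw [vars_take hj.2.le, app_varList]
    rcases exists_coeff_rename (A := PowerSeries ℚ) (varEmb (Fin.castLEEmb hj.2.le)) p.1 with
      ⟨d, h, h'⟩ | h
    · rw [h']
      rw [h] at hY' hd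
      rw [degree_embDomain] at hd
      exact bracketSpan_mono (by omega)
        (coeff_bimouldGStar_mem b (Nat.pos_of_ne_zero hj.1) (hY'.of_embDomain _))
    · rw [h]
      exact zero_mem _
  have := add_mem hmid key
  convert this using 1
  ring

lemma constantCoeff_bracket {l : List ℕ} (hl : l ≠ []) : PowerSeries.coeff 0 (bracket l) = 0 := by
  rw [bracket, PowerSeries.coeff_mk]
  cases l with
  | nil => exact absurd rfl hl
  | cons a l => simp [nestedSum]

lemma constantCoeff_of_mem_bracketSpan {N : ℕ} {g : PowerSeries ℚ} (hg : g ∈ bracketSpan N) :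
    PowerSeries.coeff 0 g = 0 := by
  induction hg using Submodule.span_induction with
  | mem g hg =>
    obtain ⟨l, hl, -, rfl⟩ := hg
    exact constantCoeff_bracket hl
  | zero => simp
  | add f g _ _ hf hg => rw [map_add, hf, hg, add_zero]
  | smul c f _ hf => rw [map_smul, hf, smul_zero]

lemma coeff_zero_G {b : Mould ℚ} (hb : b.SatisfiesEDS) (h1 : b.coeff [1] = 0) {w : List ℕ+}
    (hw : w ≠ []) : PowerSeries.coeff 0 (G b w) = b.coeff w := by
  have h := constantCoeff_of_mem_bracketSpan (G_sub_mem hb h1 hw)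
  rw [map_sub, map_sub, constantCoeff_bracket (by simpa using hw), sub_zero,
    PowerSeries.coeff_zero_C] at h
  linarith

/-! ### The functions `∑ n^k / k! e^{-nx}` -/

/-- `∑_{n ≥ 1} n^k / k! e^{-nx}`. -/
noncomputable def expLambert (k : ℕ) (x : ℝ) : ℝ :=
  ∑' n : ℕ, ((n + 1 : ℕ) : ℝ) ^ k / k.factorial * Real.exp (-x) ^ (n + 1)

section ExpLambert

variable {x : ℝ}

lemma exp_neg_lt_one (hx : 0 < x) : Real.exp (-x) < 1 := by simpa using hx

lemma hasSum_choose_exp (k : ℕ) (hx : 0 < x) :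
    HasSum (fun n : ℕ => ((n + k).choose k : ℝ) * Real.exp (-x) ^ n)
      (1 / (1 - Real.exp (-x)) ^ (k + 1)) :=
  hasSum_choose_mul_geometric_of_norm_lt_one k
    (by rw [Real.norm_of_nonneg (Real.exp_pos _).le]; exact exp_neg_lt_one hx)

lemma expLambert_term_le (k n : ℕ) (x : ℝ) :
    ((n + 1 : ℕ) : ℝ) ^ k / k.factorial * Real.exp (-x) ^ (n + 1) ≤
      Real.exp (-x) * (((n + k).choose k : ℝ) * Real.exp (-x) ^ n) := by
  have h1 : ((n + 1 : ℕ) : ℝ) ^ k / k.factorial ≤ ((n + k).choose k : ℝ) := by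
    rw [div_le_iff₀ (by positivity)]
    have h := Nat.pow_succ_le_ascFactorial (n + 1) k
    rw [Nat.ascFactorial_eq_factorial_mul_choose] at h
    calc ((n + 1 : ℕ) : ℝ) ^ k ≤ ((k.factorial * (n + k).choose k : ℕ) : ℝ) := by
          exact_mod_cast h
      _ = _ := by push_cast; ring
  calc _ ≤ ((n + k).choose k : ℝ) * Real.exp (-x) ^ (n + 1) := by gcongr
    _ = _ := by ring

lemma summable_expLambert (k : ℕ) (hx : 0 < x) : Summable fun n : ℕ =>
    ((n + 1 : ℕ) : ℝ) ^ k / k.factorial * Real.exp (-x) ^ (n + 1) :=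
  Summable.of_nonneg_of_le (fun _ => by positivity) (fun n => expLambert_term_le k n x)
    ((hasSum_choose_exp k hx).summable.mul_left _)

lemma expLambert_nonneg (k : ℕ) (x : ℝ) : 0 ≤ expLambert k x :=
  tsum_nonneg fun _ => by positivity

lemma expLambert_le (k : ℕ) (hx : 0 < x) :
    expLambert k x ≤ Real.exp (-x) / (1 - Real.exp (-x)) ^ (k + 1) := by
  have h := (hasSum_choose_exp k hx).mul_left (Real.exp (-x))
  rw [mul_one_div] at h
  exact hasSum_le (fun n => expLambert_term_le k n x) (summable_expLambert k hx).hasSum h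

/-- With `y = e^{-x}`, comparing `n^k / k!` with binomial coefficients from both sides sandwiches
the series between `(y/(1-y))^{k+1}` and `y/(1-y)^{k+1}` (`expLambert_le`). The quotient of the
bounds is `y^k`, which tends to `1` as `x → 0`. -/
lemma pow_le_expLambert (k : ℕ) (hx : 0 < x) :
    (Real.exp (-x) / (1 - Real.exp (-x))) ^ (k + 1) ≤ expLambert k x := by
  have h := (hasSum_choose_exp k hx).mul_left (Real.exp (-x) ^ (k + 1))
  rw [mul_one_div, ← div_pow] at h
  have h2 := summable_expLambert k hx
  have h3 : Summable fun n : ℕ =>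
      ((n + k + 1 : ℕ) : ℝ) ^ k / k.factorial * Real.exp (-x) ^ (n + k + 1) :=
    (summable_nat_add_iff k).mpr h2
  refine (hasSum_le (fun n => ?_) h h3.hasSum).trans ?_
  · have h4 : ((n + k).choose k : ℝ) ≤ ((n + k + 1 : ℕ) : ℝ) ^ k / k.factorial := by
      refine (Nat.choose_le_pow_div k (n + k)).trans ?_
      refine div_le_div_of_nonneg_right (pow_le_pow_left₀ (by positivity) ?_ k) (by positivity)
      push_cast
      linarith
    calc _ = ((n + k).choose k : ℝ) * Real.exp (-x) ^ (n + k + 1) := by ring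
      _ ≤ _ := by gcongr
  · rw [expLambert, ← h2.sum_add_tsum_nat_add k]
    exact le_add_of_nonneg_left (Finset.sum_nonneg fun _ _ => by positivity)

lemma div_one_sub_exp_le (hx : 0 < x) : x / (1 - Real.exp (-x)) ≤ 1 + x := by
  have h1 := exp_neg_lt_one hx
  rw [div_le_iff₀ (by linarith)]
  have h2 : (1 + x) * Real.exp (-x) ≤ 1 := by
    rw [Real.exp_neg, ← div_eq_mul_inv, div_le_one (Real.exp_pos _), add_comm]
    exact Real.add_one_le_exp x
  linarith

lemma one_add_pow_mul_exp_le (N : ℕ) (hx : 0 < x) :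
    (1 + x) ^ N * Real.exp (-x) ≤ N.factorial * Real.exp 1 := by
  have h := Real.pow_div_factorial_le_exp (1 + x) (by linarith) N
  rw [div_le_iff₀ (by positivity), Real.exp_add] at h
  rw [Real.exp_neg, ← div_eq_mul_inv, div_le_iff₀ (Real.exp_pos _)]
  linarith

/-- The pole at `x = 0` is cancelled by `x/(1-e^{-x}) ≤ 1+x`, and `e^{-x}` pays for the powers of
`1+x` with one to spare. -/
lemma pow_mul_expLambert_le (k : ℕ) (hx : 0 < x) :
    x ^ (k + 1) * expLambert k x ≤ (k + 2).factorial * Real.exp 1 / (1 + x) := by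
  have h1 := exp_neg_lt_one hx
  calc x ^ (k + 1) * expLambert k x
      ≤ x ^ (k + 1) * (Real.exp (-x) / (1 - Real.exp (-x)) ^ (k + 1)) := by
        gcongr; exact expLambert_le k hx
    _ = (x / (1 - Real.exp (-x))) ^ (k + 1) * Real.exp (-x) := by rw [div_pow]; ring
    _ ≤ (1 + x) ^ (k + 1) * Real.exp (-x) := by
        have h2 : 0 ≤ x / (1 - Real.exp (-x)) := div_nonneg hx.le (by linarith)
        gcongr
        exact div_one_sub_exp_le hx
    _ ≤ _ := by
        rw [le_div_iff₀ (by linarith)]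
        calc _ = (1 + x) ^ (k + 2) * Real.exp (-x) := by ring
          _ ≤ _ := one_add_pow_mul_exp_le _ hx

/-- The sandwich leaves an additional factor `1 - e^{-kx} ≤ kx`, which yields the gain of a factor
`t` in `lambertLetter_sub_le`. -/
lemma pow_mul_expLambert_sub_le (k : ℕ) (hx : 0 < x) :
    x ^ (k + 1) * (expLambert k x - (Real.exp (-x) / (1 - Real.exp (-x))) ^ (k + 1)) ≤
      (k + 2).factorial * Real.exp 1 / (1 + x) * (k * x) := by
  have h1 := exp_neg_lt_one hx
  have h0 : 1 - Real.exp (-x) ^ k ≤ k * x := by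
    rw [← Real.exp_nat_mul]
    have := Real.add_one_le_exp ((k : ℝ) * -x)
    linarith
  have h0' : 0 ≤ 1 - Real.exp (-x) ^ k := by
    have := pow_le_one₀ (n := k) (Real.exp_pos (-x)).le h1.le
    linarith
  have hp : 0 < x / (1 - Real.exp (-x)) := div_pos hx (by linarith)
  calc x ^ (k + 1) * (expLambert k x - (Real.exp (-x) / (1 - Real.exp (-x))) ^ (k + 1))
      ≤ x ^ (k + 1) * (Real.exp (-x) / (1 - Real.exp (-x)) ^ (k + 1) -
          (Real.exp (-x) / (1 - Real.exp (-x))) ^ (k + 1)) := by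
        gcongr; exact expLambert_le k hx
    _ = (x / (1 - Real.exp (-x))) ^ (k + 1) * Real.exp (-x) * (1 - Real.exp (-x) ^ k) := by
        rw [div_pow, div_pow]; ring
    _ ≤ (1 + x) ^ (k + 1) * Real.exp (-x) * (k * x) := by
        gcongr
        exact div_one_sub_exp_le hx
    _ ≤ _ := by
        gcongr
        rw [le_div_iff₀ (by linarith)]
        calc _ = (1 + x) ^ (k + 2) * Real.exp (-x) := by ring
          _ ≤ _ := one_add_pow_mul_exp_le _ hx

lemma exp_neg_div_eq (x : ℝ) :
    Real.exp (-x) / (1 - Real.exp (-x)) = 1 / (Real.exp x - 1) := by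
  have := Real.exp_pos x
  rw [Real.exp_neg]
  rw [← mul_div_mul_left _ _ this.ne', mul_sub, mul_inv_cancel₀ this.ne', mul_one]

lemma inv_one_add_le_rpow {δ : ℝ} (h0 : 0 ≤ δ) (h1 : δ ≤ 1) (hx : 0 < x) :
    1 / (1 + x) ≤ x ^ (-δ) := by
  rw [Real.rpow_neg hx.le, ← one_div]
  refine one_div_le_one_div_of_le (Real.rpow_pos_of_pos hx _) ?_
  rcases le_total x 1 with h | h
  · linarith [Real.rpow_le_one hx.le h h0]
  · have := Real.rpow_le_rpow_of_exponent_le h h1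
    rw [Real.rpow_one] at this
    linarith

end ExpLambert

/-! ### The letters -/

/-- `t^{k+1} ∑_n n^k / k! e^{-nmt}`, the coefficient of `X^k` in `t L_m(tX)` at `q = e^{-t}`. -/
noncomputable def lambertLetter (t : ℝ) (k m : ℕ) : ℝ := t ^ (k + 1) * expLambert k (m * t)

/-- `(t / (e^{mt} - 1))^{k+1}`. -/
noncomputable def stuffleLetter (t : ℝ) (k m : ℕ) : ℝ := (t / (Real.exp (m * t) - 1)) ^ (k + 1)

section Letters

variable {t : ℝ} {m : ℕ}

lemma mul_rpow_letter {δ : ℝ} (ht : 0 < t) (hm : 1 ≤ m) :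
    (m : ℝ)⁻¹ * (m * t) ^ (-δ) = t ^ (-δ) * (m : ℝ) ^ (-(1 + δ)) := by
  have hm' : (0 : ℝ) < m := by exact_mod_cast hm
  rw [Real.mul_rpow hm'.le ht.le, neg_add, Real.rpow_add hm', Real.rpow_neg_one]
  ring

lemma letter_arg_pos (ht : 0 < t) (hm : 1 ≤ m) : 0 < (m : ℝ) * t :=
  mul_pos (by exact_mod_cast hm) ht

lemma exp_sub_one_pos (ht : 0 < t) (hm : 1 ≤ m) : 0 < Real.exp (m * t) - 1 := by
  have := Real.add_one_lt_exp (letter_arg_pos ht hm).ne'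
  linarith [letter_arg_pos ht hm]

lemma stuffleLetter_nonneg (ht : 0 < t) (k : ℕ) (hm : 1 ≤ m) : 0 ≤ stuffleLetter t k m :=
  pow_nonneg (div_nonneg ht.le (exp_sub_one_pos ht hm).le) _

lemma stuffleLetter_eq (t : ℝ) (k m : ℕ) : stuffleLetter t k m = t ^ (k + 1) *
    (Real.exp (-(m * t)) / (1 - Real.exp (-(m * t)))) ^ (k + 1) := by
  rw [stuffleLetter, exp_neg_div_eq, ← mul_pow, mul_one_div]

lemma stuffleLetter_le_lambertLetter (ht : 0 < t) (k : ℕ) (hm : 1 ≤ m) :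
    stuffleLetter t k m ≤ lambertLetter t k m := by
  rw [stuffleLetter_eq, lambertLetter]
  gcongr
  exact pow_le_expLambert k (letter_arg_pos ht hm)

lemma lambertLetter_nonneg (ht : 0 < t) (k m : ℕ) : 0 ≤ lambertLetter t k m :=
  mul_nonneg (by positivity) (expLambert_nonneg _ _)

/-- The constant in the bounds for the letters. -/
noncomputable def letterConst (k : ℕ) : ℝ := (k + 1) * ((k + 2).factorial * Real.exp 1)

/-- The decay `1/(1+mt)` is weakened to `(mt)^{-δ}`. For `δ > 0` this makes even the letters of
weight one summable over `m`, at the price of only `t^{-δ}`. -/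
lemma lambertLetter_le {δ : ℝ} (h0 : 0 ≤ δ) (h1 : δ ≤ 1) (ht : 0 < t) (k : ℕ) (hm : 1 ≤ m) :
    lambertLetter t k m ≤ letterConst k * (t ^ (-δ) * (m : ℝ) ^ (-(1 + δ))) := by
  have hx := letter_arg_pos ht hm
  have hm' : (1 : ℝ) ≤ m := by exact_mod_cast hm
  rw [← mul_rpow_letter ht hm]
  have key := pow_mul_expLambert_le k hx
  have e1 : lambertLetter t k m =
      ((m : ℝ)⁻¹) ^ (k + 1) * ((m * t) ^ (k + 1) * expLambert k (m * t)) := by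
    rw [lambertLetter, mul_pow, ← mul_assoc, ← mul_assoc, ← mul_pow, inv_mul_cancel₀ (by positivity),
      one_pow, one_mul]
  rw [e1]
  have h2 : ((m : ℝ)⁻¹) ^ (k + 1) ≤ (m : ℝ)⁻¹ :=
    pow_le_of_le_one (by positivity) (inv_le_one_of_one_le₀ hm') (by omega)
  have hE := expLambert_nonneg k (m * t)
  have hf : (0 : ℝ) ≤ (k + 2).factorial * Real.exp 1 := by positivity
  calc _ ≤ (m : ℝ)⁻¹ * ((k + 2).factorial * Real.exp 1 / (1 + m * t)) := by gcongr
    _ = (k + 2).factorial * Real.exp 1 * ((m : ℝ)⁻¹ * (1 / (1 + m * t))) := by ring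
    _ ≤ (k + 2).factorial * Real.exp 1 * ((m : ℝ)⁻¹ * (m * t) ^ (-δ)) := by
        gcongr
        exact inv_one_add_le_rpow h0 h1 hx
    _ ≤ _ := by
        gcongr
        unfold letterConst
        have : (0 : ℝ) ≤ k := by positivity
        nlinarith

lemma lambertLetter_sub_le {δ : ℝ} (h0 : 0 ≤ δ) (h1 : δ ≤ 1) (ht : 0 < t) (k : ℕ) (hm : 1 ≤ m) :
    lambertLetter t k m - stuffleLetter t k m ≤
      t * (letterConst k * (t ^ (-δ) * (m : ℝ) ^ (-(1 + δ)))) := by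
  have hx := letter_arg_pos ht hm
  have hm' : (1 : ℝ) ≤ m := by exact_mod_cast hm
  rw [← mul_rpow_letter ht hm]
  have key := pow_mul_expLambert_sub_le k hx
  have e1 : lambertLetter t k m - stuffleLetter t k m =
      ((m : ℝ)⁻¹) ^ (k + 1) * ((m * t) ^ (k + 1) * (expLambert k (m * t) -
        (Real.exp (-(m * t)) / (1 - Real.exp (-(m * t)))) ^ (k + 1))) := by
    rw [lambertLetter, stuffleLetter_eq, ← mul_sub, mul_pow (m : ℝ) t, ← mul_assoc, ← mul_assoc,
      ← mul_pow, inv_mul_cancel₀ (by positivity), one_pow, one_mul]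
  rw [e1]
  -- The gain `k m t` brings back one power of `m`. For `k ≥ 1` the letter has a power to spare, and
  -- for `k = 0` the gain is zero.
  have h2 : ((m : ℝ)⁻¹) ^ (k + 1) * (k * (m * t)) ≤ (m : ℝ)⁻¹ * (k * t) := by
    rcases Nat.eq_zero_or_pos k with rfl | hk
    · simp
    · have : ((m : ℝ)⁻¹) ^ k ≤ (m : ℝ)⁻¹ :=
        pow_le_of_le_one (by positivity) (inv_le_one_of_one_le₀ hm') (by omega)
      calc _ = ((m : ℝ)⁻¹) ^ k * ((m : ℝ)⁻¹ * m) * (k * t) := by ring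
        _ = ((m : ℝ)⁻¹) ^ k * (k * t) := by rw [inv_mul_cancel₀ (by positivity), mul_one]
        _ ≤ _ := by gcongr
  have hf : (0 : ℝ) ≤ (k + 2).factorial * Real.exp 1 := by positivity
  calc _ ≤ ((m : ℝ)⁻¹) ^ (k + 1) *
        ((k + 2).factorial * Real.exp 1 / (1 + m * t) * (k * (m * t))) := by gcongr
    _ = (k + 2).factorial * Real.exp 1 * (1 / (1 + m * t)) *
        (((m : ℝ)⁻¹) ^ (k + 1) * (k * (m * t))) := by ring
    _ ≤ (k + 2).factorial * Real.exp 1 * (m * t) ^ (-δ) * ((m : ℝ)⁻¹ * (k * t)) := by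
        gcongr
        exact inv_one_add_le_rpow h0 h1 hx
    _ = t * ((k * ((k + 2).factorial * Real.exp 1)) * ((m : ℝ)⁻¹ * (m * t) ^ (-δ))) := by ring
    _ ≤ _ := by
        gcongr
        unfold letterConst
        nlinarith

lemma stuffleLetter_le_inv_pow (ht : 0 < t) (k : ℕ) (hm : 1 ≤ m) :
    stuffleLetter t k m ≤ ((m : ℝ) ^ (k + 1))⁻¹ := by
  have hx := letter_arg_pos ht hm
  rw [stuffleLetter, ← inv_pow]
  gcongr
  · exact div_nonneg ht.le (exp_sub_one_pos ht hm).le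
  rw [div_le_iff₀ (exp_sub_one_pos ht hm), inv_mul_eq_div, le_div_iff₀ (by positivity)]
  linarith [Real.add_one_le_exp (m * t)]

/-- The letter is at least `e^{-(k+1)mt} m^{-(k+1)}`. The exponent `1/2` instead of `1` is a
compromise: it still tends to `0` with `t`, but costs only `m^{1/2}`, which a leading letter of
weight at least two can absorb. -/
lemma inv_pow_sub_stuffleLetter_le (ht : 0 < t) (k : ℕ) (hm : 1 ≤ m) :
    ((m : ℝ) ^ (k + 1))⁻¹ - stuffleLetter t k m ≤
      (k + 1) * (m * t) ^ (1 / 2 : ℝ) * ((m : ℝ) ^ (k + 1))⁻¹ := by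
  have hx := letter_arg_pos ht hm
  have hm' : (1 : ℝ) ≤ m := by exact_mod_cast hm
  have h1 : Real.exp (-((k + 1 : ℕ) * (m * t))) * ((m : ℝ) ^ (k + 1))⁻¹ ≤ stuffleLetter t k m := by
    rw [stuffleLetter, ← inv_pow, ← mul_neg, Real.exp_nat_mul, ← mul_pow]
    gcongr
    rw [le_div_iff₀ (exp_sub_one_pos ht hm), Real.exp_neg]
    have h2 : Real.exp (m * t) - 1 ≤ m * t * Real.exp (m * t) := by
      have := Real.add_one_le_exp (-(m * t))
      have h3 := mul_le_mul_of_nonneg_right this (Real.exp_pos (m * t)).le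
      rw [← Real.exp_add, neg_add_cancel, Real.exp_zero] at h3
      linarith
    calc _ ≤ (Real.exp (m * t))⁻¹ * (m : ℝ)⁻¹ * (m * t * Real.exp (m * t)) := by gcongr
      _ = t := by field_simp
  have h2 : 1 - Real.exp (-((k + 1 : ℕ) * (m * t))) ≤ (k + 1) * (m * t) ^ (1 / 2 : ℝ) := by
    rcases le_total ((m : ℝ) * t) 1 with h | h
    · have h3 : (m : ℝ) * t ≤ (m * t) ^ (1 / 2 : ℝ) := by
        conv_lhs => rw [← Real.rpow_one (m * t)]
        exact Real.rpow_le_rpow_of_exponent_ge hx h (by norm_num)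
      have h4 := Real.add_one_le_exp (-((k + 1 : ℕ) * (m * t)))
      have h5 : ((k : ℝ) + 1) * (m * t) ≤ (k + 1) * (m * t) ^ (1 / 2 : ℝ) := by gcongr
      push_cast at h4 ⊢
      linarith
    · have h3 := Real.one_le_rpow h (show (0 : ℝ) ≤ 1 / 2 by norm_num)
      have h4 := Real.exp_pos (-((k + 1 : ℕ) * (m * t)))
      have h5 : (0 : ℝ) ≤ k := by positivity
      nlinarith
  have h3 : (0 : ℝ) ≤ ((m : ℝ) ^ (k + 1))⁻¹ := by positivity
  calc _ ≤ (1 - Real.exp (-((k + 1 : ℕ) * (m * t)))) * ((m : ℝ) ^ (k + 1))⁻¹ := by linarith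
    _ ≤ _ := by gcongr

end Letters

/-! ### Bounds for nested sums -/

section Bounds

variable {ι : Type*} {a A : ι → ℕ → ℝ}

lemma nestedSum_nonneg {l : List ι} {M : ℕ} (ha : ∀ k ∈ l, ∀ m, 1 ≤ m → m < M → 0 ≤ a k m) :
    0 ≤ nestedSum a l M := by
  induction l generalizing M with
  | nil => simp [nestedSum]
  | cons k l ih =>
    refine Finset.sum_nonneg fun m hm => ?_
    rw [Finset.mem_Ico] at hm
    exact mul_nonneg (ha k (by simp) m hm.1 hm.2)
      (ih fun k' hk' m' h1 h2 => ha k' (by simp [hk']) m' h1 (h2.trans hm.2))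

lemma nestedSum_mono {l : List ι} (ha : ∀ k ∈ l, ∀ m, 1 ≤ m → 0 ≤ a k m) :
    Monotone (nestedSum a l) := by
  cases l with
  | nil => exact fun _ _ _ => le_rfl
  | cons k l =>
    intro M M' h
    refine Finset.sum_le_sum_of_subset_of_nonneg (Finset.Ico_subset_Ico_right h) fun m hm _ => ?_
    exact mul_nonneg (ha k (by simp) m (Finset.mem_Ico.mp hm).1)
      (nestedSum_nonneg fun k' hk' m' h1 _ => ha k' (by simp [hk']) m' h1)

lemma nestedSum_le {l : List ι} {M : ℕ} {B : ℕ → ℝ} {S : ℝ}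
    (ha : ∀ k ∈ l, ∀ m, 1 ≤ m → m < M → 0 ≤ a k m ∧ a k m ≤ B m)
    (hB : ∀ m, 1 ≤ m → 0 ≤ B m) (hS : ∑ m ∈ Finset.Ico 1 M, B m ≤ S) :
    nestedSum a l M ≤ S ^ l.length := by
  have hB' : ∀ M, 0 ≤ ∑ m ∈ Finset.Ico 1 M, B m := fun M =>
    Finset.sum_nonneg fun m hm => hB m (Finset.mem_Ico.mp hm).1
  induction l generalizing M with
  | nil => simp [nestedSum]
  | cons k l ih =>
    have hS0 : 0 ≤ S := (hB' M).trans hS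
    calc nestedSum a (k :: l) M ≤ ∑ m ∈ Finset.Ico 1 M, B m * S ^ l.length := by
          refine Finset.sum_le_sum fun m hm => ?_
          rw [Finset.mem_Ico] at hm
          refine mul_le_mul (ha k (by simp) m hm.1 hm.2).2 (ih (fun k' hk' m' h1 h2 =>
            ha k' (by simp [hk']) m' h1 (h2.trans hm.2)) (le_trans ?_ hS))
            (nestedSum_nonneg fun k' hk' m' h1 h2 =>
              (ha k' (by simp [hk']) m' h1 (h2.trans hm.2)).1) (hB m hm.1)
          exact Finset.sum_le_sum_of_subset_of_nonneg (Finset.Ico_subset_Ico_right hm.2.le)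
            fun m hm _ => hB m (Finset.mem_Ico.mp hm).1
      _ = (∑ m ∈ Finset.Ico 1 M, B m) * S ^ l.length := by rw [Finset.sum_mul]
      _ ≤ S * S ^ l.length := by gcongr
      _ = _ := by rw [List.length_cons, pow_succ']

/-- The letters are exchanged one at a time: each exchange costs a factor `η`, and everything else
is bounded by the majorant. -/
lemma abs_nestedSum_sub_le {l : List ι} {M : ℕ} {B : ℕ → ℝ} {S η : ℝ} (hη : 0 ≤ η)
    (ha : ∀ k ∈ l, ∀ m, 1 ≤ m → m < M → 0 ≤ a k m ∧ a k m ≤ B m)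
    (hA : ∀ k ∈ l, ∀ m, 1 ≤ m → m < M → 0 ≤ A k m ∧ A k m ≤ B m)
    (hd : ∀ k ∈ l, ∀ m, 1 ≤ m → m < M → |A k m - a k m| ≤ η * B m)
    (hB : ∀ m, 1 ≤ m → 0 ≤ B m) (hS : ∑ m ∈ Finset.Ico 1 M, B m ≤ S) :
    |nestedSum A l M - nestedSum a l M| ≤ l.length * η * S ^ l.length := by
  have hB' : ∀ M, 0 ≤ ∑ m ∈ Finset.Ico 1 M, B m := fun M =>
    Finset.sum_nonneg fun m hm => hB m (Finset.mem_Ico.mp hm).1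
  induction l generalizing M with
  | nil => simp [nestedSum]
  | cons k l ih =>
    have hS0 : 0 ≤ S := (hB' M).trans hS
    rw [nestedSum, nestedSum, ← Finset.sum_sub_distrib]
    calc _ ≤ ∑ m ∈ Finset.Ico 1 M, |A k m * nestedSum A l m - a k m * nestedSum a l m| :=
          Finset.abs_sum_le_sum_abs _ _
      _ ≤ ∑ m ∈ Finset.Ico 1 M, B m * ((l.length + 1) * η * S ^ l.length) := by
          refine Finset.sum_le_sum fun m hm => ?_
          rw [Finset.mem_Ico] at hm
          have hS' : ∑ m ∈ Finset.Ico 1 m, B m ≤ S := le_trans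
            (Finset.sum_le_sum_of_subset_of_nonneg (Finset.Ico_subset_Ico_right hm.2.le)
              fun m hm _ => hB m (Finset.mem_Ico.mp hm).1) hS
          have h1 := ih (fun k' hk' m' h1 h2 => ha k' (by simp [hk']) m' h1 (h2.trans hm.2))
            (fun k' hk' m' h1 h2 => hA k' (by simp [hk']) m' h1 (h2.trans hm.2))
            (fun k' hk' m' h1 h2 => hd k' (by simp [hk']) m' h1 (h2.trans hm.2)) hS'
          have h2 : nestedSum A l m ≤ S ^ l.length := nestedSum_le
            (fun k' hk' m' h1 h2 => hA k' (by simp [hk']) m' h1 (h2.trans hm.2)) hB hS'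
          have h3 : 0 ≤ nestedSum A l m := nestedSum_nonneg
            (fun k' hk' m' h1 h2 => (hA k' (by simp [hk']) m' h1 (h2.trans hm.2)).1)
          have h4 := hd k (by simp) m hm.1 hm.2
          have h5 := ha k (by simp) m hm.1 hm.2
          calc _ = |(A k m - a k m) * nestedSum A l m +
                a k m * (nestedSum A l m - nestedSum a l m)| := by ring_nf
            _ ≤ |A k m - a k m| * nestedSum A l m +
                a k m * |nestedSum A l m - nestedSum a l m| := by
              refine (abs_add_le _ _).trans ?_
              rw [abs_mul, abs_mul, abs_of_nonneg h3, abs_of_nonneg h5.1]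
            _ ≤ η * B m * S ^ l.length + B m * (l.length * η * S ^ l.length) := by
              have hBm := hB m hm.1
              refine add_le_add (mul_le_mul h4 h2 h3 (by positivity))
                (mul_le_mul h5.2 h1 (abs_nonneg _) hBm)
            _ = _ := by ring
      _ = (∑ m ∈ Finset.Ico 1 M, B m) * ((l.length + 1) * η * S ^ l.length) := by
          rw [Finset.sum_mul]
      _ ≤ S * ((l.length + 1) * η * S ^ l.length) := by gcongr
      _ = _ := by rw [List.length_cons, pow_succ']; push_cast; ring

end Bounds

lemma exists_sum_rpow_le {δ : ℝ} (hδ : 0 < δ) :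
    ∃ P : ℝ, 0 ≤ P ∧ ∀ M : ℕ, ∑ m ∈ Finset.Ico 1 M, (m : ℝ) ^ (-(1 + δ)) ≤ P := by
  have h : Summable fun m : ℕ => (m : ℝ) ^ (-(1 + δ)) := Real.summable_nat_rpow.mpr (by linarith)
  exact ⟨_, tsum_nonneg fun m => by positivity,
    fun M => h.sum_le_tsum _ fun m _ => by positivity⟩

lemma exists_forall_le_of_list {ι : Type*} (f : ι → ℝ) (l : List ι) :
    ∃ K : ℝ, 0 ≤ K ∧ ∀ k ∈ l, f k ≤ K := by
  induction l with
  | nil => exact ⟨0, le_rfl, by simp⟩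
  | cons a l ih =>
    obtain ⟨K, h0, h⟩ := ih
    refine ⟨max (f a) K, le_max_of_le_right h0, fun k hk => ?_⟩
    rcases List.mem_cons.mp hk with rfl | hk
    · exact le_max_left _ _
    · exact (h k hk).trans (le_max_right _ _)

/-! ### Uniform estimates for nested sums of the letters -/

section Letters

lemma exists_majorant (l : List ℕ) {δ : ℝ} (h0 : 0 < δ) (h1 : δ ≤ 1) :
    ∃ K P : ℝ, 0 ≤ K ∧ 0 ≤ P ∧ ∀ t : ℝ, 0 < t → ∃ B : ℕ → ℝ,
      (∀ m, 1 ≤ m → 0 ≤ B m) ∧ (∀ M, ∑ m ∈ Finset.Ico 1 M, B m ≤ K * P * t ^ (-δ)) ∧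
      ∀ k ∈ l, ∀ m, 1 ≤ m → (0 ≤ stuffleLetter t k m ∧ stuffleLetter t k m ≤ B m) ∧
        (0 ≤ lambertLetter t k m ∧ lambertLetter t k m ≤ B m) ∧
        |lambertLetter t k m - stuffleLetter t k m| ≤ t * B m := by
  obtain ⟨K, hK, hl⟩ := exists_forall_le_of_list letterConst l
  obtain ⟨P, hP, hsum⟩ := exists_sum_rpow_le h0
  refine ⟨K, P, hK, hP, fun t ht => ⟨fun m => K * (t ^ (-δ) * (m : ℝ) ^ (-(1 + δ))),
    fun m _ => by positivity, fun M => ?_, fun k hk m hm => ?_⟩⟩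
  · rw [← Finset.mul_sum, ← Finset.mul_sum, mul_assoc, mul_comm P]
    gcongr
    exact hsum M
  · have hle : letterConst k * (t ^ (-δ) * (m : ℝ) ^ (-(1 + δ))) ≤
        K * (t ^ (-δ) * (m : ℝ) ^ (-(1 + δ))) := by
      gcongr
      exact hl k hk
    have h2 := (lambertLetter_le h0.le h1 ht k hm).trans hle
    have h3 := stuffleLetter_le_lambertLetter ht k hm
    refine ⟨⟨stuffleLetter_nonneg ht k hm, h3.trans h2⟩, ⟨lambertLetter_nonneg ht k m, h2⟩, ?_⟩
    rw [abs_of_nonneg (sub_nonneg.mpr h3)]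
    exact (lambertLetter_sub_le h0.le h1 ht k hm).trans (by gcongr)

lemma pow_mul_rpow_le {C t δ ε : ℝ} (hC : 0 ≤ C) (ht : 0 < t) (ht1 : t ≤ 1) {r : ℕ}
    (h : r * δ ≤ ε) : (C * t ^ (-δ)) ^ r ≤ C ^ r * t ^ (-ε) := by
  rw [mul_pow, ← Real.rpow_mul_natCast ht.le]
  gcongr 1
  exact Real.rpow_le_rpow_of_exponent_ge ht ht1 (by linarith)

lemma length_mul_div_le (n : ℕ) {ε : ℝ} (h : 0 < ε) : n * (ε / (n + 1)) ≤ ε := by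
  have : (0 : ℝ) ≤ n := by positivity
  rw [← mul_div_assoc, div_le_iff₀ (by positivity)]
  nlinarith

lemma div_length_le (n : ℕ) {ε : ℝ} (h1 : ε ≤ 1) : ε / (n + 1) ≤ 1 := by
  have : (0 : ℝ) ≤ n := by positivity
  rw [div_le_iff₀ (by positivity)]
  linarith

lemma exists_nestedSum_le (l : List ℕ) {ε : ℝ} (h0 : 0 < ε) (h1 : ε ≤ 1) :
    ∃ C : ℝ, 0 ≤ C ∧ ∀ t : ℝ, 0 < t → t ≤ 1 → ∀ M,
      nestedSum (lambertLetter t) l M ≤ C * t ^ (-ε) ∧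
      nestedSum (stuffleLetter t) l M ≤ C * t ^ (-ε) := by
  -- Each letter costs `t^{-δ}`, so this `δ` keeps the total loss below `t^{-ε}`; the `+ 1` covers
  -- the empty word.
  obtain ⟨K, P, hK, hP, h⟩ := exists_majorant l (δ := ε / (l.length + 1)) (by positivity)
    (div_length_le _ h1)
  refine ⟨(K * P) ^ l.length, by positivity, fun t ht ht1 M => ?_⟩
  obtain ⟨B, hB, hS, hl⟩ := h t ht
  have hle := pow_mul_rpow_le (mul_nonneg hK hP) ht ht1 (length_mul_div_le l.length h0)
  exact ⟨(nestedSum_le (fun k hk m hm _ => (hl k hk m hm).2.1) hB (hS M)).trans hle,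
    (nestedSum_le (fun k hk m hm _ => (hl k hk m hm).1) hB (hS M)).trans hle⟩

/-- Exchanging a letter gains `t`, while all letters together lose at most `t^{-1/2}`. -/
lemma exists_lambert_sub_stuffle_le (l : List ℕ) :
    ∃ C : ℝ, ∀ t : ℝ, 0 < t → t ≤ 1 → ∀ M,
      |nestedSum (lambertLetter t) l M - nestedSum (stuffleLetter t) l M| ≤ C * t ^ (1 / 2 : ℝ) := by
  obtain ⟨K, P, hK, hP, h⟩ := exists_majorant l (δ := (1 / 2) / (l.length + 1)) (by positivity)
    (div_length_le _ (by norm_num))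
  refine ⟨l.length * (K * P) ^ l.length, fun t ht ht1 M => ?_⟩
  obtain ⟨B, hB, hS, hl⟩ := h t ht
  have hle := pow_mul_rpow_le (mul_nonneg hK hP) ht ht1
    (length_mul_div_le l.length (show (0 : ℝ) < 1 / 2 by norm_num))
  refine (abs_nestedSum_sub_le ht.le (fun k hk m hm _ => (hl k hk m hm).1)
    (fun k hk m hm _ => (hl k hk m hm).2.1) (fun k hk m hm _ => (hl k hk m hm).2.2)
    hB (hS M)).trans ?_
  calc _ ≤ l.length * t * ((K * P) ^ l.length * t ^ (-(1 / 2) : ℝ)) := by gcongr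
    _ = l.length * (K * P) ^ l.length * (t ^ (1 : ℝ) * t ^ (-(1 / 2) : ℝ)) := by
        rw [Real.rpow_one]; ring
    _ = _ := by
        rw [← Real.rpow_add ht]
        norm_num

/-- `m^{-(k+1)}`. -/
noncomputable def zetaLetter (k m : ℕ) : ℝ := ((m : ℝ) ^ (k + 1))⁻¹

lemma zetaLetter_nonneg (k m : ℕ) : 0 ≤ zetaLetter k m := by
  unfold zetaLetter
  positivity

/-- Below the cutoff `M` the harmonic letter is made summable by paying `M^δ`. In this way the
logarithms coming from letters `z_1` are bounded by a small power of the next larger index. -/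
lemma zetaLetter_le {δ : ℝ} (h0 : 0 ≤ δ) (k : ℕ) {m M : ℕ} (hm : 1 ≤ m) (hM : m ≤ M) :
    zetaLetter k m ≤ (M : ℝ) ^ δ * (m : ℝ) ^ (-(1 + δ)) := by
  have hm' : (1 : ℝ) ≤ m := by exact_mod_cast hm
  have hM' : (m : ℝ) ≤ M := by exact_mod_cast hM
  calc zetaLetter k m ≤ (m : ℝ)⁻¹ := by
        unfold zetaLetter
        gcongr
        exact le_self_pow₀ hm' (by omega)
    _ = (m : ℝ) ^ δ * (m : ℝ) ^ (-(1 + δ)) := by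
        rw [← Real.rpow_add (by linarith), ← Real.rpow_neg_one]
        congr 1
        ring
    _ ≤ _ := by gcongr

lemma natCast_pow_rpow_le {r m : ℕ} {δ P : ℝ} (hm : 1 ≤ m) (hP : 0 ≤ P) (h : r * δ ≤ 1 / 4) :
    ((m : ℝ) ^ δ * P) ^ r ≤ (m : ℝ) ^ (1 / 4 : ℝ) * P ^ r := by
  have hm' : (1 : ℝ) ≤ m := by exact_mod_cast hm
  rw [mul_pow, ← Real.rpow_mul_natCast (by linarith)]
  gcongr 1
  exact Real.rpow_le_rpow_of_exponent_le hm' (by linarith)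

/-- These are bounds for the part of a word behind its first letter, where letters `z_1` are
allowed: growth at most `m^{1/4}`, and deviation smaller by `(mt)^{1/2}`. -/
lemma exists_nestedSum_zeta (l : List ℕ) :
    ∃ C : ℝ, 0 ≤ C ∧ ∀ m, 1 ≤ m → nestedSum zetaLetter l m ≤ C * (m : ℝ) ^ (1 / 4 : ℝ) ∧
      ∀ t : ℝ, 0 < t → |nestedSum zetaLetter l m - nestedSum (stuffleLetter t) l m| ≤
        C * (m * t) ^ (1 / 2 : ℝ) * (m : ℝ) ^ (1 / 4 : ℝ) := by
  set δ : ℝ := (1 / 4) / (l.length + 1) with hδ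
  have h0 : 0 < δ := by positivity
  have hlen := length_mul_div_le l.length (show (0 : ℝ) < 1 / 4 by norm_num)
  rw [← hδ] at hlen
  obtain ⟨P, hP, hsum⟩ := exists_sum_rpow_le h0
  obtain ⟨K, hK, hl⟩ := exists_forall_le_of_list (fun k : ℕ => (k : ℝ) + 1) l
  refine ⟨max (P ^ l.length) (l.length * K * P ^ l.length), by positivity, fun m hm => ?_⟩
  have hm' : (1 : ℝ) ≤ m := by exact_mod_cast hm
  have hB : ∀ m' : ℕ, 1 ≤ m' → 0 ≤ (m : ℝ) ^ δ * (m' : ℝ) ^ (-(1 + δ)) := fun m' _ => by positivity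
  have hS : ∑ m' ∈ Finset.Ico 1 m, (m : ℝ) ^ δ * (m' : ℝ) ^ (-(1 + δ)) ≤ (m : ℝ) ^ δ * P := by
    rw [← Finset.mul_sum]
    gcongr
    exact hsum m
  have hz : ∀ k ∈ l, ∀ m', 1 ≤ m' → m' < m → 0 ≤ zetaLetter k m' ∧
      zetaLetter k m' ≤ (m : ℝ) ^ δ * (m' : ℝ) ^ (-(1 + δ)) := fun k _ m' h1 h2 =>
    ⟨zetaLetter_nonneg k m', zetaLetter_le h0.le k h1 h2.le⟩
  have hpow := natCast_pow_rpow_le hm hP hlen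
  refine ⟨(nestedSum_le hz hB hS).trans (hpow.trans ?_), fun t ht => ?_⟩
  · rw [mul_comm]
    gcongr
    exact le_max_left _ _
  · refine (abs_nestedSum_sub_le (η := K * (m * t) ^ (1 / 2 : ℝ)) (by positivity)
      (fun k hk m' h1 h2 => ⟨stuffleLetter_nonneg ht k h1,
        (stuffleLetter_le_inv_pow ht k h1).trans (hz k hk m' h1 h2).2⟩)
      hz (fun k hk m' h1 h2 => ?_) hB hS).trans ?_
    · have h3 := stuffleLetter_le_inv_pow ht k h1
      have h4 := inv_pow_sub_stuffleLetter_le ht k h1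
      have h5 := hz k hk m' h1 h2
      have h6 : (m' : ℝ) ≤ m := by exact_mod_cast h2.le
      change _ ≤ zetaLetter k m' at h3
      change zetaLetter k m' - _ ≤ _ * zetaLetter k m' at h4
      rw [abs_of_nonneg (sub_nonneg.mpr h3)]
      refine h4.trans ?_
      have h7 := hl k hk
      exact mul_le_mul (by gcongr) h5.2 h5.1 (by positivity)
    · calc _ ≤ l.length * (K * (m * t) ^ (1 / 2 : ℝ)) * ((m : ℝ) ^ (1 / 4 : ℝ) * P ^ l.length) := by
            gcongr
        _ = (l.length * K * P ^ l.length) * (m * t) ^ (1 / 2 : ℝ) * (m : ℝ) ^ (1 / 4 : ℝ) := by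
            ring
        _ ≤ _ := by
            gcongr
            exact le_max_right _ _

lemma zetaLetter_le_sq {k : ℕ} (hk : 1 ≤ k) {m : ℕ} (hm : 1 ≤ m) :
    zetaLetter k m ≤ (m : ℝ) ^ (-2 : ℝ) := by
  have hm' : (1 : ℝ) ≤ m := by exact_mod_cast hm
  rw [Real.rpow_neg (by positivity), zetaLetter]
  gcongr
  exact_mod_cast pow_le_pow_right₀ hm' (show 2 ≤ k + 1 by omega)

lemma exists_nestedSum_zeta_le {k : ℕ} (hk : 1 ≤ k) (l : List ℕ) :
    ∃ C : ℝ, ∀ M, nestedSum zetaLetter (k :: l) M ≤ C := by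
  obtain ⟨C, hC, h⟩ := exists_nestedSum_zeta l
  obtain ⟨P, hP, hsum⟩ := exists_sum_rpow_le (show (0 : ℝ) < 3 / 4 by norm_num)
  refine ⟨C * P, fun M => ?_⟩
  calc nestedSum zetaLetter (k :: l) M
      ≤ ∑ m ∈ Finset.Ico 1 M, C * (m : ℝ) ^ (-(1 + 3 / 4) : ℝ) := by
        refine Finset.sum_le_sum fun m hm => ?_
        have hm1 := (Finset.mem_Ico.mp hm).1
        have hm' : (0 : ℝ) < m := by exact_mod_cast hm1
        calc _ ≤ (m : ℝ) ^ (-2 : ℝ) * (C * (m : ℝ) ^ (1 / 4 : ℝ)) :=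
              mul_le_mul (zetaLetter_le_sq hk hm1) (h m hm1).1
                (nestedSum_nonneg fun _ _ _ _ _ => zetaLetter_nonneg _ _) (by positivity)
          _ = C * ((m : ℝ) ^ (-2 : ℝ) * (m : ℝ) ^ (1 / 4 : ℝ)) := by ring
          _ = _ := by
              rw [← Real.rpow_add hm']
              norm_num
    _ ≤ _ := by
        rw [← Finset.mul_sum]
        gcongr
        exact hsum M

/-- The leading letter supplies `m^{-2}`, the tail costs `m^{1/4}` and the exchange of letters
`m^{1/2}`. The result `m^{-5/4}` is summable, uniformly in the cutoff. -/
lemma exists_zeta_sub_stuffle_le {k : ℕ} (hk : 1 ≤ k) (l : List ℕ) :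
    ∃ C : ℝ, ∀ t : ℝ, 0 < t → ∀ M,
      |nestedSum zetaLetter (k :: l) M - nestedSum (stuffleLetter t) (k :: l) M| ≤
        C * t ^ (1 / 2 : ℝ) := by
  obtain ⟨C, hC, h⟩ := exists_nestedSum_zeta l
  obtain ⟨P, hP, hsum⟩ := exists_sum_rpow_le (show (0 : ℝ) < 1 / 4 by norm_num)
  refine ⟨(k + 2) * C * P, fun t ht M => ?_⟩
  rw [nestedSum, nestedSum, ← Finset.sum_sub_distrib]
  calc _ ≤ ∑ m ∈ Finset.Ico 1 M, |zetaLetter k m * nestedSum zetaLetter l m -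
          stuffleLetter t k m * nestedSum (stuffleLetter t) l m| := Finset.abs_sum_le_sum_abs _ _
    _ ≤ ∑ m ∈ Finset.Ico 1 M, (k + 2) * C * t ^ (1 / 2 : ℝ) * (m : ℝ) ^ (-(1 + 1 / 4) : ℝ) := by
        refine Finset.sum_le_sum fun m hm => ?_
        have hm1 := (Finset.mem_Ico.mp hm).1
        have hm' : (0 : ℝ) < m := by exact_mod_cast hm1
        have h1 := (h m hm1).1
        have h2 := (h m hm1).2 t ht
        have h3 := stuffleLetter_le_inv_pow ht k hm1
        have h4 := inv_pow_sub_stuffleLetter_le ht k hm1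
        have h5 := stuffleLetter_nonneg ht k hm1
        have h6 : 0 ≤ nestedSum zetaLetter l m :=
          nestedSum_nonneg fun _ _ _ _ _ => zetaLetter_nonneg _ _
        have h7 := zetaLetter_le_sq hk hm1
        change _ ≤ zetaLetter k m at h3
        change zetaLetter k m - _ ≤ _ * zetaLetter k m at h4
        have h8 := zetaLetter_nonneg k m
        calc _ = |(zetaLetter k m - stuffleLetter t k m) * nestedSum zetaLetter l m +
              stuffleLetter t k m * (nestedSum zetaLetter l m -
                nestedSum (stuffleLetter t) l m)| := by ring_nf
          _ ≤ (zetaLetter k m - stuffleLetter t k m) * nestedSum zetaLetter l m +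
              stuffleLetter t k m * |nestedSum zetaLetter l m -
                nestedSum (stuffleLetter t) l m| := by
              refine (abs_add_le _ _).trans ?_
              rw [abs_mul, abs_mul, abs_of_nonneg (sub_nonneg.mpr h3), abs_of_nonneg h6,
                abs_of_nonneg h5]
          _ ≤ (k + 1) * (m * t) ^ (1 / 2 : ℝ) * (m : ℝ) ^ (-2 : ℝ) * (C * (m : ℝ) ^ (1 / 4 : ℝ)) +
              (m : ℝ) ^ (-2 : ℝ) * (C * (m * t) ^ (1 / 2 : ℝ) * (m : ℝ) ^ (1 / 4 : ℝ)) := by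
              refine add_le_add (mul_le_mul (h4.trans (by gcongr)) h1 h6 (by positivity))
                (mul_le_mul (h3.trans h7) h2 (abs_nonneg _) (by positivity))
          _ = (k + 2) * C * t ^ (1 / 2 : ℝ) *
              ((m : ℝ) ^ (1 / 2 : ℝ) * (m : ℝ) ^ (-2 : ℝ) * (m : ℝ) ^ (1 / 4 : ℝ)) := by
              rw [Real.mul_rpow hm'.le ht.le]
              ring
          _ = _ := by
              rw [← Real.rpow_add hm', ← Real.rpow_add hm']
              norm_num
    _ = (k + 2) * C * t ^ (1 / 2 : ℝ) * ∑ m ∈ Finset.Ico 1 M, (m : ℝ) ^ (-(1 + 1 / 4) : ℝ) := by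
        rw [Finset.mul_sum]
    _ ≤ (k + 2) * C * t ^ (1 / 2 : ℝ) * P := by
        gcongr
        exact hsum M
    _ = _ := by ring

end Letters

/-! ### Infinite nested sums -/

/-- `∑_{m_1 > ⋯ > m_r > 0} a_{k_1}(m_1) ⋯ a_{k_r}(m_r)`, for non-negative `a`. -/
noncomputable def nestedLim {ι : Type*} (a : ι → ℕ → ℝ) (l : List ι) : ℝ :=
  ⨆ M, nestedSum a l M

lemma tendsto_nestedLim {ι : Type*} {a : ι → ℕ → ℝ} {l : List ι}
    (ha : ∀ k m, 1 ≤ m → 0 ≤ a k m) {C : ℝ} (hC : ∀ M, nestedSum a l M ≤ C) :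
    Tendsto (nestedSum a l) atTop (𝓝 (nestedLim a l)) :=
  tendsto_atTop_ciSup (nestedSum_mono fun k _ => ha k) ⟨C, by rintro _ ⟨M, rfl⟩; exact hC M⟩

lemma tendsto_stuffle {t : ℝ} (ht : 0 < t) (ht1 : t ≤ 1) (l : List ℕ) :
    Tendsto (nestedSum (stuffleLetter t) l) atTop (𝓝 (nestedLim (stuffleLetter t) l)) := by
  obtain ⟨C, -, h⟩ := exists_nestedSum_le l zero_lt_one le_rfl
  exact tendsto_nestedLim (fun k m => stuffleLetter_nonneg ht k) fun M => (h t ht ht1 M).2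

lemma tendsto_lambert {t : ℝ} (ht : 0 < t) (ht1 : t ≤ 1) (l : List ℕ) :
    Tendsto (nestedSum (lambertLetter t) l) atTop (𝓝 (nestedLim (lambertLetter t) l)) := by
  obtain ⟨C, -, h⟩ := exists_nestedSum_le l zero_lt_one le_rfl
  exact tendsto_nestedLim (fun k m _ => lambertLetter_nonneg ht k m) fun M => (h t ht ht1 M).1

/-! ### Multiple zeta values as limits of truncated nested sums -/

section Mzv

lemma ofFn_natPred (w : List ℕ+) :
    List.ofFn (fun i => (w.get i).natPred) = w.map PNat.natPred := by
  apply List.ext_getElem <;> simp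

lemma prod_zetaLetter (w : List ℕ+) (m : Fin w.length → ℕ) :
    ∏ i, ((m i : ℝ) ^ (w.get i : ℕ))⁻¹ = ∏ i, zetaLetter (w.get i).natPred (m i) :=
  Finset.prod_congr rfl fun i _ => by rw [zetaLetter, PNat.natPred_add_one]

/-- The truncated index sets exhaust all decreasing tuples, and the terms are non-negative. Bounded
truncations therefore give summability, and convergence to the unordered sum. -/
lemma tendsto_mzv {w : List ℕ+} {C : ℝ}
    (hC : ∀ M, nestedSum zetaLetter (w.map PNat.natPred) M ≤ C) :
    Tendsto (nestedSum zetaLetter (w.map PNat.natPred)) atTop (𝓝 (mzv w)) := by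
  classical
  set p : (Fin w.length → ℕ) → Prop := fun m => StrictAnti m ∧ ∀ i, 0 < m i
  set f : {m : Fin w.length → ℕ // p m} → ℝ := fun m => ∏ i, ((m.1 i : ℝ) ^ (w.get i : ℕ))⁻¹ with hf
  have hf0 : ∀ m, 0 ≤ f m := fun m => Finset.prod_nonneg fun i _ => by positivity
  let U : ℕ → Finset {m : Fin w.length → ℕ // p m} := fun M => (decTuples w.length M).subtype p
  have hU : ∀ M, ∑ m ∈ U M, f m = nestedSum zetaLetter (w.map PNat.natPred) M := by
    intro M
    rw [← ofFn_natPred, ← sum_decTuples]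
    simp only [← prod_zetaLetter]
    refine Finset.sum_subtype_of_mem
      (fun m : Fin w.length → ℕ => ∏ i, ((m i : ℝ) ^ (w.get i : ℕ))⁻¹) fun m hm => ?_
    rw [mem_decTuples] at hm
    exact ⟨hm.2, fun i => (hm.1 i).1⟩
  have hmono : Monotone U := by
    intro M M' h m hm
    simp only [U, Finset.mem_subtype, mem_decTuples] at hm ⊢
    exact ⟨fun i => ⟨(hm.1 i).1, (hm.1 i).2.trans_le h⟩, hm.2⟩
  have hex : ∀ m, ∃ M, m ∈ U M := by
    intro m
    refine ⟨(∑ i, m.1 i) + 1, ?_⟩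
    simp only [U, Finset.mem_subtype, mem_decTuples]
    refine ⟨fun i => ⟨m.2.2 i, Nat.lt_succ_of_le ?_⟩, m.2.1⟩
    exact Finset.single_le_sum (f := m.1) (fun _ _ => Nat.zero_le _) (Finset.mem_univ i)
  have htop : Tendsto U atTop atTop := tendsto_atTop_finset_of_monotone hmono hex
  have hsum : Summable f := by
    refine summable_of_sum_le hf0 (c := C) fun u => ?_
    obtain ⟨M, hM⟩ := (htop.eventually_ge_atTop u).exists
    exact (Finset.sum_le_sum_of_subset_of_nonneg hM fun m _ _ => hf0 m).trans
      ((hU M).le.trans (hC M))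
  have := hsum.hasSum.comp htop
  exact this.congr fun M => hU M

end Mzv

/-! ### The stuffle product with `z_1` for the values at `t` -/

section Stuffle

/-- The value of a word in the letters `(t / (e^{mt} - 1))^k`. -/
noncomputable def stuffleValue (t : ℝ) (w : List ℕ+) : ℝ :=
  nestedLim (stuffleLetter t) (w.map PNat.natPred)

/-- The reason for introducing `stuffleLetter`: its letters multiply by adding weights, so the
truncated sums already satisfy the product rule exactly. -/
lemma nestedSum_one_mul (t : ℝ) (v : List ℕ+) (M : ℕ) :
    nestedSum (stuffleLetter t) [0] M * nestedSum (stuffleLetter t) (v.map PNat.natPred) M =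
      ((stuffle [1] v).map fun u => nestedSum (stuffleLetter t) (u.map PNat.natPred) M).sum := by
  have h1 : PNat.natPred 1 = 0 := rfl
  induction v generalizing M with
  | nil => simp [stuffle, quasiShuffle, nestedSum, h1]
  | cons b v ih =>
    have hb : (1 + b).natPred = b.natPred + 1 := by
      have e1 := PNat.natPred_add_one b
      have e2 := PNat.natPred_add_one (1 + b)
      rw [PNat.add_coe, PNat.one_coe] at e2
      omega
    have hmul : ∀ m, stuffleLetter t (b.natPred + 1) m =
        stuffleLetter t 0 m * stuffleLetter t b.natPred m := fun m => by
      simp only [stuffleLetter]; ring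
    have hl : ∀ M, ((stuffle [1] v).map fun u =>
        nestedSum (stuffleLetter t) (b.natPred :: u.map PNat.natPred) M).sum =
        ∑ m ∈ Finset.Ico 1 M, stuffleLetter t b.natPred m *
          (nestedSum (stuffleLetter t) [0] m *
            nestedSum (stuffleLetter t) (v.map PNat.natPred) m) := by
      intro M
      simp only [ih]
      simp only [nestedSum]
      induction stuffle [1] v with
      | nil => simp
      | cons u L ihL =>
        simp only [List.map_cons, List.sum_cons, mul_add, Finset.sum_add_distrib]
        rw [ihL]
    rw [stuffle_one_cons]
    simp only [List.map_cons, List.map_append, List.map_map, List.sum_cons, List.sum_append,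
      Function.comp_def, List.map_nil, List.sum_nil, h1, hb, hl, add_zero]
    simp only [nestedSum, hmul, mul_one]
    -- What remains is the splitting of a product of two sums into the parts above, below and on the
    -- diagonal. Raising the cutoff adds only the terms whose largest index is the new one.
    induction M with
    | zero => simp
    | succ M ihM =>
      rcases Nat.eq_zero_or_pos M with rfl | hM
      · simp
      · simp only [Finset.sum_Ico_succ_top hM, add_mul, mul_add]
        linear_combination ihM

lemma stuffleValue_one_mul {t : ℝ} (ht : 0 < t) (ht1 : t ≤ 1) (v : List ℕ+) :
    stuffleValue t [1] * stuffleValue t v = ((stuffle [1] v).map (stuffleValue t)).sum := by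
  have h1 := (tendsto_stuffle ht ht1 [0]).mul (tendsto_stuffle ht ht1 (v.map PNat.natPred))
  refine tendsto_nhds_unique h1 ?_
  simp only [nestedSum_one_mul]
  induction stuffle [1] v with
  | nil => simp
  | cons u L ih =>
    simp only [List.map_cons, List.sum_cons]
    exact (tendsto_stuffle ht ht1 _).add ih

end Stuffle

/-! ### Asymptotic expansions -/

/-- Functions that are `O(t^δ)` for some `δ > 0`. -/
def IsSmall (f : ℝ → ℝ) : Prop :=
  ∃ δ : ℝ, δ > 0 ∧ ∃ C : ℝ, ∀ t : ℝ, 0 < t → t ≤ 1 → |f t| ≤ C * t ^ δ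

namespace IsSmall

variable {f g : ℝ → ℝ}

lemma congr (hf : IsSmall f) (h : ∀ t, 0 < t → t ≤ 1 → g t = f t) : IsSmall g := by
  obtain ⟨δ, hδ, C, hC⟩ := hf
  exact ⟨δ, hδ, C, fun t h0 h1 => by rw [h t h0 h1]; exact hC t h0 h1⟩

lemma add (hf : IsSmall f) (hg : IsSmall g) : IsSmall fun t => f t + g t := by
  obtain ⟨δ, hδ, C, hC⟩ := hf
  obtain ⟨δ', hδ', C', hC'⟩ := hg
  refine ⟨min δ δ', lt_min hδ hδ', |C| + |C'|, fun t h0 h1 => (abs_add_le _ _).trans ?_⟩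
  have e1 : t ^ δ ≤ t ^ min δ δ' :=
    Real.rpow_le_rpow_of_exponent_ge h0 h1 (min_le_left _ _)
  have e2 : t ^ δ' ≤ t ^ min δ δ' :=
    Real.rpow_le_rpow_of_exponent_ge h0 h1 (min_le_right _ _)
  rw [add_mul]
  refine add_le_add ((hC t h0 h1).trans ?_) ((hC' t h0 h1).trans ?_)
  · exact mul_le_mul (le_abs_self C) e1 (by positivity) (abs_nonneg _)
  · exact mul_le_mul (le_abs_self C') e2 (by positivity) (abs_nonneg _)

lemma const_mul (hf : IsSmall f) (c : ℝ) : IsSmall fun t => c * f t := by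
  obtain ⟨δ, hδ, C, hC⟩ := hf
  refine ⟨δ, hδ, |c| * C, fun t h0 h1 => ?_⟩
  rw [abs_mul, mul_assoc]
  exact mul_le_mul_of_nonneg_left (hC t h0 h1) (abs_nonneg c)

lemma zero : IsSmall fun _ => 0 :=
  ⟨1, one_pos, 0, fun t _ _ => by simp⟩

lemma tendsto (hf : IsSmall f) : Tendsto f (𝓝[>] 0) (𝓝 0) := by
  obtain ⟨δ, hδ, C, hC⟩ := hf
  have h1 : Tendsto (fun t : ℝ => C * t ^ δ) (𝓝[>] 0) (𝓝 0) := by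
    have : Tendsto (fun t : ℝ => C * t ^ δ) (𝓝 0) (𝓝 (C * 0 ^ δ)) :=
      ((Real.continuous_rpow_const hδ.le).tendsto 0).const_mul C
    rw [Real.zero_rpow hδ.ne', mul_zero] at this
    exact this.mono_left nhdsWithin_le_nhds
  refine squeeze_zero_norm' ?_ h1
  filter_upwards [Ioc_mem_nhdsGT (show (0 : ℝ) < 1 by norm_num)] with t ht
  exact hC t ht.1 ht.2

/-- The value at `z_1` is `O(t^{-ε})` for every `ε` in `(0, 1]`, so `ε = min δ 1 / 2` leaves a
positive exponent. -/
lemma mul_stuffleValue (hf : IsSmall f) : IsSmall fun t => stuffleValue t [1] * f t := by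
  obtain ⟨δ, hδ, C, hC⟩ := hf
  have hε : 0 < min δ 1 / 2 := by positivity
  have hε1 : min δ 1 / 2 ≤ 1 := by
    have := min_le_right δ 1
    linarith
  obtain ⟨C', hC', h⟩ := exists_nestedSum_le [0] hε hε1
  refine ⟨δ - min δ 1 / 2, ?_, C' * C, fun t h0 h1 => ?_⟩
  · have := min_le_left δ 1
    linarith
  have e1 : stuffleValue t [1] ≤ C' * t ^ (-(min δ 1 / 2)) :=
    le_of_tendsto' (tendsto_stuffle h0 h1 [0]) fun M => (h t h0 h1 M).2
  have e0 : 0 ≤ stuffleValue t [1] := ge_of_tendsto' (tendsto_stuffle h0 h1 [0]) fun M =>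
    nestedSum_nonneg fun k _ m hm _ => stuffleLetter_nonneg h0 k hm
  rw [abs_mul, abs_of_nonneg e0]
  calc _ ≤ (C' * t ^ (-(min δ 1 / 2))) * (C * t ^ δ) :=
        mul_le_mul e1 (hC t h0 h1) (abs_nonneg _) (by positivity)
    _ = C' * C * (t ^ (-(min δ 1 / 2)) * t ^ δ) := by ring
    _ = _ := by
        rw [← Real.rpow_add h0]
        ring_nf

end IsSmall

/-- `f` is, up to a small error, a polynomial in `stuffleValue t [1]` with constant term `z`. -/
def HasExpansion (f : ℝ → ℝ) (z : ℝ) : Prop :=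
  ∃ P : Polynomial ℝ, P.coeff 0 = z ∧ IsSmall fun t => f t - P.eval (stuffleValue t [1])

namespace HasExpansion

variable {f g : ℝ → ℝ} {z z' : ℝ}

lemma of_sub (hf : HasExpansion f z) (h : IsSmall fun t => g t - f t) : HasExpansion g z := by
  obtain ⟨P, h0, hP⟩ := hf
  exact ⟨P, h0, (hP.add h).congr fun t _ _ => by ring⟩

lemma of_const (h : IsSmall fun t => f t - z) : HasExpansion f z :=
  ⟨Polynomial.C z, by simp, by simpa using h⟩

lemma add (hf : HasExpansion f z) (hg : HasExpansion g z') :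
    HasExpansion (fun t => f t + g t) (z + z') := by
  obtain ⟨P, h0, hP⟩ := hf
  obtain ⟨Q, h0', hQ⟩ := hg
  refine ⟨P + Q, by simp [h0, h0'], (hP.add hQ).congr fun t _ _ => ?_⟩
  rw [Polynomial.eval_add]
  ring

lemma const_mul (hf : HasExpansion f z) (c : ℝ) : HasExpansion (fun t => c * f t) (c * z) := by
  obtain ⟨P, h0, hP⟩ := hf
  refine ⟨Polynomial.C c * P, by simp [h0], (hP.const_mul c).congr fun t _ _ => ?_⟩
  rw [Polynomial.eval_mul, Polynomial.eval_C]
  ring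

/-- Multiplying the polynomial by its variable removes the constant term. This is the counterpart of
`ζ*(1) = 0`. -/
lemma stuffleValue_mul (hf : HasExpansion f z) :
    HasExpansion (fun t => stuffleValue t [1] * f t) 0 := by
  obtain ⟨P, h0, hP⟩ := hf
  refine ⟨Polynomial.X * P, by simp, hP.mul_stuffleValue.congr fun t _ _ => ?_⟩
  rw [Polynomial.eval_mul, Polynomial.eval_X]
  ring

lemma zero : HasExpansion (fun _ => 0) 0 := of_const (by simpa using IsSmall.zero)

lemma list_sum {α : Type*} {F : ℝ → α → ℝ} {ζ : α → ℝ} (L : List α)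
    (h : ∀ u ∈ L, HasExpansion (fun t => F t u) (ζ u)) :
    HasExpansion (fun t => (L.map (F t)).sum) (L.map ζ).sum := by
  induction L with
  | nil => simpa using zero
  | cons u L ih =>
    simp only [List.map_cons, List.sum_cons]
    exact (h u (by simp)).add (ih fun u' hu' => h u' (by simp [hu']))

lemma finset_sum {α : Type*} {F : ℝ → α → ℝ} {ζ : α → ℝ} (s : Finset α)
    (h : ∀ u ∈ s, HasExpansion (fun t => F t u) (ζ u)) :
    HasExpansion (fun t => ∑ u ∈ s, F t u) (∑ u ∈ s, ζ u) := by
  classical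
  induction s using Finset.induction_on with
  | empty => simpa using zero
  | insert u s hu ih =>
    simp only [Finset.sum_insert hu]
    exact (h u (by simp)).add (ih fun u' hu' => h u' (by simp [hu']))

end HasExpansion

lemma one_le_natPred {k : ℕ+} (hk : k ≠ 1) : 1 ≤ k.natPred := by
  have h1 := PNat.natPred_add_one k
  have h2 : (k : ℕ) ≠ 1 := fun h => hk (PNat.coe_eq_one_iff.mp h)
  omega

lemma isSmall_stuffleValue_sub_mzv {w : List ℕ+} (hw : leadingOnes w = 0) :
    IsSmall fun t => stuffleValue t w - mzv w := by
  obtain ⟨C', hC'⟩ : ∃ C, ∀ M, nestedSum zetaLetter (w.map PNat.natPred) M ≤ C := by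
    cases w with
    | nil => exact ⟨1, fun M => le_rfl⟩
    | cons k v =>
      have hk : k ≠ 1 := by
        rintro rfl
        rw [leadingOnes_cons_one] at hw
        omega
      exact exists_nestedSum_zeta_le (one_le_natPred hk) _
  have hmzv := tendsto_mzv hC'
  obtain ⟨C, hC⟩ : ∃ C : ℝ, ∀ t : ℝ, 0 < t → ∀ M,
      |nestedSum zetaLetter (w.map PNat.natPred) M -
        nestedSum (stuffleLetter t) (w.map PNat.natPred) M| ≤ C * t ^ (1 / 2 : ℝ) := by
    cases w with
    | nil => exact ⟨0, fun t _ M => by simp [nestedSum]⟩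
    | cons k v =>
      have hk : k ≠ 1 := by
        rintro rfl
        rw [leadingOnes_cons_one] at hw
        omega
      exact exists_zeta_sub_stuffle_le (one_le_natPred hk) _
  refine ⟨1 / 2, by norm_num, C, fun t h0 h1 => ?_⟩
  rw [abs_sub_comm]
  exact le_of_tendsto' (hmzv.sub (tendsto_stuffle h0 h1 _)).abs fun M => hC t h0 M

lemma zetaStar_one_cons (v : List ℕ+) : zetaStar (1 :: v) = -(1 / (leadingOnes v + 1 : ℕ)) *
    (((stuffle [1] v).filter fun u => decide (leadingOnes u < leadingOnes v + 1)).map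
      zetaStar).sum := by
  have hl := leadingOnes_cons_one v
  rw [zetaStar, if_neg (by omega), List.attach_map_val (f := zetaStar), hl, List.tail_cons]

/-- Induction on the number of leading letters `z_1`. Solving the product `z_1 * v` for `z_1 v` is
the recursion of `zetaStar`, and constant terms of the expansions follow the same recursion. -/
lemma hasExpansion_stuffleValue (w : List ℕ+) :
    HasExpansion (fun t => stuffleValue t w) (zetaStar w) := by
  induction hn : leadingOnes w using Nat.strong_induction_on generalizing w with
  | _ n ih =>
    subst hn
    by_cases h : leadingOnes w = 0
    · rw [zetaStar, if_pos h]
      exact HasExpansion.of_const (isSmall_stuffleValue_sub_mzv h)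
    · obtain ⟨v, rfl⟩ : ∃ v, w = 1 :: v := by
        cases w with
        | nil => exact absurd rfl h
        | cons b v =>
          by_cases hb : b = 1
          · exact ⟨v, by rw [hb]⟩
          · exact absurd (leadingOnes_cons_ne hb v) h
      have hl := leadingOnes_cons_one v
      have h1 := (ih (leadingOnes v) (by omega) v rfl).stuffleValue_mul
      have h2 : HasExpansion (fun t => (((stuffle [1] v).filter
          fun u => decide (leadingOnes u < leadingOnes v + 1)).map (stuffleValue t)).sum)
          (((stuffle [1] v).filter
          fun u => decide (leadingOnes u < leadingOnes v + 1)).map zetaStar).sum := by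
        refine HasExpansion.list_sum _ fun u hu => ?_
        have := (List.mem_filter.mp hu).2
        exact ih _ (by rw [hl]; simpa using this) u rfl
      have h3 := (h1.add (h2.const_mul (-1))).const_mul (1 / (leadingOnes v + 1 : ℕ))
      have hz : 1 / ((leadingOnes v + 1 : ℕ) : ℝ) * (0 + -1 * (((stuffle [1] v).filter
          fun u => decide (leadingOnes u < leadingOnes v + 1)).map zetaStar).sum) =
          zetaStar (1 :: v) := by
        rw [zetaStar_one_cons]
        ring
      rw [hz] at h3
      refine h3.of_sub (IsSmall.zero.congr fun t h0 h1 => ?_)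
      have key := stuffleValue_one_mul h0 h1 v
      rw [sum_stuffle_one] at key
      have hne : ((leadingOnes v + 1 : ℕ) : ℝ) ≠ 0 := by positivity
      rw [key]
      field_simp
      ring

lemma tendsto_stuffleValue_one :
    Tendsto (fun t => stuffleValue t [1]) (𝓝[>] 0) atTop := by
  rw [tendsto_atTop]
  intro K
  obtain ⟨n, hn⟩ := (Real.tendsto_sum_range_one_div_nat_succ_atTop.eventually_ge_atTop
    (2 * K)).exists
  -- For `t` up to this bound and `m ≤ n`, the relative error `(mt)^{1/2}` of a letter is at most
  -- `1/2`. So the value at `z_1` is at least half of a harmonic sum, which was chosen to be at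
  -- least `2K`.
  have hpos : (0 : ℝ) < 1 / (4 * (n + 1)) := by positivity
  have hle1 : 1 / (4 * ((n : ℝ) + 1)) ≤ 1 := by
    rw [div_le_one (by positivity)]
    have : (0 : ℝ) ≤ n := by positivity
    linarith
  filter_upwards [Ioc_mem_nhdsGT hpos] with t ht
  have hmono := nestedSum_mono (a := stuffleLetter t) (l := [0])
    fun k _ m => stuffleLetter_nonneg ht.1 k
  refine le_trans ?_ (hmono.ge_of_tendsto (tendsto_stuffle ht.1 (ht.2.trans hle1) [0]) (n + 1))
  rw [nestedSum, Finset.sum_Ico_eq_sum_range, Nat.add_sub_cancel]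
  have h2 : ∀ i ∈ Finset.range n, 1 / 2 * (1 / ((i : ℝ) + 1)) ≤
      stuffleLetter t 0 (1 + i) * nestedSum (stuffleLetter t) [] (1 + i) := by
    intro i hi
    have hin : (i : ℝ) + 1 ≤ n + 1 := by
      have : (i : ℝ) ≤ n := by exact_mod_cast (Finset.mem_range.mp hi).le
      linarith
    have h3 := inv_pow_sub_stuffleLetter_le ht.1 0 (Nat.le_add_right 1 i)
    have h4 : (((1 + i : ℕ) : ℝ) * t) ^ (1 / 2 : ℝ) ≤ 1 / 2 := by
      have h5 : ((1 + i : ℕ) : ℝ) * t ≤ (1 / 2) ^ 2 := by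
        have h6 := ht.2
        rw [le_div_iff₀ (by positivity)] at h6
        push_cast
        nlinarith [ht.1]
      have h0 := ht.1
      calc _ ≤ (((1 : ℝ) / 2) ^ 2) ^ (1 / 2 : ℝ) :=
            Real.rpow_le_rpow (by positivity) h5 (by norm_num)
        _ = 1 / 2 := by
            rw [← Real.sqrt_eq_rpow, Real.sqrt_sq (by norm_num)]
    have h5 : (0 : ℝ) < (((1 + i : ℕ) : ℝ))⁻¹ := by positivity
    simp only [nestedSum, mul_one, Nat.cast_zero, zero_add, one_mul, pow_one] at h3 ⊢
    have h6 : 1 / ((i : ℝ) + 1) = ((1 + i : ℕ) : ℝ)⁻¹ := by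
      push_cast
      rw [one_div, add_comm]
    rw [h6]
    nlinarith
  refine le_trans ?_ (Finset.sum_le_sum h2)
  rw [← Finset.mul_sum]
  linarith

/-! ### Evaluation of `q`-series at `q = e^{-t}` -/

/-- The `q`-series `f` converges at `q = e^{-t}`, with sum `v`. -/
def EvalsTo (f : PowerSeries ℚ) (t v : ℝ) : Prop :=
  HasSum (fun n : ℕ => ((PowerSeries.coeff n f : ℚ) : ℝ) * Real.exp (-t) ^ n) v

namespace EvalsTo

variable {f g : PowerSeries ℚ} {t v w : ℝ}

lemma add (hf : EvalsTo f t v) (hg : EvalsTo g t w) : EvalsTo (f + g) t (v + w) := by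
  have := HasSum.add hf hg
  refine this.congr_fun fun n => ?_
  rw [map_add]
  push_cast
  ring

lemma smul (hf : EvalsTo f t v) (c : ℚ) : EvalsTo (c • f) t (c * v) := by
  have := HasSum.mul_left (c : ℝ) hf
  refine this.congr_fun fun n => ?_
  rw [map_smul, smul_eq_mul]
  push_cast
  ring

lemma zero : EvalsTo 0 t 0 := by
  simp [EvalsTo, hasSum_zero]

lemma finset_sum {ι : Type*} (s : Finset ι) {f : ι → PowerSeries ℚ} {v : ι → ℝ}
    (h : ∀ i ∈ s, EvalsTo (f i) t (v i)) : EvalsTo (∑ i ∈ s, f i) t (∑ i ∈ s, v i) := by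
  classical
  induction s using Finset.induction_on with
  | empty => simpa using zero
  | insert i s hi ih =>
    rw [Finset.sum_insert hi, Finset.sum_insert hi]
    exact (h i (by simp)).add (ih fun j hj => h j (by simp [hj]))

lemma C (c : ℚ) : EvalsTo (PowerSeries.C c) t c := by
  have := hasSum_single (f := fun n : ℕ =>
    ((PowerSeries.coeff n (PowerSeries.C c) : ℚ) : ℝ) * Real.exp (-t) ^ n) 0 fun n hn => by
      simp [PowerSeries.coeff_C, hn]
  simpa [EvalsTo] using this

/-- Non-negative coefficients make the convergence absolute, so the Cauchy product applies. -/
lemma mul (hf : EvalsTo f t v) (hg : EvalsTo g t w) (hf0 : ∀ n, 0 ≤ PowerSeries.coeff n f)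
    (hg0 : ∀ n, 0 ≤ PowerSeries.coeff n g) : EvalsTo (f * g) t (v * w) := by
  have norm_eq : ∀ f : PowerSeries ℚ, (∀ n, 0 ≤ PowerSeries.coeff n f) →
      (fun n : ℕ => ‖((PowerSeries.coeff n f : ℚ) : ℝ) * Real.exp (-t) ^ n‖) =
        fun n : ℕ => ((PowerSeries.coeff n f : ℚ) : ℝ) * Real.exp (-t) ^ n := by
    intro f hf
    ext n
    rw [Real.norm_of_nonneg]
    exact mul_nonneg (by exact_mod_cast hf n) (by positivity)
  have h1 : Summable fun n : ℕ => ‖((PowerSeries.coeff n f : ℚ) : ℝ) * Real.exp (-t) ^ n‖ := by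
    rw [norm_eq f hf0]; exact hf.summable
  have h2 : Summable fun n : ℕ => ‖((PowerSeries.coeff n g : ℚ) : ℝ) * Real.exp (-t) ^ n‖ := by
    rw [norm_eq g hg0]; exact hg.summable
  have h3 := (summable_norm_sum_mul_antidiagonal_of_summable_norm h1 h2).of_norm.hasSum
  rw [← tsum_mul_tsum_eq_tsum_sum_antidiagonal_of_summable_norm h1 h2, hf.tsum_eq, hg.tsum_eq] at h3
  refine h3.congr_fun fun n => ?_
  rw [PowerSeries.coeff_mul, Rat.cast_sum, Finset.sum_mul]
  refine Finset.sum_congr rfl fun p hp => ?_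
  rw [← Finset.HasAntidiagonal.mem_antidiagonal.mp hp, pow_add]
  push_cast
  ring

end EvalsTo

lemma evalsTo_divisorSeries (k : ℕ) {m : ℕ} (hm : 1 ≤ m) {t : ℝ} (ht : 0 < t) :
    EvalsTo (divisorSeries k m) t (expLambert k (m * t)) := by
  have h := (summable_expLambert k (letter_arg_pos ht hm)).hasSum
  have hinj : Function.Injective fun n : ℕ => m * (n + 1) := fun a b hab => by
    have := Nat.eq_of_mul_eq_mul_left (by omega) hab
    omega
  refine (hinj.hasSum_iff fun N hN => ?_).mp (h.congr_fun fun n => ?_)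
  · simp only [divisorSeries, PowerSeries.coeff_mk]
    rw [if_neg, Rat.cast_zero, zero_mul]
    rintro ⟨⟨n, rfl⟩, h0⟩
    refine hN ⟨n - 1, ?_⟩
    have : n ≠ 0 := by
      rintro rfl
      exact h0 rfl
    simp only
    rw [Nat.sub_add_cancel (by omega)]
  · have hm' : 0 < m := by omega
    have h0 : m ∣ m * (n + 1) ∧ m * (n + 1) ≠ 0 := ⟨dvd_mul_right _ _, by positivity⟩
    simp only [Function.comp_apply, divisorSeries, PowerSeries.coeff_mk, if_pos h0,
      Nat.mul_div_cancel_left _ hm']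
    have hexp : Real.exp (-(m * t)) = Real.exp (-t) ^ m := by
      rw [← Real.exp_nat_mul, mul_neg]
    rw [hexp, pow_mul]
    push_cast
    rfl

lemma coeff_nestedSum_nonneg (l : List ℕ) (M n : ℕ) :
    0 ≤ PowerSeries.coeff n (nestedSum divisorSeries l M) := by
  induction l generalizing M n with
  | nil =>
    rw [nestedSum, PowerSeries.coeff_one]
    split_ifs <;> norm_num
  | cons k l ih =>
    rw [nestedSum, map_sum]
    refine Finset.sum_nonneg fun m _ => ?_
    rw [PowerSeries.coeff_mul]
    exact Finset.sum_nonneg fun p _ => mul_nonneg (coeff_divisorSeries_nonneg _ _ _) (ih _ _)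

lemma coeff_nestedSum_mono (l : List ℕ) (n : ℕ) :
    Monotone fun M => PowerSeries.coeff n (nestedSum divisorSeries l M) := by
  cases l with
  | nil => exact fun _ _ _ => le_rfl
  | cons k l =>
    intro M M' h
    simp only [nestedSum, map_sum]
    refine Finset.sum_le_sum_of_subset_of_nonneg (Finset.Ico_subset_Ico_right h) fun m _ _ => ?_
    rw [PowerSeries.coeff_mul]
    exact Finset.sum_nonneg fun p _ =>
      mul_nonneg (coeff_divisorSeries_nonneg _ _ _) (coeff_nestedSum_nonneg _ _ _)

lemma coeff_nestedSum_of_lt (l : List ℕ) {n M : ℕ} (h : n < M) :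
    PowerSeries.coeff n (nestedSum divisorSeries l M) = PowerSeries.coeff n (bracket l) := by
  rw [bracket, PowerSeries.coeff_mk]
  cases l with
  | nil => rfl
  | cons k l =>
    simp only [nestedSum, map_sum]
    refine (Finset.sum_subset (Finset.Ico_subset_Ico_right h) fun m _ hm => ?_).symm
    have hm' : n < m := by
      simp only [Finset.mem_Ico] at *
      omega
    exact PowerSeries.X_pow_dvd_iff.mp (dvd_mul_of_dvd_left
      (PowerSeries.X_pow_dvd_iff.mpr fun N hN => coeff_divisorSeries_eq_zero hN) _) n hm'

lemma coeff_nestedSum_le (l : List ℕ) (n M : ℕ) :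
    PowerSeries.coeff n (nestedSum divisorSeries l M) ≤ PowerSeries.coeff n (bracket l) := by
  rw [← coeff_nestedSum_of_lt l (show n < max M (n + 1) by simp)]
  exact coeff_nestedSum_mono l n (le_max_left _ _)

lemma evalsTo_nestedSum {t : ℝ} (ht : 0 < t) (l : List ℕ) (M : ℕ) :
    EvalsTo (nestedSum divisorSeries l M) t
      (nestedSum (fun k m => expLambert k (m * t)) l M) := by
  induction l generalizing M with
  | nil => simpa [nestedSum] using EvalsTo.C (t := t) 1
  | cons k l ih =>
    refine EvalsTo.finset_sum _ fun m hm => ?_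
    exact (evalsTo_divisorSeries k (Finset.mem_Ico.mp hm).1 ht).mul (ih m)
      (coeff_divisorSeries_nonneg _ _) (coeff_nestedSum_nonneg _ _)

lemma nestedSum_lambertLetter (t : ℝ) (l : List ℕ) (M : ℕ) :
    nestedSum (lambertLetter t) l M =
      t ^ (l.sum + l.length) * nestedSum (fun k m => expLambert k (m * t)) l M := by
  induction l generalizing M with
  | nil => simp [nestedSum]
  | cons k l ih =>
    simp only [nestedSum, ih, Finset.mul_sum, lambertLetter, List.sum_cons, List.length_cons]
    exact Finset.sum_congr rfl fun m _ => by ring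

/-- Interchange of the sum over `q`-coefficients with the limit in the cutoff. All terms are
non-negative, each coefficient increases with the cutoff and becomes stationary, so both
inequalities follow from comparison of sums. -/
lemma evalsTo_bracket {t : ℝ} (ht : 0 < t) (ht1 : t ≤ 1) (l : List ℕ) :
    EvalsTo (bracket l) t ((t ^ (l.sum + l.length))⁻¹ * nestedLim (lambertLetter t) l) := by
  have hpow : t ^ (l.sum + l.length) ≠ 0 := by positivity
  have hlim : Tendsto (nestedSum (fun k m => expLambert k (m * t)) l) atTop
      (𝓝 ((t ^ (l.sum + l.length))⁻¹ * nestedLim (lambertLetter t) l)) := by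
    refine ((tendsto_lambert ht ht1 l).const_mul _).congr fun M => ?_
    rw [nestedSum_lambertLetter, inv_mul_cancel_left₀ hpow]
  set V := (t ^ (l.sum + l.length))⁻¹ * nestedLim (lambertLetter t) l
  have hmono : Monotone (nestedSum (fun k m => expLambert k (m * t)) l) :=
    nestedSum_mono fun k _ m _ => expLambert_nonneg _ _
  have h0 : ∀ M n, 0 ≤ ((PowerSeries.coeff n (nestedSum divisorSeries l M) : ℚ) : ℝ) *
      Real.exp (-t) ^ n := fun M n =>
    mul_nonneg (by exact_mod_cast coeff_nestedSum_nonneg l M n) (by positivity)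
  have hle : ∀ M n, ((PowerSeries.coeff n (nestedSum divisorSeries l M) : ℚ) : ℝ) *
      Real.exp (-t) ^ n ≤ ((PowerSeries.coeff n (bracket l) : ℚ) : ℝ) * Real.exp (-t) ^ n :=
    fun M n => by
      gcongr
      exact coeff_nestedSum_le l n M
  have hpartial : ∀ N, ∑ n ∈ Finset.range N,
      ((PowerSeries.coeff n (bracket l) : ℚ) : ℝ) * Real.exp (-t) ^ n ≤ V := by
    intro N
    calc _ = ∑ n ∈ Finset.range N, ((PowerSeries.coeff n (nestedSum divisorSeries l N) : ℚ) : ℝ) *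
          Real.exp (-t) ^ n := Finset.sum_congr rfl fun n hn => by
            rw [coeff_nestedSum_of_lt l (Finset.mem_range.mp hn)]
      _ ≤ _ := sum_le_hasSum _ (fun n _ => h0 N n) (evalsTo_nestedSum ht l N)
      _ ≤ V := hmono.ge_of_tendsto hlim N
  have hnn : ∀ n, 0 ≤ ((PowerSeries.coeff n (bracket l) : ℚ) : ℝ) * Real.exp (-t) ^ n :=
    fun n => (h0 0 n).trans (hle 0 n)
  have hs := summable_of_sum_range_le hnn hpartial
  have heq : ∑' n : ℕ, ((PowerSeries.coeff n (bracket l) : ℚ) : ℝ) * Real.exp (-t) ^ n = V := by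
    refine le_antisymm (Real.tsum_le_of_sum_range_le hnn hpartial) ?_
    exact le_of_tendsto' hlim fun M =>
      hasSum_le (hle M) (evalsTo_nestedSum ht l M) hs.hasSum
  rw [EvalsTo, ← heq]
  exact hs.hasSum

lemma isSmall_pow_mul_nestedLim (l : List ℕ) {n : ℕ} (hn : 1 ≤ n) :
    IsSmall fun t => t ^ n * nestedLim (lambertLetter t) l := by
  obtain ⟨C, hC, h⟩ := exists_nestedSum_le l (show (0 : ℝ) < 1 / 2 by norm_num) (by norm_num)
  refine ⟨1 / 2, by norm_num, C, fun t h0 h1 => ?_⟩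
  have e1 : nestedLim (lambertLetter t) l ≤ C * t ^ (-(1 / 2) : ℝ) :=
    le_of_tendsto' (tendsto_lambert h0 h1 l) fun M => (h t h0 h1 M).1
  have e0 : 0 ≤ nestedLim (lambertLetter t) l := ge_of_tendsto' (tendsto_lambert h0 h1 l) fun M =>
    nestedSum_nonneg fun k _ m hm _ => lambertLetter_nonneg h0 k m
  rw [abs_of_nonneg (by positivity)]
  calc _ ≤ t ^ 1 * (C * t ^ (-(1 / 2) : ℝ)) :=
        mul_le_mul (pow_le_pow_of_le_one h0.le h1 hn) e1 e0 (by positivity)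
    _ = C * (t ^ (1 : ℝ) * t ^ (-(1 / 2) : ℝ)) := by rw [Real.rpow_one]; ring
    _ = _ := by
        rw [← Real.rpow_add h0]
        norm_num

/-- A bracket of weight less than `k` leaves at least one factor `t` after normalization by `t^k`,
which outweighs the growth `t^{-1/2}` of the nested sum. -/
lemma exists_evalsTo_of_mem_bracketSpan {N k : ℕ} (hN : N < k) {g : PowerSeries ℚ}
    (hg : g ∈ bracketSpan N) : ∃ v : ℝ → ℝ, (∀ t, 0 < t → t ≤ 1 → EvalsTo g t (v t)) ∧
      IsSmall fun t => t ^ k * v t := by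
  induction hg using Submodule.span_induction with
  | mem g hg =>
    obtain ⟨l, -, hl, rfl⟩ := hg
    refine ⟨_, fun t h0 h1 => evalsTo_bracket h0 h1 l,
      (isSmall_pow_mul_nestedLim l (n := k - (l.sum + l.length)) (by omega)).congr
        fun t h0 _ => ?_⟩
    rw [← mul_assoc]
    congr 1
    rw [← div_eq_mul_inv, div_eq_iff (by positivity), ← pow_add]
    congr 1
    omega
  | zero => exact ⟨0, fun t _ _ => EvalsTo.zero, by simpa using IsSmall.zero⟩
  | add f g _ _ hf hg =>
    obtain ⟨v, hv, hv'⟩ := hf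
    obtain ⟨w, hw, hw'⟩ := hg
    exact ⟨fun t => v t + w t, fun t h0 h1 => (hv t h0 h1).add (hw t h0 h1),
      (hv'.add hw').congr fun t _ _ => by ring⟩
  | smul c f _ hf =>
    obtain ⟨v, hv, hv'⟩ := hf
    exact ⟨fun t => c * v t, fun t h0 h1 => (hv t h0 h1).smul c,
      (hv'.const_mul c).congr fun t _ _ => by ring⟩

/-- The behaviour of `t^k G(k_1, …, k_r)` for `q = e^{-t}` and `t → 0`, in weight `k`. -/
lemma exists_evalsTo_G {b : Mould ℚ} (hb : b.SatisfiesEDS) (h1 : b.coeff [1] = 0) {w : List ℕ+}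
    (hw : w ≠ []) : ∃ v : ℝ → ℝ, (∀ t, 0 < t → t ≤ 1 → EvalsTo (G b w) t (v t)) ∧
      HasExpansion (fun t => t ^ weight w * v t) (zetaStar w) := by
  have hwt : 1 ≤ weight w := by
    rw [weight_eq]
    have := List.length_pos_iff.mpr hw
    omega
  obtain ⟨v, hv, hv'⟩ := exists_evalsTo_of_mem_bracketSpan (show weight w - 1 < weight w by omega)
    (G_sub_mem hb h1 hw)
  set l := w.map PNat.natPred with hl
  have hwl : l.sum + l.length = weight w := by rw [weight_eq, hl, List.length_map]
  refine ⟨fun t => v t + (b.coeff w + (t ^ weight w)⁻¹ * nestedLim (lambertLetter t) l),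
    fun t h0 h1 => ?_, (hasExpansion_stuffleValue w).of_sub ?_⟩
  · have := (hv t h0 h1).add ((EvalsTo.C (t := t) (b.coeff w)).add (evalsTo_bracket h0 h1 l))
    rw [hwl] at this
    convert this using 1
    ring
  · obtain ⟨C, hC⟩ := exists_lambert_sub_stuffle_le l
    have hsmall : IsSmall fun t => nestedLim (lambertLetter t) l - stuffleValue t w :=
      ⟨1 / 2, by norm_num, C, fun t h0 h1 => le_of_tendsto'
        ((tendsto_lambert h0 h1 l).sub (tendsto_stuffle h0 h1 l)).abs fun M => hC t h0 h1 M⟩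
    have hconst : IsSmall fun t => (b.coeff w : ℝ) * t ^ weight w :=
      IsSmall.const_mul ⟨1, one_pos, 1, fun t h0 h1 => by
        rw [abs_of_nonneg (by positivity), one_mul, Real.rpow_one]
        simpa using pow_le_pow_of_le_one h0.le h1 hwt⟩ _
    refine ((hv'.add hconst).add hsmall).congr fun t h0 _ => ?_
    have : t ^ weight w ≠ 0 := by positivity
    field_simp
    ring

/-- A non-constant polynomial is unbounded along `stuffleValue t [1] → ∞`, so a finite limit leaves
only its constant term. -/
lemma HasExpansion.eq_of_tendsto {f : ℝ → ℝ} {z : ℝ} (h : HasExpansion f z) {L : ℂ}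
    (hL : Tendsto (fun t => (f t : ℂ)) (𝓝[>] 0) (𝓝 L)) : (z : ℂ) = L := by
  obtain ⟨P, rfl, hP⟩ := h
  have hT := tendsto_stuffleValue_one
  have h1 : Tendsto (fun t => ((P.eval (stuffleValue t [1]) : ℝ) : ℂ)) (𝓝[>] 0) (𝓝 L) := by
    have h2 := hL.sub (Complex.continuous_ofReal.continuousAt.tendsto.comp hP.tendsto)
    rw [Complex.ofReal_zero, sub_zero] at h2
    refine h2.congr fun t => ?_
    simp
  have hdeg : P.degree ≤ 0 := by
    by_contra hdeg
    have h2 := (P.abs_tendsto_atTop (not_le.mp hdeg)).comp hT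
    have h3 := h1.norm
    simp only [Complex.norm_real] at h3
    exact not_tendsto_nhds_of_tendsto_atTop h2 _ h3
  rw [Polynomial.eq_C_of_degree_le_zero hdeg] at h1
  simp only [Polynomial.eval_C] at h1
  exact tendsto_nhds_unique tendsto_const_nhds h1

/-! ### Modular forms -/

/-- The point `i t / (2π)` of the upper half plane, where `q = e^{-t}`. -/
noncomputable def imagPoint (t : ℝ) (ht : 0 < t) : UpperHalfPlane :=
  ⟨Complex.I * ((t / (2 * Real.pi) : ℝ) : ℂ), by
    rw [Complex.I_mul_im, Complex.ofReal_re]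
    positivity⟩

lemma exp_imagPoint {t : ℝ} (ht : 0 < t) :
    Complex.exp (2 * Real.pi * Complex.I * (imagPoint t ht : ℂ)) = (Real.exp (-t) : ℂ) := by
  have h : (2 * Real.pi * Complex.I * (imagPoint t ht : ℂ) : ℂ) = ((-t : ℝ) : ℂ) := by
    change 2 * Real.pi * Complex.I * (Complex.I * ((t / (2 * Real.pi) : ℝ) : ℂ)) = _
    have : (Real.pi : ℂ) ≠ 0 := by exact_mod_cast Real.pi_ne_zero
    push_cast
    field_simp
    rw [Complex.I_sq]
    ring
  rw [h, ← Complex.ofReal_exp]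

lemma S_smul_imagPoint {t : ℝ} (ht : 0 < t) :
    ModularGroup.S • imagPoint t ht = imagPoint (4 * Real.pi ^ 2 / t) (by positivity) := by
  rw [UpperHalfPlane.modular_S_smul]
  apply UpperHalfPlane.ext
  change (-(Complex.I * ((t / (2 * Real.pi) : ℝ) : ℂ)))⁻¹ =
    Complex.I * ((4 * Real.pi ^ 2 / t / (2 * Real.pi) : ℝ) : ℂ)
  have h1 : (Real.pi : ℂ) ≠ 0 := by exact_mod_cast Real.pi_ne_zero
  have h2 : (t : ℂ) ≠ 0 := by exact_mod_cast ht.ne'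
  apply inv_eq_of_mul_eq_one_right
  push_cast
  field_simp
  rw [Complex.I_sq]
  norm_num

section

variable {k : ℤ} (f : ModularForm (Matrix.SpecialLinearGroup.mapGL (n := Fin 2) (R := ℤ) ℝ).range k)

lemma modularForm_S (z : UpperHalfPlane) : f (ModularGroup.S • z) = (z : ℂ) ^ k * f z := by
  have h := SlashInvariantForm.slash_action_eqn''
    (Γ := (Matrix.SpecialLinearGroup.mapGL (n := Fin 2) (R := ℤ) ℝ).range) f
    (γ := Matrix.SpecialLinearGroup.mapGL ℝ ModularGroup.S) ⟨_, rfl⟩ z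
  rw [← ModularGroup.denom_S z]
  exact h

/-- The matrix `-1` fixes `z` and has automorphy factor `-1`, hence `f z = -f z`. -/
lemma modularForm_eq_zero_of_odd (hk : Odd k) (z : UpperHalfPlane) : f z = 0 := by
  have h := SlashInvariantForm.slash_action_eqn''
    (Γ := (Matrix.SpecialLinearGroup.mapGL (n := Fin 2) (R := ℤ) ℝ).range) f
    (γ := Matrix.SpecialLinearGroup.mapGL ℝ (-1)) ⟨_, rfl⟩ z
  have h1 : Matrix.SpecialLinearGroup.mapGL ℝ (-1 : Matrix.SpecialLinearGroup (Fin 2) ℤ) • z = z := by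
    have := ModularGroup.SL_neg_smul 1 z
    rw [one_smul] at this
    exact this
  have h2 : UpperHalfPlane.denom (Matrix.SpecialLinearGroup.mapGL ℝ
      (-1 : Matrix.SpecialLinearGroup (Fin 2) ℤ)) z = -1 := by
    simp [UpperHalfPlane.denom]
  rw [h1, h2, hk.neg_one_zpow] at h
  have : 2 * f z = 0 := by linear_combination h
  simpa using this

end

/-- Dominated convergence, with the series at `s = 1` as majorant. -/
lemma tendsto_of_hasSum_exp {c : ℕ → ℂ} {F : ℝ → ℂ}
    (h : ∀ s : ℝ, 0 < s → HasSum (fun n => c n * (Real.exp (-s) : ℂ) ^ n) (F s)) :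
    Tendsto F atTop (𝓝 (c 0)) := by
  have h1 : Tendsto (fun s : ℝ => ∑' n, c n * (Real.exp (-s) : ℂ) ^ n) atTop
      (𝓝 (∑' n, if n = 0 then c 0 else 0)) := by
    refine tendsto_tsum_of_dominated_convergence (h 1 one_pos).summable.norm (fun n => ?_) ?_
    · rcases Nat.eq_zero_or_pos n with rfl | hn
      · simp
      · rw [if_neg hn.ne']
        have e1 : Tendsto (fun s : ℝ => (Real.exp (-s) : ℂ)) atTop (𝓝 ((0 : ℝ) : ℂ)) :=
          (Complex.continuous_ofReal.tendsto 0).comp Real.tendsto_exp_neg_atTop_nhds_zero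
        have e2 := (e1.pow n).const_mul (c n)
        simpa [hn.ne'] using e2
    · filter_upwards [eventually_ge_atTop 1] with s hs n
      rw [norm_mul, norm_mul, norm_pow, norm_pow, Complex.norm_real, Complex.norm_real,
        Real.norm_of_nonneg (Real.exp_pos _).le, Real.norm_of_nonneg (Real.exp_pos _).le]
      gcongr
  rw [tsum_ite_eq] at h1
  refine h1.congr' ?_
  filter_upwards [eventually_gt_atTop 0] with s hs
  exact (h s hs).tsum_eq

end CMES

/-! ### The theorem: comparison of the two limits -/

theorem proposition5p13
    (b : CMES.Mould ℚ) (hb : b.SatisfiesEDS)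
    (hb_one : ∀ k : ℕ+, b.coeff [k] = if 2 ≤ (k : ℕ) then
      -(bernoulli (k : ℕ) / (2 * (Nat.factorial (k : ℕ) : ℚ))) else 0)
    (k : ℕ) (hk : 4 ≤ k)
    (ε : List ℕ+ →₀ ℚ) (hε : ∀ w ∈ ε.support, (w.map fun i : ℕ+ => (i : ℕ)).sum = k)
    (f : ModularForm (Matrix.SpecialLinearGroup.mapGL (n := Fin 2) (R := ℤ) ℝ).range (k : ℤ))
    (hf : ∀ τ : UpperHalfPlane,
      HasSum (fun n : ℕ =>
        (((PowerSeries.coeff n (ε.sum fun w c => c • CMES.G b w) : ℚ) : ℂ)) *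
          Complex.exp (2 * Real.pi * Complex.I * (τ : ℂ)) ^ n) (f τ)) :
    ((ε.sum fun w c => (c : ℝ) * CMES.zetaStar w : ℝ) : ℂ) =
      (2 * Real.pi * Complex.I) ^ k * ((ε.sum fun w c => c * b.coeff w : ℚ) : ℂ) := by
  classical
  have h1 : b.coeff [1] = 0 := by simpa using hb_one 1
  have hne : ∀ w ∈ ε.support, w ≠ [] := by
    rintro w hw rfl
    have := hε [] hw
    simp at this
    omega
  have hwt : ∀ w ∈ ε.support, CMES.weight w = k := hε
  set Q : PowerSeries ℚ := ε.sum fun w c => c • CMES.G b w with hQ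
  have hQ0 : PowerSeries.coeff 0 Q = ε.sum fun w c => c * b.coeff w := by
    rw [hQ, Finsupp.sum, Finsupp.sum, map_sum]
    refine Finset.sum_congr rfl fun w hw => ?_
    rw [map_smul, CMES.coeff_zero_G hb h1 (hne w hw), smul_eq_mul]
  have hpoint : ∀ s : ℝ, ∀ hs : 0 < s, HasSum (fun n : ℕ =>
      ((PowerSeries.coeff n Q : ℚ) : ℂ) * (Real.exp (-s) : ℂ) ^ n) (f (CMES.imagPoint s hs)) := by
    intro s hs
    have := hf (CMES.imagPoint s hs)
    rwa [CMES.exp_imagPoint] at this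
  -- The form on the imaginary axis as a function on all of `ℝ`, so that limits can be taken; the
  -- value `0` for `s ≤ 0` plays no role.
  set F : ℝ → ℂ := fun s => if hs : 0 < s then f (CMES.imagPoint s hs) else 0 with hF
  have hFpos : ∀ s (hs : 0 < s), F s = f (CMES.imagPoint s hs) := fun s hs => dif_pos hs
  have hFlim : Tendsto F atTop (𝓝 ((PowerSeries.coeff 0 Q : ℚ) : ℂ)) :=
    CMES.tendsto_of_hasSum_exp (c := fun n => ((PowerSeries.coeff n Q : ℚ) : ℂ))
      fun s hs => by rw [hFpos s hs]; exact hpoint s hs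
  have hv : ∀ w, ∃ v : ℝ → ℝ, w ∈ ε.support →
      (∀ t, 0 < t → t ≤ 1 → CMES.EvalsTo (CMES.G b w) t (v t)) ∧
        CMES.HasExpansion (fun t => t ^ CMES.weight w * v t) (CMES.zetaStar w) := by
    intro w
    by_cases hw : w ∈ ε.support
    · obtain ⟨v, hv⟩ := CMES.exists_evalsTo_G hb h1 (hne w hw)
      exact ⟨v, fun _ => hv⟩
    · exact ⟨0, fun h => absurd h hw⟩
  choose v hv using hv
  set V : ℝ → ℝ := fun t => ∑ w ∈ ε.support, (ε w : ℝ) * v w t with hV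
  have hVF : ∀ t, 0 < t → t ≤ 1 → (V t : ℂ) = F t := by
    intro t h0 ht1
    have e1 : CMES.EvalsTo Q t (V t) := CMES.EvalsTo.finset_sum _ fun w hw =>
      ((hv w hw).1 t h0 ht1).smul _
    have e2 : HasSum (fun n : ℕ => ((PowerSeries.coeff n Q : ℚ) : ℂ) * (Real.exp (-t) : ℂ) ^ n)
        (V t : ℂ) := by
      have := Complex.hasSum_ofReal.mpr e1
      refine this.congr_fun fun n => ?_
      push_cast
      rfl
    rw [hFpos t h0]
    exact e2.unique (hpoint t h0)
  have hexp : CMES.HasExpansion (fun t => t ^ k * V t)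
      (∑ w ∈ ε.support, (ε w : ℝ) * CMES.zetaStar w) := by
    have := CMES.HasExpansion.finset_sum ε.support fun w hw => ((hv w hw).2.const_mul (ε w))
    refine this.of_sub (CMES.IsSmall.zero.congr fun t _ _ => ?_)
    rw [hV, Finset.mul_sum, ← Finset.sum_sub_distrib]
    refine Finset.sum_eq_zero fun w hw => ?_
    rw [hwt w hw]
    ring
  have hpi : (Real.pi : ℂ) ≠ 0 := by exact_mod_cast Real.pi_ne_zero
  -- Modularity under `S`: since `-2πi · it/2π = t`, the function `t^k F(t)` is `(-2πi)^k F(4π²/t)`,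
  -- and `4π²/t → ∞`.
  have hlim : Tendsto (fun t : ℝ => ((t ^ k * V t : ℝ) : ℂ)) (𝓝[>] 0)
      (𝓝 ((-(2 * Real.pi * Complex.I)) ^ k * ((PowerSeries.coeff 0 Q : ℚ) : ℂ))) := by
    have e1 : Tendsto (fun t : ℝ => 4 * Real.pi ^ 2 / t) (𝓝[>] 0) atTop := by
      simp only [div_eq_mul_inv]
      exact tendsto_inv_nhdsGT_zero.const_mul_atTop (by positivity)
    refine ((hFlim.comp e1).const_mul _).congr' ?_
    filter_upwards [Ioc_mem_nhdsGT (show (0 : ℝ) < 1 by norm_num)] with t ht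
    have h0 := ht.1
    have e2 := CMES.modularForm_S f (CMES.imagPoint t h0)
    rw [CMES.S_smul_imagPoint, ← hFpos, ← hFpos, ← hVF t h0 ht.2] at e2
    rw [Function.comp_apply, e2, zpow_natCast, ← mul_assoc, ← mul_pow]
    have e3 : -(2 * Real.pi * Complex.I) * (CMES.imagPoint t h0 : ℂ) = t := by
      change -(2 * Real.pi * Complex.I) * (Complex.I * ((t / (2 * Real.pi) : ℝ) : ℂ)) = t
      push_cast
      field_simp
      rw [Complex.I_sq]
      ring
    rw [e3]
    push_cast
    rfl
  have hmain := hexp.eq_of_tendsto hlim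
  rw [Finsupp.sum, hmain, ← hQ0]
  -- The limit carries `(-2πi)^k` instead of `(2πi)^k`. The signs agree for even `k`, and for odd
  -- `k` the constant term is zero.
  rcases Nat.even_or_odd k with hk' | hk'
  · rw [hk'.neg_pow]
  · have hzero : ((PowerSeries.coeff 0 Q : ℚ) : ℂ) = 0 := by
      refine tendsto_nhds_unique hFlim (tendsto_const_nhds.congr' ?_)
      filter_upwards [eventually_gt_atTop 0] with s hs
      rw [hFpos s hs, CMES.modularForm_eq_zero_of_odd f (by exact_mod_cast hk')]
    rw [hzero, mul_zero, mul_zero]
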